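/- Let $\mathfrak g$ be a finite-dimensional simple Lie superalgebra over $\mathbb C$, let $A\neq 0$ be a finitely generated commutative associative unital $\mathbb C$-algebra, and let $\Gamma$ be a finite abelian group acting on $\mathfrak g$ by Lie superalgebra automorphisms and on $A$ by $\mathbb C$-algebra automorphisms, such that the induced action on the set $\operatorname{MaxSpec}A$ of maximal ideals is free. Let $(\mathfrak g\otimes A)^\Gamma$ be the Lie superalgebra of fixed points of $\Gamma$ in $\mathfrak g\otimes A$. For $\mathsf m\in\operatorname{MaxSpec}A$ and $n>0$ let $\mathrm{ev}^\Gamma_{\mathsf m^n}\colon(\mathfrak g\otimes A)^\Gamma\to\mathfrak g\otimes A/\mathsf m^n$ be the canonical homomorphism; for a $\mathfrak g\otimes A/\mathsf m^n$-module $M$ denote by $\mathrm{ev}^\Gamma_{\mathsf m^n}M$ its pull-back. Conventions. Modules and their submodules are $\mathbb Z_2$-graded; irreducibility and indecomposability refer to graded submodules. A homomorphism $V\to W$ of $\mathfrak a$-modules of parity $z\in\{\bar 0,\bar 1\}$ is a linear map $f$ of parity $z$ with $f(xv)=(-1)^{z|x|}xf(v)$; $\operatorname{Hom}_{\mathfrak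 a}(V,W)=\operatorname{Hom}_{\mathfrak a}(V,W)_{\bar 0}\oplus\operatorname{Hom}_{\mathfrak a}(V,W)_{\bar 1}$, and an isomorphism is a bijective, not necessarily homogeneous, element of it. The group $\operatorname{Ext}^p_{\mathfrak a}(V,U)$ is the $p$-th cohomology of the Chevalley–Eilenberg cochain complex $\operatorname{Hom}_{\mathbb C}(\Lambda^\bullet\mathfrak a\otimes V,U)$, and $H^p(\mathfrak a,U)=\operatorname{Ext}^p_{\mathfrak a}(\mathbb C,U)$. If $V_1,V_2$ are finite-dimensional irreducible modules over $\mathfrak g^1,\mathfrak g^2$, then $V_1\widehat\otimes V_2$ is the $\mathfrak g^1\oplus\mathfrak g^2$-module $V_1\otimes V_2$ if this is irreducible; otherwise $V_1,V_2$ have odd endomorphisms $\varphi_1,\varphi_2$ with $\varphi_i^2=-1$, and $V_1\widehat\otimes V_2=\{v\in V_1\otimes V_2:(\sqrt{-1}\,\varphi_1\otimes\varphi_2)v=v\}$. Put $V_1\widehat\otimes\cdots\widehat\otimes V_\ell=(V_1\widehat\otimes\cdots\widehat\otimes V_{\ell-1})\widehat\otimes V_\ell$ (the empty product being the trivial module $\mathbb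 C$) and $$\kappa(V_1,\dots,V_\ell)=\sum_{i=2}^\ell\dim\operatorname{End}_{\mathfrak g^1\oplus\cdots\oplus\mathfrak g^{i-1}}(V_1\widehat\otimes\cdots\widehat\otimes V_{i-1})_{\bar1}\cdot\dim\operatorname{End}_{\mathfrak g^i}(V_i)_{\bar1}.$$ Let $\mathcal P$ be the set of $\Gamma$-equivariant functions $\pi$ that assign to each $\mathsf m\in\operatorname{MaxSpec}A$ an integer $n(\mathsf m)>0$ and an isomorphism class $\pi(\mathsf m)$ of finite-dimensional irreducible $\mathfrak g\otimes A/\mathsf m^{n(\mathsf m)}$-modules, trivial for all but finitely many $\mathsf m$; equivariance means that $n(\gamma\mathsf m)=n(\mathsf m)$ and that $\pi(\gamma\mathsf m)$ is the class of $\pi(\mathsf m)$ with $x$ acting as $\gamma^{-1}x$. For $\pi\in\mathcal P$ choose representatives of the classes $\pi(\mathsf m)$ and a set $\operatorname{Supp}_*(\pi)=\{\mathsf n_1,\dots,\mathsf n_r\}$ containing exactly one element of each $\Gamma$-orbit of maximal ideals $\mathsf m$ with $\pi(\mathsf m)$ nontrivial. Let $\mathcal V(\pi)$ be the $(\mathfrak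 g\otimes A)^\Gamma$-module $\widehat{\bigotimes}_{i=1}^{r}\mathrm{ev}^\Gamma_{\mathsf n_i^{n(\mathsf n_i)}}\pi(\mathsf n_i)$, that is, the pull-back of the $\bigoplus_i\mathfrak g\otimes A/\mathsf n_i^{n(\mathsf n_i)}$-module $\pi(\mathsf n_1)\widehat\otimes\cdots\widehat\otimes\pi(\mathsf n_r)$, and let $\kappa(\pi)=\kappa(\pi(\mathsf n_1),\dots,\pi(\mathsf n_r))$. Proposition. Let $\pi,\pi'\in\mathcal P$. Whatever the choices above, there exist positive integers $n,\ell,q_1,\dots,q_\ell$, maximal ideals $\mathsf m_1,\dots,\mathsf m_\ell$ of $A$ in distinct $\Gamma$-orbits and, for $1\le i\le\ell$ and $1\le j\le q_i$, finite-dimensional indecomposable $\mathfrak g\otimes A/\mathsf m_i^n$-modules $M_{i,j}$, such that there are an isomorphism of $(\mathfrak g\otimes A)^\Gamma$-modules $$\operatorname{Hom}_{\mathbb C}(\mathcal V(\pi),\mathcal V(\pi'))^{\oplus2^{\kappa(\pi)+\kappa(\pi')}}\cong\bigoplus_{\substack{1\le j_i\le q_i\\1\le i\le\ell}}\mathrm{ev}^\Gamma_{\mathsf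 m_1^n}M_{1,j_1}\otimes\cdots\otimes\mathrm{ev}^\Gamma_{\mathsf m_\ell^n}M_{\ell,j_\ell}$$ and, for all $p>0$, an isomorphism of vector spaces $$\operatorname{Ext}^p_{(\mathfrak g\otimes A)^\Gamma}(\mathcal V(\pi),\mathcal V(\pi'))^{\oplus2^{\kappa(\pi)+\kappa(\pi')}}\cong\bigoplus_{\substack{1\le j_i\le q_i\\1\le i\le\ell}}H^p\bigl((\mathfrak g\otimes A)^\Gamma,\ \mathrm{ev}^\Gamma_{\mathsf m_1^n}M_{1,j_1}\otimes\cdots\otimes\mathrm{ev}^\Gamma_{\mathsf m_\ell^n}M_{\ell,j_\ell}\bigr).$$ -/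

import Mathlib

open scoped TensorProduct

universe u v w t

/-- The sign `(-1)^{ij}` of two parities. -/
def ksgn (i j : ZMod 2) : ℂ := (-1) ^ (i.val * j.val)

@[simp] lemma ksgn_zero_left (j : ZMod 2) : ksgn 0 j = 1 := by simp [ksgn]
@[simp] lemma ksgn_zero_right (i : ZMod 2) : ksgn i 0 = 1 := by simp [ksgn]
@[simp] lemma ksgn_one_one : ksgn 1 1 = -1 := by simp [ksgn, ZMod.val_one]

lemma zmod2_cases (i : ZMod 2) : i = 0 ∨ i = 1 := by
  revert i; decide

lemma zmod2_one_add_one : (1 : ZMod 2) + 1 = 0 := by decide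

/-- A super space: a complex vector space `V = V₀ ⊕ V₁`. -/
structure SuperSpace where
  carrier : Type u
  [acg : AddCommGroup carrier]
  [mod : Module ℂ carrier]
  gr : ZMod 2 → Submodule ℂ carrier
  compl : IsCompl (gr 0) (gr 1)

namespace SuperSpace

instance : CoeSort SuperSpace.{u} (Type u) := ⟨carrier⟩
instance (V : SuperSpace.{u}) : AddCommGroup V := V.acg
instance (V : SuperSpace.{u}) : Module ℂ V := V.mod

/-- The projection of `V = V₀ ⊕ V₁` onto `V_i`. -/
noncomputable def proj (V : SuperSpace.{u}) (i : ZMod 2) : V →ₗ[ℂ] V :=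
  if i = 0 then (V.gr 0).projection (V.gr 1) V.compl
  else (V.gr 1).projection (V.gr 0) V.compl.symm

/-- The parity operator `v ↦ (-1)^{|v|} v`. -/
noncomputable def parity (V : SuperSpace.{u}) : V →ₗ[ℂ] V := V.proj 0 - V.proj 1

variable (V W : SuperSpace.{u})

lemma proj_mem (i : ZMod 2) (v : V) : V.proj i v ∈ V.gr i := by
  rcases zmod2_cases i with rfl | rfl <;> simp [proj]

lemma proj_of_mem {i : ZMod 2} {v : V} (hv : v ∈ V.gr i) : V.proj i v = v := by
  rcases zmod2_cases i with rfl | rfl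
  · simpa [proj] using Submodule.projection_apply_of_mem_left V.compl hv
  · simpa [proj] using Submodule.projection_apply_of_mem_left V.compl.symm hv

lemma proj_of_mem' {i : ZMod 2} {v : V} (hv : v ∈ V.gr i) : V.proj (i + 1) v = 0 := by
  rcases zmod2_cases i with rfl | rfl
  · simpa [proj] using (Submodule.projection_apply_eq_zero_iff V.compl.symm).2 hv
  · simpa [proj, zmod2_one_add_one] using (Submodule.projection_apply_eq_zero_iff V.compl).2 hv

lemma proj_add (v : V) : V.proj 0 v + V.proj 1 v = v := by
  have h : v ∈ V.gr 0 ⊔ V.gr 1 := by rw [V.compl.sup_eq_top]; trivial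
  obtain ⟨a, ha, b, hb, rfl⟩ := Submodule.mem_sup.1 h
  have h1 := V.proj_of_mem' ha
  have h2 := V.proj_of_mem' hb
  rw [zmod2_one_add_one] at h2
  rw [zero_add] at h1
  simp [V.proj_of_mem ha, V.proj_of_mem hb, h1, h2]

lemma parity_of_mem {i : ZMod 2} {v : V} (hv : v ∈ V.gr i) : V.parity v = ksgn 1 i • v := by
  have h1 := V.proj_of_mem' hv
  have h0 := V.proj_of_mem hv
  rcases zmod2_cases i with rfl | rfl
  · rw [zero_add] at h1
    simp [parity, h0, h1]
  · rw [zmod2_one_add_one] at h1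
    simp [parity, h0, h1]

lemma mem_gr_iff {i : ZMod 2} {v : V} : v ∈ V.gr i ↔ V.parity v = ksgn 1 i • v := by
  refine ⟨V.parity_of_mem, fun h => ?_⟩
  have h2 := V.proj_add v
  have key : ∀ a b : V, a = -a → a = 0 := fun a _ ha => by
    have h3 : (2 : ℂ) • a = 0 := by rw [two_smul]; nth_rewrite 2 [ha]; simp
    simpa using h3
  rcases zmod2_cases i with rfl | rfl
  · simp only [parity, ksgn_zero_right, one_smul, LinearMap.sub_apply] at h
    have h3 : V.proj 1 v = 0 := by
      apply key _ v
      nth_rewrite 3 [← h2] at h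
      rw [sub_eq_add_neg] at h
      exact (add_left_cancel h).symm
    rw [h3, add_zero] at h2
    rw [← h2]; exact V.proj_mem _ _
  · simp only [parity, ksgn_one_one, neg_smul, one_smul, LinearMap.sub_apply] at h
    have h3 : V.proj 0 v = 0 := by
      apply key _ v
      nth_rewrite 3 [← h2] at h
      rw [neg_add, sub_eq_add_neg] at h
      exact add_right_cancel h
    rw [h3, zero_add] at h2
    rw [← h2]; exact V.proj_mem _ _

@[simp] lemma parity_parity (v : V) : V.parity (V.parity v) = v := by
  conv_lhs => rw [← V.proj_add v]
  have h0 := V.parity_of_mem (V.proj_mem 0 v)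
  have h1 := V.parity_of_mem (V.proj_mem 1 v)
  simp only [map_add, h0, h1, map_smul, smul_smul]
  simpa using V.proj_add v

lemma parity_comp_parity : V.parity ∘ₗ V.parity = LinearMap.id :=
  LinearMap.ext V.parity_parity

/-- Complementarity of `G 0` and `G 1` from an operator which is `1` on the first and `-1` on the
second. -/
lemma isCompl_of_parity {E : Type*} [AddCommGroup E] [Module ℂ E] (G : ZMod 2 → Submodule ℂ E)
    (s : E →ₗ[ℂ] E) (hs : ∀ i, ∀ v ∈ G i, s v = ksgn 1 i • v) (hG : ∀ v, v ∈ G 0 ⊔ G 1) :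
    IsCompl (G 0) (G 1) := by
  refine ⟨?_, ?_⟩
  · rw [Submodule.disjoint_def]
    intro x h0 h1
    have a := hs 0 x h0
    have b := hs 1 x h1
    simp only [ksgn_zero_right, one_smul, ksgn_one_one, neg_smul] at a b
    have h3 : (2 : ℂ) • x = 0 := by
      rw [two_smul]; nth_rewrite 1 [← a]; rw [b]; simp
    simpa using h3
  · rw [codisjoint_iff, eq_top_iff]
    exact fun v _ => hG v

/-- An operator acting by `(-1)^i` on `V_i` is the parity operator. -/
lemma parity_eq_of (s : V →ₗ[ℂ] V) (hs : ∀ i, ∀ v ∈ V.gr i, s v = ksgn 1 i • v) :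
    V.parity = s := by
  ext v
  rw [← V.proj_add v, map_add, map_add, V.parity_of_mem (V.proj_mem 0 v),
    V.parity_of_mem (V.proj_mem 1 v), hs 0 _ (V.proj_mem 0 v), hs 1 _ (V.proj_mem 1 v)]

/-- The one-dimensional even super space. -/
noncomputable def triv : SuperSpace.{u} where
  carrier := ULift.{u} ℂ
  gr i := if i = 0 then ⊤ else ⊥
  compl := by simpa using isCompl_top_bot

/-- Direct sum of a (finite) family of super spaces. -/
def pi {ι : Type v} (V : ι → SuperSpace.{u}) : SuperSpace.{max u v} where
  carrier := ∀ i, V i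
  gr z := Submodule.pi Set.univ fun i => (V i).gr z
  compl := by
    refine isCompl_of_parity (fun z => Submodule.pi Set.univ fun i => (V i).gr z)
      (LinearMap.pi fun i => (V i).parity ∘ₗ LinearMap.proj i) ?_ ?_
    · intro z v hv
      ext i
      exact (V i).parity_of_mem (hv i trivial)
    · intro v
      refine Submodule.mem_sup.2 ⟨fun i => (V i).proj 0 (v i), fun i _ => (V i).proj_mem _ _,
        fun i => (V i).proj 1 (v i), fun i _ => (V i).proj_mem _ _, ?_⟩
      ext i
      exact (V i).proj_add _

/-- `(V ⊗ W)_z`: the span of the `v ⊗ w` with `|v| + |w| = z`. -/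
def tensorGr (V : SuperSpace.{u}) (W : SuperSpace.{v}) (z : ZMod 2) :
    Submodule ℂ (V ⊗[ℂ] W) :=
  Submodule.span ℂ {s | ∃ i j : ZMod 2, i + j = z ∧ ∃ v ∈ V.gr i, ∃ w ∈ W.gr j, s = v ⊗ₜ[ℂ] w}

lemma tensorGr_parity (V : SuperSpace.{u}) (W : SuperSpace.{v}) (z : ZMod 2) (s : V ⊗[ℂ] W)
    (hs : s ∈ tensorGr V W z) : TensorProduct.map V.parity W.parity s = ksgn 1 z • s := by
  induction hs using Submodule.span_induction with
  | mem x hx =>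
    obtain ⟨i, j, rfl, v, hv, w, hw, rfl⟩ := hx
    rw [TensorProduct.map_tmul, V.parity_of_mem hv, W.parity_of_mem hw]
    rcases zmod2_cases i with rfl | rfl <;> rcases zmod2_cases j with rfl | rfl <;>
      simp [zmod2_one_add_one, TensorProduct.neg_tmul, TensorProduct.tmul_neg]
  | zero => simp
  | add x y _ _ hx hy => rw [map_add, hx, hy, smul_add]
  | smul a x _ hx => rw [map_smul, hx, smul_comm]

/-- The super space `V ⊗ W`. -/
def tensor (V : SuperSpace.{u}) (W : SuperSpace.{v}) : SuperSpace.{max u v} where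
  carrier := V ⊗[ℂ] W
  gr z := tensorGr V W z
  compl := by
    refine isCompl_of_parity (tensorGr V W)
      (TensorProduct.map V.parity W.parity) (tensorGr_parity V W) ?_
    intro s
    induction s using TensorProduct.induction_on with
    | zero => exact Submodule.zero_mem _
    | add x y hx hy => exact Submodule.add_mem _ hx hy
    | tmul v w =>
      rw [← V.proj_add v, ← W.proj_add w, TensorProduct.add_tmul, TensorProduct.tmul_add,
        TensorProduct.tmul_add]
      refine Submodule.add_mem _ (Submodule.add_mem _ ?_ ?_) (Submodule.add_mem _ ?_ ?_)
      · exact Submodule.mem_sup_left (Submodule.subset_span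
          ⟨0, 0, by decide, _, V.proj_mem _ _, _, W.proj_mem _ _, rfl⟩)
      · exact Submodule.mem_sup_right (Submodule.subset_span
          ⟨0, 1, by decide, _, V.proj_mem _ _, _, W.proj_mem _ _, rfl⟩)
      · exact Submodule.mem_sup_right (Submodule.subset_span
          ⟨1, 0, by decide, _, V.proj_mem _ _, _, W.proj_mem _ _, rfl⟩)
      · exact Submodule.mem_sup_left (Submodule.subset_span
          ⟨1, 1, by decide, _, V.proj_mem _ _, _, W.proj_mem _ _, rfl⟩)

lemma parity_tensor (V : SuperSpace.{u}) (W : SuperSpace.{v}) :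
    (tensor V W).parity = TensorProduct.map V.parity W.parity :=
  parity_eq_of (tensor V W) _ (tensorGr_parity V W)

/-- `Hom_ℂ(V, W)_z`: the linear maps with `f(V_i) ⊆ W_{i+z}`. -/
def homGr (V : SuperSpace.{u}) (W : SuperSpace.{v}) (z : ZMod 2) : Submodule ℂ (V →ₗ[ℂ] W) where
  carrier := {f | ∀ i, ∀ v ∈ V.gr i, f v ∈ W.gr (i + z)}
  add_mem' hf hg i v hv := Submodule.add_mem _ (hf i v hv) (hg i v hv)
  zero_mem' _ _ _ := Submodule.zero_mem _
  smul_mem' a _ hf i v hv := Submodule.smul_mem _ a (hf i v hv)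

/-- The operator `f ↦ (-1)^{i|f|} f` on `Hom_ℂ(V, W)`. -/
noncomputable def twist (V : SuperSpace.{u}) (W : SuperSpace.{v}) (i : ZMod 2)
    (f : V →ₗ[ℂ] W) : V →ₗ[ℂ] W :=
  if i = 0 then f else W.parity ∘ₗ f ∘ₗ V.parity

lemma twist_one_of_mem {V : SuperSpace.{u}} {W : SuperSpace.{v}} {z : ZMod 2} {f : V →ₗ[ℂ] W}
    (hf : f ∈ homGr V W z) : twist V W 1 f = ksgn 1 z • f := by
  have key : ∀ i, ∀ v ∈ V.gr i, W.parity (f (V.parity v)) = ksgn 1 z • f v := by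
    intro i v hv
    rw [V.parity_of_mem hv, map_smul, map_smul, W.parity_of_mem (hf i v hv), smul_smul]
    rcases zmod2_cases i with rfl | rfl <;> rcases zmod2_cases z with rfl | rfl <;>
      simp [zmod2_one_add_one]
  ext v
  have h0 := key 0 _ (V.proj_mem 0 v)
  have h1 := key 1 _ (V.proj_mem 1 v)
  simp only [twist, one_ne_zero, if_false, LinearMap.comp_apply, LinearMap.smul_apply]
  rw [← V.proj_add v]
  simp only [map_add, h0, h1, smul_add]

lemma mem_homGr_of_twist {V : SuperSpace.{u}} {W : SuperSpace.{v}} {z : ZMod 2} {f : V →ₗ[ℂ] W}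
    (hf : twist V W 1 f = ksgn 1 z • f) : f ∈ homGr V W z := by
  intro i v hv
  rw [mem_gr_iff]
  have h := LinearMap.congr_fun hf (V.parity v)
  simp only [twist, one_ne_zero, if_false, LinearMap.comp_apply, LinearMap.smul_apply,
    parity_parity] at h
  rw [h, V.parity_of_mem hv, map_smul, smul_smul]
  rcases zmod2_cases i with rfl | rfl <;> rcases zmod2_cases z with rfl | rfl <;>
      simp [zmod2_one_add_one]

/-- The super space `Hom_ℂ(V, W)`. -/
def hom (V : SuperSpace.{u}) (W : SuperSpace.{v}) : SuperSpace.{max u v} where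
  carrier := V →ₗ[ℂ] W
  gr z := homGr V W z
  compl := by
    refine isCompl_of_parity (homGr V W)
      ((LinearMap.lcomp ℂ W V.parity).comp (W.parity.compRight ℂ)) ?_ ?_
    · intro z f hf
      exact twist_one_of_mem hf
    · intro f
      have hh : twist V W 1 (twist V W 1 f) = f := by
        ext v; simp [twist]
      have hadd : ∀ a b : ℂ, twist V W 1 (a • f + b • twist V W 1 f)
          = a • twist V W 1 f + b • f := by
        intro a b
        ext v; simp [twist]
      refine Submodule.mem_sup.2 ⟨(1/2 : ℂ) • f + (1/2 : ℂ) • twist V W 1 f, ?_,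
        (1/2 : ℂ) • f + (-1/2 : ℂ) • twist V W 1 f, ?_, ?_⟩
      · apply mem_homGr_of_twist
        rw [hadd]; simp [add_comm]
      · apply mem_homGr_of_twist
        rw [hadd]; simp only [ksgn_one_one]; module
      · module

lemma parity_hom (V : SuperSpace.{u}) (W : SuperSpace.{v}) (f : hom V W) :
    (hom V W).parity f = twist V W 1 f := by
  have := parity_eq_of (hom V W) ((LinearMap.lcomp ℂ W V.parity).comp (W.parity.compRight ℂ))
    (fun z f hf => twist_one_of_mem hf)
  rw [this]; rfl

/-- A subspace `N ⊆ V` is graded if it contains the homogeneous components of its elements. -/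
def IsGraded {V : SuperSpace.{u}} (N : Submodule ℂ V) : Prop :=
  ∀ v ∈ N, ∀ i, V.proj i v ∈ N

/-- A graded subspace as a super space. -/
def sub (V : SuperSpace.{u}) (N : Submodule ℂ V) (hN : IsGraded N) : SuperSpace.{u} where
  carrier := N
  gr i := (V.gr i).comap N.subtype
  compl := by
    have hp : ∀ v ∈ N, V.parity v ∈ N := fun v hv =>
      Submodule.sub_mem _ (hN v hv 0) (hN v hv 1)
    refine isCompl_of_parity (fun i => (V.gr i).comap N.subtype) (V.parity.restrict hp) ?_ ?_
    · intro i v hv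
      apply Subtype.ext
      exact V.parity_of_mem hv
    · intro v
      refine Submodule.mem_sup.2 ⟨⟨_, hN v v.2 0⟩, V.proj_mem _ _, ⟨_, hN v v.2 1⟩,
        V.proj_mem _ _, ?_⟩
      apply Subtype.ext
      exact V.proj_add _

lemma isGraded_of_parity {V : SuperSpace.{u}} {N : Submodule ℂ V}
    (h : ∀ v ∈ N, V.parity v ∈ N) : IsGraded N := by
  intro v hv i
  have e := V.proj_add v
  have e' : V.proj 0 v - V.proj 1 v = V.parity v := rfl
  rcases zmod2_cases i with rfl | rfl
  · have : V.proj 0 v = (1/2 : ℂ) • (v + V.parity v) := by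
      rw [← e']; nth_rewrite 2 [← e]; module
    rw [this]
    exact Submodule.smul_mem _ _ (Submodule.add_mem _ hv (h v hv))
  · have : V.proj 1 v = (1/2 : ℂ) • (v - V.parity v) := by
      rw [← e']; nth_rewrite 2 [← e]; module
    rw [this]
    exact Submodule.smul_mem _ _ (Submodule.sub_mem _ hv (h v hv))

end SuperSpace

/-- A Lie superalgebra over `ℂ`. -/
structure LieSuper extends SuperSpace.{u} where
  bracket : carrier →ₗ[ℂ] carrier →ₗ[ℂ] carrier
  bracket_mem : ∀ {i j : ZMod 2} {x y : carrier}, x ∈ gr i → y ∈ gr j → bracket x y ∈ gr (i + j)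
  bracket_skew : ∀ {i j : ZMod 2} {x y : carrier}, x ∈ gr i → y ∈ gr j →
    bracket x y = -(ksgn i j • bracket y x)
  bracket_jacobi : ∀ {i j : ZMod 2} {x y : carrier} (z : carrier), x ∈ gr i → y ∈ gr j →
    bracket x (bracket y z) = bracket (bracket x y) z + ksgn i j • bracket y (bracket x z)

namespace LieSuper

instance : CoeSort LieSuper.{u} (Type u) := ⟨fun g => g.carrier⟩

/-- A (graded) ideal of a Lie superalgebra. -/
structure IsIdeal (g : LieSuper.{u}) (I : Submodule ℂ g) : Prop where
  graded : SuperSpace.IsGraded (V := g.toSuperSpace) I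
  bracket_mem : ∀ x : g, ∀ y ∈ I, g.bracket x y ∈ I

/-- A Lie superalgebra is simple if it is not abelian and its only ideals are `0` and itself. -/
structure IsSimple (g : LieSuper.{u}) : Prop where
  non_abelian : g.bracket ≠ 0
  eq_bot_or_eq_top : ∀ I : Submodule ℂ g, g.IsIdeal I → I = ⊥ ∨ I = ⊤

/-- (Even) homomorphisms of Lie superalgebras. -/
structure Hom (g : LieSuper.{u}) (h : LieSuper.{v}) where
  toLin : g →ₗ[ℂ] h
  map_gr : ∀ {i : ZMod 2} {x : g}, x ∈ g.gr i → toLin x ∈ h.gr i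
  map_bracket : ∀ x y : g, toLin (g.bracket x y) = h.bracket (toLin x) (toLin y)

/-- The composite `ψ ∘ φ`. -/
def Hom.comp {g : LieSuper.{u}} {h : LieSuper.{v}} {k : LieSuper.{w}} (ψ : Hom h k)
    (φ : Hom g h) : Hom g k where
  toLin := ψ.toLin ∘ₗ φ.toLin
  map_gr hx := ψ.map_gr (φ.map_gr hx)
  map_bracket x y := by simp [φ.map_bracket, ψ.map_bracket]

/-- The direct sum of a finite family of Lie superalgebras. -/
def pi {ι : Type v} (g : ι → LieSuper.{u}) : LieSuper.{max u v} where
  toSuperSpace := SuperSpace.pi fun i => (g i).toSuperSpace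
  bracket := LinearMap.mk₂ ℂ (fun (x y : ∀ i, g i) i => (g i).bracket (x i) (y i))
    (fun x x' y => funext fun i => LinearMap.congr_fun (map_add (g i).bracket (x i) (x' i)) (y i))
    (fun c x y => funext fun i => LinearMap.congr_fun (map_smul (g i).bracket c (x i)) (y i))
    (fun x y y' => funext fun i => map_add ((g i).bracket (x i)) (y i) (y' i))
    (fun c x y => funext fun i => map_smul ((g i).bracket (x i)) c (y i))
  bracket_mem hx hy i _ := (g i).bracket_mem (hx i trivial) (hy i trivial)
  bracket_skew hx hy := funext fun i => (g i).bracket_skew (hx i trivial) (hy i trivial)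
  bracket_jacobi z hx hy :=
    funext fun i => (g i).bracket_jacobi (z i) (hx i trivial) (hy i trivial)

/-- The projection of a direct sum to a summand. -/
def piProj {ι : Type v} (g : ι → LieSuper.{u}) (i : ι) : Hom (pi g) (g i) where
  toLin := LinearMap.proj (R := ℂ) (φ := fun i => (g i).carrier) i
  map_gr hx := hx i trivial
  map_bracket _ _ := rfl

/-- The homomorphism to a direct sum with given components. -/
def piLift {ι : Type v} (g : ι → LieSuper.{u}) {h : LieSuper.{w}} (φ : ∀ i, Hom h (g i)) :
    Hom h (pi g) where
  toLin := LinearMap.pi (φ := fun i => (g i).carrier) fun i => (φ i).toLin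
  map_gr hx i _ := (φ i).map_gr hx
  map_bracket x y := funext fun i => (φ i).map_bracket x y

section MapAlgebra

variable (g : LieSuper.{u}) (A : Type v) [CommRing A] [Algebra ℂ A]

/-- `(g ⊗ A)_z = g_z ⊗ A`. -/
def mapGr (z : ZMod 2) : Submodule ℂ (g.carrier ⊗[ℂ] A) :=
  Submodule.span ℂ {s | ∃ x ∈ g.gr z, ∃ a : A, s = x ⊗ₜ[ℂ] a}

variable {g A} in
@[elab_as_elim]
lemma mapGr_induction {z : ZMod 2} {P : ∀ s : g.carrier ⊗[ℂ] A, s ∈ mapGr g A z → Prop}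
    (tmul : ∀ x (hx : x ∈ g.gr z) (a : A), P (x ⊗ₜ a) (Submodule.subset_span ⟨x, hx, a, rfl⟩))
    (add : ∀ s s' hs hs', P s hs → P s' hs' → P (s + s') (Submodule.add_mem _ hs hs'))
    {s : g.carrier ⊗[ℂ] A} (hs : s ∈ mapGr g A z) : P s hs := by
  induction hs using Submodule.closure_induction with
  | zero => simpa using tmul 0 (Submodule.zero_mem _) 0
  | add s s' hs hs' h h' => exact add s s' hs hs' h h'
  | smul_mem c s hs =>
    obtain ⟨x, hx, a, rfl⟩ := hs
    simp only [TensorProduct.smul_tmul']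
    exact tmul _ (Submodule.smul_mem _ _ hx) a

/-- The bracket of `g ⊗ A`: `[x ⊗ a, y ⊗ b] = [x, y] ⊗ ab`. -/
noncomputable def mapBracket :
    g.carrier ⊗[ℂ] A →ₗ[ℂ] g.carrier ⊗[ℂ] A →ₗ[ℂ] g.carrier ⊗[ℂ] A :=
  TensorProduct.map₂ g.bracket (LinearMap.mul ℂ A)

@[simp] lemma mapBracket_tmul (x y : g.carrier) (a b : A) :
    mapBracket g A (x ⊗ₜ a) (y ⊗ₜ b) = g.bracket x y ⊗ₜ (a * b) := rfl

lemma mapBracket_mem {i j : ZMod 2} {s t : g.carrier ⊗[ℂ] A} (hs : s ∈ mapGr g A i)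
    (ht : t ∈ mapGr g A j) : mapBracket g A s t ∈ mapGr g A (i + j) := by
  induction hs using mapGr_induction with
  | add s s' _ _ h h' => rw [map_add, LinearMap.add_apply]; exact Submodule.add_mem _ h h'
  | tmul x hx a =>
    induction ht using mapGr_induction with
    | add s s' _ _ h h' => rw [map_add]; exact Submodule.add_mem _ h h'
    | tmul y hy b =>
      exact Submodule.subset_span ⟨_, g.bracket_mem hx hy, a * b, rfl⟩

lemma mapBracket_skew {i j : ZMod 2} {s t : g.carrier ⊗[ℂ] A} (hs : s ∈ mapGr g A i)
    (ht : t ∈ mapGr g A j) : mapBracket g A s t = -(ksgn i j • mapBracket g A t s) := by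
  induction hs using mapGr_induction with
  | add s s' _ _ h h' =>
    rw [map_add, LinearMap.add_apply, h, h', map_add, smul_add, neg_add]
  | tmul x hx a =>
    induction ht using mapGr_induction with
    | add s s' _ _ h h' => rw [map_add, h, h', map_add, LinearMap.add_apply, smul_add, neg_add]
    | tmul y hy b =>
      rw [mapBracket_tmul, mapBracket_tmul, g.bracket_skew hx hy, mul_comm b a,
        TensorProduct.neg_tmul, TensorProduct.smul_tmul']

lemma mapBracket_jacobi {i j : ZMod 2} {s t : g.carrier ⊗[ℂ] A} (r : g.carrier ⊗[ℂ] A)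
    (hs : s ∈ mapGr g A i) (ht : t ∈ mapGr g A j) :
    mapBracket g A s (mapBracket g A t r) =
      mapBracket g A (mapBracket g A s t) r + ksgn i j • mapBracket g A t (mapBracket g A s r) := by
  induction hs using mapGr_induction with
  | add s s' _ _ h h' =>
    simp only [map_add, LinearMap.add_apply, h, h', smul_add]; abel
  | tmul x hx a =>
    induction ht using mapGr_induction with
    | add s s' _ _ h h' => simp only [map_add, LinearMap.add_apply, h, h', smul_add]; abel
    | tmul y hy b =>
      induction r using TensorProduct.induction_on with
      | zero => simp
      | add r r' h h' => simp only [map_add, h, h', smul_add]; abel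
      | tmul z c =>
        simp only [mapBracket_tmul]
        rw [g.bracket_jacobi z hx hy, TensorProduct.add_tmul, TensorProduct.smul_tmul', mul_assoc,
          mul_left_comm b a c]

/-- The map superalgebra `g ⊗ A`. -/
noncomputable def mapAlg : LieSuper.{max u v} where
  carrier := g.carrier ⊗[ℂ] A
  gr := mapGr g A
  compl := by
    refine SuperSpace.isCompl_of_parity (mapGr g A)
      (TensorProduct.map g.toSuperSpace.parity LinearMap.id) ?_ ?_
    · intro i s hs
      induction hs using mapGr_induction with
      | add s s' _ _ h h' => rw [map_add, h, h', smul_add]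
      | tmul x hx a =>
        rw [TensorProduct.map_tmul, g.toSuperSpace.parity_of_mem hx, TensorProduct.smul_tmul']
        rfl
    · intro s
      induction s using TensorProduct.induction_on with
      | zero => exact Submodule.zero_mem _
      | add x y hx hy => exact Submodule.add_mem _ hx hy
      | tmul x a =>
        have h := g.toSuperSpace.proj_add x
        rw [← h, TensorProduct.add_tmul]
        exact Submodule.add_mem _
          (Submodule.mem_sup_left (Submodule.subset_span ⟨_, g.toSuperSpace.proj_mem 0 x, a, rfl⟩))
          (Submodule.mem_sup_right (Submodule.subset_span ⟨_, g.toSuperSpace.proj_mem 1 x, a, rfl⟩))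
  bracket := mapBracket g A
  bracket_mem := mapBracket_mem g A
  bracket_skew := mapBracket_skew g A
  bracket_jacobi := mapBracket_jacobi g A

variable {g A} in
lemma mapAlgMap_bracket {h : LieSuper.{u}} {B : Type w} [CommRing B] [Algebra ℂ B]
    (σ : Hom g h) (τ : A →ₐ[ℂ] B) (s t : g.carrier ⊗[ℂ] A) :
    TensorProduct.map σ.toLin τ.toLinearMap (mapBracket g A s t) =
      mapBracket h B (TensorProduct.map σ.toLin τ.toLinearMap s)
        (TensorProduct.map σ.toLin τ.toLinearMap t) := by
  induction s using TensorProduct.induction_on with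
  | zero => simp
  | add s s' h h' => simp only [map_add, LinearMap.add_apply, h, h']
  | tmul x a =>
    induction t using TensorProduct.induction_on with
    | zero => simp
    | add s s' h h' => simp only [map_add, h, h']
    | tmul y b =>
      simp only [mapBracket_tmul, TensorProduct.map_tmul, σ.map_bracket]
      simp

variable {g A} in
/-- The homomorphism `σ ⊗ τ : g ⊗ A → h ⊗ B`. -/
noncomputable def mapAlgMap {h : LieSuper.{u}} {B : Type w} [CommRing B] [Algebra ℂ B]
    (σ : Hom g h) (τ : A →ₐ[ℂ] B) : Hom (mapAlg g A) (mapAlg h B) where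
  toLin := TensorProduct.map σ.toLin τ.toLinearMap
  map_gr {i s} hs := by
    change s ∈ mapGr g A i at hs
    change TensorProduct.map σ.toLin τ.toLinearMap s ∈ mapGr h B i
    induction hs using mapGr_induction with
    | add s s' _ _ h h' => rw [map_add]; exact Submodule.add_mem _ h h'
    | tmul x hx a => exact Submodule.subset_span ⟨_, σ.map_gr hx, τ a, rfl⟩
  map_bracket := mapAlgMap_bracket σ τ

end MapAlgebra

/-- An action of a group `Γ` on a Lie superalgebra by (even) automorphisms. -/
structure Action (Γ : Type t) [Group Γ] (g : LieSuper.{u}) where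
  toHom : Γ → Hom g g
  map_one : ∀ x, (toHom 1).toLin x = x
  map_mul : ∀ γ δ x, (toHom (γ * δ)).toLin x = (toHom γ).toLin ((toHom δ).toLin x)

/-- The identity homomorphism. -/
def Hom.id (g : LieSuper.{u}) : Hom g g where
  toLin := LinearMap.id
  map_gr hx := hx
  map_bracket _ _ := rfl

section Equivariant

variable {Γ : Type t} [Group Γ] {g : LieSuper.{u}} {A : Type v} [CommRing A] [Algebra ℂ A]

/-- The action `γ (x ⊗ a) = γ x ⊗ γ a` of `Γ` on `g ⊗ A`. -/
noncomputable def Action.map (σ : Action Γ g) (τ : Γ →* (A ≃ₐ[ℂ] A)) :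
    Action Γ (mapAlg g A) where
  toHom γ := mapAlgMap (σ.toHom γ) (τ γ : A →ₐ[ℂ] A)
  map_one s := by
    change TensorProduct.map _ _ s = s
    have h1 : (σ.toHom 1).toLin = LinearMap.id := LinearMap.ext σ.map_one
    rw [h1]
    induction s using TensorProduct.induction_on with
    | zero => rfl
    | add s s' h h' => rw [_root_.map_add, h, h']
    | tmul x a => simp
  map_mul γ δ s := by
    change TensorProduct.map _ _ s = TensorProduct.map _ _ (TensorProduct.map _ _ s)
    have h1 : (σ.toHom (γ * δ)).toLin = (σ.toHom γ).toLin ∘ₗ (σ.toHom δ).toLin :=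
      LinearMap.ext (σ.map_mul γ δ)
    rw [h1]
    induction s using TensorProduct.induction_on with
    | zero => simp
    | add s s' h h' => simp only [_root_.map_add, h, h']
    | tmul x a => simp

/-- The Lie subsuperalgebra of fixed points of a group action. -/
def Action.fixed {k : LieSuper.{u}} (α : Action Γ k) : LieSuper.{u} where
  toSuperSpace := SuperSpace.sub k.toSuperSpace
    (⨅ γ, LinearMap.eqLocus (α.toHom γ).toLin LinearMap.id) (by
      intro v hv i
      simp only [Submodule.mem_iInf, LinearMap.mem_eqLocus, LinearMap.id_apply] at hv ⊢
      intro γ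
      have key : ∀ j, (α.toHom γ).toLin (k.toSuperSpace.proj j v) =
          k.toSuperSpace.proj j ((α.toHom γ).toLin v) := by
        intro j
        have h := congrArg (fun w => k.toSuperSpace.proj j ((α.toHom γ).toLin w))
          (k.toSuperSpace.proj_add v)
        simp only [_root_.map_add] at h
        have e0 := (α.toHom γ).map_gr (k.toSuperSpace.proj_mem 0 v)
        have e1 := (α.toHom γ).map_gr (k.toSuperSpace.proj_mem 1 v)
        have a0 := k.toSuperSpace.proj_of_mem e0
        have a1 := k.toSuperSpace.proj_of_mem e1
        have b0 := k.toSuperSpace.proj_of_mem' e0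
        have b1 := k.toSuperSpace.proj_of_mem' e1
        rw [zero_add] at b0
        rw [zmod2_one_add_one] at b1
        rcases zmod2_cases j with rfl | rfl
        · rw [a0, b1, add_zero] at h; exact h
        · rw [a1, b0, zero_add] at h; exact h
      exact (key i).trans (congrArg _ (hv γ)))
  bracket := LinearMap.mk₂ ℂ (fun x y => ⟨k.bracket x.1 y.1, by
      have hx := x.2
      have hy := y.2
      simp only [Submodule.mem_iInf, LinearMap.mem_eqLocus, LinearMap.id_apply] at hx hy ⊢
      intro γ
      rw [(α.toHom γ).map_bracket, hx γ, hy γ]⟩)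
    (fun x x' y => Subtype.ext (LinearMap.congr_fun (_root_.map_add k.bracket x.1 x'.1) y.1))
    (fun c x y => Subtype.ext (LinearMap.congr_fun (map_smul k.bracket c x.1) y.1))
    (fun x y y' => Subtype.ext (_root_.map_add (k.bracket x.1) y.1 y'.1))
    (fun c x y => Subtype.ext (map_smul (k.bracket x.1) c y.1))
  bracket_mem hx hy := k.bracket_mem hx hy
  bracket_skew hx hy := Subtype.ext (k.bracket_skew hx hy)
  bracket_jacobi z hx hy := Subtype.ext (k.bracket_jacobi z.1 hx hy)

/-- The inclusion of the fixed points. -/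
def Action.incl {k : LieSuper.{u}} (α : Action Γ k) : Hom α.fixed k where
  toLin := Submodule.subtype _
  map_gr hx := hx
  map_bracket _ _ := rfl

/-- The equivariant map superalgebra `(g ⊗ A)^Γ`. -/
noncomputable def equivMap (σ : Action Γ g) (τ : Γ →* (A ≃ₐ[ℂ] A)) : LieSuper.{max u v} :=
  (σ.map τ).fixed

/-- `ev_I : g ⊗ A → g ⊗ A/I`. -/
noncomputable def ev (g : LieSuper.{u}) (I : Ideal A) : Hom (mapAlg g A) (mapAlg g (A ⧸ I)) :=
  mapAlgMap (Hom.id g) (Ideal.Quotient.mkₐ ℂ I)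

/-- `ev_I^Γ : (g ⊗ A)^Γ → g ⊗ A/I`, the restriction of `ev_I`. -/
noncomputable def evΓ (σ : Action Γ g) (τ : Γ →* (A ≃ₐ[ℂ] A)) (I : Ideal A) :
    Hom (equivMap σ τ) (mapAlg g (A ⧸ I)) :=
  (ev g I).comp (σ.map τ).incl

end Equivariant

end LieSuper

/-- A module over a Lie superalgebra. -/
structure LieSuper.Mod (L : LieSuper.{u}) extends SuperSpace.{v} where
  act : L.carrier →ₗ[ℂ] carrier →ₗ[ℂ] carrier
  act_mem : ∀ {i j : ZMod 2} {x : L.carrier} {v : carrier}, x ∈ L.gr i → v ∈ gr j →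
    act x v ∈ gr (i + j)
  act_bracket : ∀ {i j : ZMod 2} {x y : L.carrier} (v : carrier), x ∈ L.gr i → y ∈ L.gr j →
    act (L.bracket x y) v = act x (act y v) - ksgn i j • act y (act x v)

namespace LieSuper.Mod

open SuperSpace

variable {L : LieSuper.{u}}

instance : CoeSort (Mod.{u, v} L) (Type v) := ⟨fun V => V.carrier⟩

lemma parity_act (V : Mod.{u, v} L) {i : ZMod 2} {x : L} (hx : x ∈ L.gr i) (v : V) :
    V.toSuperSpace.parity (V.act x v) = ksgn 1 i • V.act x (V.toSuperSpace.parity v) := by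
  have key : ∀ j, ∀ w ∈ V.gr j, V.toSuperSpace.parity (V.act x w) =
      ksgn 1 i • V.act x (V.toSuperSpace.parity w) := by
    intro j w hw
    rw [V.toSuperSpace.parity_of_mem (V.act_mem hx hw), V.toSuperSpace.parity_of_mem hw, map_smul,
      smul_smul]
    rcases zmod2_cases i with rfl | rfl <;> rcases zmod2_cases j with rfl | rfl <;>
      simp [zmod2_one_add_one]
  have h0 := key 0 _ (V.toSuperSpace.proj_mem 0 v)
  have h1 := key 1 _ (V.toSuperSpace.proj_mem 1 v)
  rw [← V.toSuperSpace.proj_add v]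
  simp only [map_add, h0, h1, smul_add]

/-- The subspace `Hom_L(V, W)_z` of homomorphisms of parity `z`: the linear maps `f` of parity `z`
with `f (x v) = (-1)^{z|x|} x f(v)`. -/
def homs (V : Mod.{u, v} L) (W : Mod.{u, w} L) (z : ZMod 2) : Submodule ℂ (V →ₗ[ℂ] W) where
  carrier := {f | f ∈ homGr V.toSuperSpace W.toSuperSpace z ∧
    ∀ i, ∀ x ∈ L.gr i, ∀ v, f (V.act x v) = ksgn z i • W.act x (f v)}
  add_mem' := by
    rintro f g ⟨hf, hf'⟩ ⟨hg, hg'⟩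
    refine ⟨Submodule.add_mem _ hf hg, fun i x hx v => ?_⟩
    simp [hf' i x hx v, hg' i x hx v]
  zero_mem' := ⟨Submodule.zero_mem _, fun i x hx v => by simp⟩
  smul_mem' := by
    rintro c f ⟨hf, hf'⟩
    refine ⟨Submodule.smul_mem _ c hf, fun i x hx v => ?_⟩
    simp [hf' i x hx v, smul_comm c]

/-- `V ≅ W`: there is a bijective element of `Hom_L(V, W) = Hom_L(V, W)₀ ⊕ Hom_L(V, W)₁`. (It need
not be homogeneous; in particular a module is isomorphic to its parity shift.) -/
def Iso (V : Mod.{u, v} L) (W : Mod.{u, w} L) : Prop :=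
  ∃ f₀ ∈ homs V W 0, ∃ f₁ ∈ homs V W 1, Function.Bijective (f₀ + f₁)

/-- A (graded) submodule. -/
structure IsSubmodule (V : Mod.{u, v} L) (N : Submodule ℂ V) : Prop where
  graded : IsGraded (V := V.toSuperSpace) N
  act_mem : ∀ x : L, ∀ n ∈ N, V.act x n ∈ N

structure IsIrreducible (V : Mod.{u, v} L) : Prop where
  nontrivial : Nontrivial V
  eq_bot_or_eq_top : ∀ N : Submodule ℂ V, V.IsSubmodule N → N = ⊥ ∨ N = ⊤

structure IsIndecomposable (V : Mod.{u, v} L) : Prop where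
  nontrivial : Nontrivial V
  eq_bot_or_eq_bot : ∀ N N' : Submodule ℂ V, V.IsSubmodule N → V.IsSubmodule N' → IsCompl N N' →
    N = ⊥ ∨ N' = ⊥

/-- A submodule as a module. -/
def sub (V : Mod.{u, v} L) (N : Submodule ℂ V) (hN : V.IsSubmodule N) : Mod.{u, v} L where
  toSuperSpace := SuperSpace.sub V.toSuperSpace N hN.graded
  act := LinearMap.mk₂ ℂ (fun x n => ⟨V.act x n.1, hN.act_mem x n.1 n.2⟩)
    (fun x x' n => Subtype.ext (LinearMap.congr_fun (map_add V.act x x') n.1))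
    (fun c x n => Subtype.ext (LinearMap.congr_fun (map_smul V.act c x) n.1))
    (fun x n n' => Subtype.ext (map_add (V.act x) n.1 n'.1))
    (fun c x n => Subtype.ext (map_smul (V.act x) c n.1))
  act_mem hx hv := V.act_mem hx hv
  act_bracket v hx hy := Subtype.ext (V.act_bracket v.1 hx hy)

/-- The pull-back of a module along a homomorphism of Lie superalgebras. -/
def pullback {L' : LieSuper.{w}} (φ : Hom L' L) (V : Mod.{u, v} L) : Mod.{w, v} L' where
  toSuperSpace := V.toSuperSpace
  act := V.act ∘ₗ φ.toLin
  act_mem hx hv := V.act_mem (φ.map_gr hx) hv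
  act_bracket v hx hy := by
    simp only [LinearMap.comp_apply, φ.map_bracket]
    exact V.act_bracket v (φ.map_gr hx) (φ.map_gr hy)

/-- The trivial module `ℂ`. -/
noncomputable def triv (L : LieSuper.{u}) : Mod.{u, v} L where
  toSuperSpace := SuperSpace.triv
  act := 0
  act_mem _ _ := Submodule.zero_mem _
  act_bracket v _ _ := by simp

/-- The direct sum of a finite family of modules. -/
def pi {ι : Type w} (V : ι → Mod.{u, v} L) : Mod.{u, max v w} L where
  toSuperSpace := SuperSpace.pi fun i => (V i).toSuperSpace
  act := LinearMap.mk₂ ℂ (fun x (v : ∀ i, V i) i => (V i).act x (v i))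
    (fun x x' v => funext fun i => LinearMap.congr_fun (map_add (V i).act x x') (v i))
    (fun c x v => funext fun i => LinearMap.congr_fun (map_smul (V i).act c x) (v i))
    (fun x v v' => funext fun i => map_add ((V i).act x) (v i) (v' i))
    (fun c x v => funext fun i => map_smul ((V i).act x) c (v i))
  act_mem hx hv i _ := (V i).act_mem hx (hv i trivial)
  act_bracket v hx hy := funext fun i => (V i).act_bracket (v i) hx hy

/-- The direct sum `V^{⊕ n}`. -/
def copies (n : ℕ) (V : Mod.{u, v} L) : Mod.{u, v} L := pi fun _ : Fin n => V

section Hom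

variable (V : Mod.{u, v} L) (W : Mod.{u, w} L)

/-- The action on `Hom_ℂ(V, W)`: `(x f)(v) = x f(v) - (-1)^{|x||f|} f(x v)`. -/
noncomputable def homAct : L.carrier →ₗ[ℂ] (V →ₗ[ℂ] W) →ₗ[ℂ] (V →ₗ[ℂ] W) :=
  LinearMap.mk₂ ℂ (fun x f => W.act x ∘ₗ f
      - f ∘ₗ V.act (L.toSuperSpace.proj 0 x)
      - twist V.toSuperSpace W.toSuperSpace 1 f ∘ₗ V.act (L.toSuperSpace.proj 1 x))
    (fun x x' f => by ext v; simp [twist]; abel)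
    (fun c x f => by ext v; simp [twist, smul_sub])
    (fun x f f' => by ext v; simp [twist]; abel)
    (fun c x f => by ext v; simp [twist, smul_sub])

lemma homAct_apply_of_mem {i : ZMod 2} {x : L} (hx : x ∈ L.gr i) (f : V →ₗ[ℂ] W) :
    homAct V W x f = W.act x ∘ₗ f - twist V.toSuperSpace W.toSuperSpace i f ∘ₗ V.act x := by
  have h0 := L.toSuperSpace.proj_of_mem hx
  have h1 := L.toSuperSpace.proj_of_mem' hx
  rcases zmod2_cases i with rfl | rfl
  · rw [zero_add] at h1
    ext v; simp [homAct, h0, h1, twist]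
  · rw [zmod2_one_add_one] at h1
    ext v; simp [homAct, h0, h1, twist]

lemma homAct_mem {i j : ZMod 2} {x : L} {f : V →ₗ[ℂ] W} (hx : x ∈ L.gr i)
    (hf : f ∈ homGr V.toSuperSpace W.toSuperSpace j) :
    homAct V W x f ∈ homGr V.toSuperSpace W.toSuperSpace (i + j) := by
  rw [homAct_apply_of_mem V W hx]
  intro k v hv
  have e : k + (i + j) = i + (k + j) := by ring
  have e' : k + (i + j) = (i + k) + j := by ring
  refine Submodule.sub_mem _ ?_ ?_
  · rw [e]; exact W.act_mem hx (hf k v hv)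
  · rw [e']
    have h := hf (i + k) _ (V.act_mem hx hv)
    rcases zmod2_cases i with rfl | rfl
    · exact h
    · rw [twist_one_of_mem hf]; exact Submodule.smul_mem _ _ h

lemma homAct_bracket {i j : ZMod 2} {x y : L} (f : V →ₗ[ℂ] W) (hx : x ∈ L.gr i)
    (hy : y ∈ L.gr j) : homAct V W (L.bracket x y) f =
      homAct V W x (homAct V W y f) - ksgn i j • homAct V W y (homAct V W x f) := by
  rw [homAct_apply_of_mem V W hx, homAct_apply_of_mem V W hy, homAct_apply_of_mem V W hx,
    homAct_apply_of_mem V W hy, homAct_apply_of_mem V W (L.bracket_mem hx hy)]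
  have wx := W.parity_act hx
  have wy := W.parity_act hy
  have vx := V.parity_act hx
  have vy := V.parity_act hy
  rcases zmod2_cases i with rfl | rfl <;> rcases zmod2_cases j with rfl | rfl <;>
  · ext v
    have b1 := W.act_bracket (f v) hx hy
    have b2 := V.act_bracket v hx hy
    simp [twist, zmod2_one_add_one] at wx wy vx vy b1 b2 ⊢
    simp [b1, b2, wx, wy, vx, vy]
    try abel

/-- The module `Hom_ℂ(V, W)`. -/
noncomputable def hom : Mod.{u, max v w} L where
  toSuperSpace := SuperSpace.hom V.toSuperSpace W.toSuperSpace
  act := homAct V W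
  act_mem hx hf := homAct_mem V W hx hf
  act_bracket f hx hy := homAct_bracket V W f hx hy

end Hom

section Tensor

variable (V : Mod.{u, v} L) (W : Mod.{u, w} L)

/-- The action on `V ⊗ W`: `x (v ⊗ w) = x v ⊗ w + (-1)^{|x||v|} v ⊗ x w`. -/
noncomputable def tensorAct :
    L.carrier →ₗ[ℂ] (V.carrier ⊗[ℂ] W.carrier) →ₗ[ℂ] (V.carrier ⊗[ℂ] W.carrier) where
  toFun x := TensorProduct.map (V.act x) LinearMap.id
    + TensorProduct.map LinearMap.id (W.act (L.toSuperSpace.proj 0 x))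
    + TensorProduct.map V.toSuperSpace.parity (W.act (L.toSuperSpace.proj 1 x))
  map_add' x x' := by
    simp only [map_add, TensorProduct.map_add_left, TensorProduct.map_add_right]; abel
  map_smul' c x := by
    simp only [map_smul, TensorProduct.map_smul_left, TensorProduct.map_smul_right, smul_add]; rfl

/-- The operator `v ↦ (-1)^{i|v|} v`. -/
noncomputable def parityPow (V : SuperSpace.{v}) (i : ZMod 2) : V →ₗ[ℂ] V :=
  if i = 0 then LinearMap.id else V.parity

lemma tensorAct_of_mem {i : ZMod 2} {x : L} (hx : x ∈ L.gr i) (v : V) (y : W) :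
    tensorAct V W x (v ⊗ₜ y) = V.act x v ⊗ₜ y + parityPow V.toSuperSpace i v ⊗ₜ W.act x y := by
  have h0 := L.toSuperSpace.proj_of_mem hx
  have h1 := L.toSuperSpace.proj_of_mem' hx
  rcases zmod2_cases i with rfl | rfl
  · rw [zero_add] at h1
    simp [tensorAct, h0, h1, parityPow]
  · rw [zmod2_one_add_one] at h1
    simp [tensorAct, h0, h1, parityPow]

lemma tensorAct_mem {i j : ZMod 2} {x : L} {s : V.carrier ⊗[ℂ] W.carrier} (hx : x ∈ L.gr i)
    (hs : s ∈ tensorGr V.toSuperSpace W.toSuperSpace j) :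
    tensorAct V W x s ∈ tensorGr V.toSuperSpace W.toSuperSpace (i + j) := by
  induction hs using Submodule.span_induction with
  | zero => rw [map_zero]; exact Submodule.zero_mem _
  | add a b _ _ ha hb => rw [map_add]; exact Submodule.add_mem _ ha hb
  | smul c a _ ha => rw [map_smul]; exact Submodule.smul_mem _ _ ha
  | mem s hs =>
    obtain ⟨k, l, rfl, v, hv, y, hy, rfl⟩ := hs
    rw [tensorAct_of_mem V W hx]
    refine Submodule.add_mem _
      (Submodule.subset_span ⟨i + k, l, by ring, _, V.act_mem hx hv, _, hy, rfl⟩)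
      (Submodule.subset_span ⟨k, i + l, by ring, _, ?_, _, W.act_mem hx hy, rfl⟩)
    rcases zmod2_cases i with rfl | rfl
    · exact hv
    · change V.toSuperSpace.parity v ∈ _
      rw [V.toSuperSpace.parity_of_mem hv]; exact Submodule.smul_mem _ _ hv

lemma tensorAct_bracket {i j : ZMod 2} {x y : L} (s : V.carrier ⊗[ℂ] W.carrier) (hx : x ∈ L.gr i)
    (hy : y ∈ L.gr j) : tensorAct V W (L.bracket x y) s =
      tensorAct V W x (tensorAct V W y s) - ksgn i j • tensorAct V W y (tensorAct V W x s) := by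
  induction s using TensorProduct.induction_on with
  | zero => simp
  | add a b ha hb => simp only [map_add, ha, hb, smul_add]; abel
  | tmul v y' =>
    have vx := V.parity_act hx v
    have vy := V.parity_act hy v
    have b1 := W.act_bracket y' hx hy
    have b2 := V.act_bracket v hx hy
    simp only [tensorAct_of_mem V W hx, tensorAct_of_mem V W hy, map_add,
      tensorAct_of_mem V W (L.bracket_mem hx hy), b1, b2]
    rcases zmod2_cases i with rfl | rfl <;> rcases zmod2_cases j with rfl | rfl <;>
    · simp [parityPow, zmod2_one_add_one, TensorProduct.sub_tmul, TensorProduct.tmul_sub,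
        TensorProduct.tmul_add, TensorProduct.add_tmul] at vx vy ⊢
      try simp only [vx, vy, TensorProduct.neg_tmul]
      abel

/-- The module `V ⊗ W`. -/
noncomputable def tensor : Mod.{u, max v w} L where
  toSuperSpace := SuperSpace.tensor V.toSuperSpace W.toSuperSpace
  act := tensorAct V W
  act_mem hx hs := tensorAct_mem V W hx hs
  act_bracket s hx hy := tensorAct_bracket V W s hx hy

end Tensor

/-- `V₁ ⊗ ⋯ ⊗ V_ℓ`, bracketed to the left. -/
noncomputable def tensorList : List (Mod.{u, v} L) → Mod.{u, v} L
  | [] => triv L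
  | V :: l => l.foldl tensor V

section IrrProd

/-- The operator `√-1 φ₁ ⊗ φ₂` for odd `φ₁`, `φ₂`, where
`(φ₁ ⊗ φ₂)(v ⊗ w) = (-1)^{|φ₂||v|} φ₁(v) ⊗ φ₂(w)`. -/
noncomputable def hatOp (V : Mod.{u, v} L) (W : Mod.{u, w} L) (φ₁ : V →ₗ[ℂ] V) (φ₂ : W →ₗ[ℂ] W) :
    (V.carrier ⊗[ℂ] W.carrier) →ₗ[ℂ] (V.carrier ⊗[ℂ] W.carrier) :=
  Complex.I • TensorProduct.map (φ₁ ∘ₗ V.toSuperSpace.parity) φ₂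

lemma parity_odd {V : Mod.{u, v} L} {φ : V →ₗ[ℂ] V} (hφ : φ ∈ homs V V 1) (v : V) :
    V.toSuperSpace.parity (φ v) = -φ (V.toSuperSpace.parity v) := by
  have h := LinearMap.congr_fun (twist_one_of_mem hφ.1) (V.toSuperSpace.parity v)
  simpa [twist] using h

lemma hat_isSubmodule (V : Mod.{u, v} L) (W : Mod.{u, w} L) {φ₁ : V →ₗ[ℂ] V} {φ₂ : W →ₗ[ℂ] W}
    (h₁ : φ₁ ∈ homs V V 1) (h₂ : φ₂ ∈ homs W W 1) :
    (tensor V W).IsSubmodule (LinearMap.eqLocus (hatOp V W φ₁ φ₂) LinearMap.id) := by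
  have hp : ∀ s : V.carrier ⊗[ℂ] W.carrier,
      hatOp V W φ₁ φ₂ (TensorProduct.map V.toSuperSpace.parity W.toSuperSpace.parity s) =
      TensorProduct.map V.toSuperSpace.parity W.toSuperSpace.parity (hatOp V W φ₁ φ₂ s) := by
    intro s
    induction s using TensorProduct.induction_on with
    | zero => simp
    | add a b ha hb => simp only [map_add, ha, hb]
    | tmul v y =>
      simp [hatOp, parity_odd h₁, parity_odd h₂, TensorProduct.neg_tmul, TensorProduct.tmul_neg]
  have ha : ∀ i, ∀ x ∈ L.gr i, ∀ s : V.carrier ⊗[ℂ] W.carrier,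
      hatOp V W φ₁ φ₂ (tensorAct V W x s) = tensorAct V W x (hatOp V W φ₁ φ₂ s) := by
    intro i x hx s
    induction s using TensorProduct.induction_on with
    | zero => simp
    | add a b ha hb => simp only [map_add, ha, hb]
    | tmul v y =>
      have c1 := fun v => h₁.2 i x hx v
      have c2 := fun v => h₂.2 i x hx v
      have c3 := fun v => V.parity_act hx v
      simp only [hatOp, LinearMap.smul_apply, TensorProduct.map_tmul, map_smul,
        tensorAct_of_mem V W hx, map_add, LinearMap.comp_apply, c1, c2, c3]
      rcases zmod2_cases i with rfl | rfl
      · simp [parityPow]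
      · simp [parityPow, parity_odd h₁, TensorProduct.neg_tmul, TensorProduct.tmul_neg]
  have hg : ∀ s : V.carrier ⊗[ℂ] W.carrier, hatOp V W φ₁ φ₂ s = s →
      hatOp V W φ₁ φ₂ (TensorProduct.map V.toSuperSpace.parity W.toSuperSpace.parity s) =
      TensorProduct.map V.toSuperSpace.parity W.toSuperSpace.parity s := fun s hs => by
    rw [hp, hs]
  have hx : ∀ (x : L) (s : V.carrier ⊗[ℂ] W.carrier), hatOp V W φ₁ φ₂ s = s →
      hatOp V W φ₁ φ₂ (tensorAct V W x s) = tensorAct V W x s := fun x s hs => by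
    rw [← L.toSuperSpace.proj_add x, map_add, LinearMap.add_apply, map_add,
      ha _ _ (L.toSuperSpace.proj_mem 0 x), ha _ _ (L.toSuperSpace.proj_mem 1 x), hs]
  constructor
  · apply isGraded_of_parity
    intro s hs
    rw [show (tensor V W).toSuperSpace.parity =
      TensorProduct.map V.toSuperSpace.parity W.toSuperSpace.parity from
      parity_tensor V.toSuperSpace W.toSuperSpace]
    exact hg s hs
  · exact fun x s hs => hx x s hs

/-- The submodule `V̂ = {s ∈ V ⊗ W | (√-1 φ₁ ⊗ φ₂) s = s}`. -/
noncomputable def hat (V : Mod.{u, v} L) (W : Mod.{u, w} L) {φ₁ : V →ₗ[ℂ] V} {φ₂ : W →ₗ[ℂ] W}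
    (h₁ : φ₁ ∈ homs V V 1) (h₂ : φ₂ ∈ homs W W 1) : Mod.{u, max v w} L :=
  (tensor V W).sub _ (hat_isSubmodule V W h₁ h₂)

/-- Odd endomorphisms of square `-1`. -/
def OddRoot (V : Mod.{u, v} L) : Type v := {φ : V →ₗ[ℂ] V // φ ∈ homs V V 1 ∧ φ ∘ₗ φ = -LinearMap.id}

open Classical in
/-- The irreducible product `V ⊗̂ W`: it is `V ⊗ W` if this is irreducible, and otherwise `V̂` for odd
endomorphisms `φ₁`, `φ₂` of `V`, `W` of square `-1`. (For irreducible modules over two Lie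
superalgebras, regarded as modules over the direct sum, these exist if `V ⊗ W` is reducible; the
last alternative is a placeholder.) -/
noncomputable def irrProd (V W : Mod.{u, v} L) : Mod.{u, v} L :=
  if (tensor V W).IsIrreducible then tensor V W
  else if h : Nonempty (OddRoot V) ∧ Nonempty (OddRoot W) then
    hat V W h.1.some.2.1 h.2.some.2.1
  else tensor V W

/-- `V₁ ⊗̂ ⋯ ⊗̂ V_ℓ = (V₁ ⊗̂ ⋯ ⊗̂ V_{ℓ-1}) ⊗̂ V_ℓ`, the empty product being `ℂ`. -/
noncomputable def irrProdList : List (Mod.{u, v} L) → Mod.{u, v} L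
  | [] => triv L
  | V :: l => l.foldl irrProd V

/-- The contribution to `κ` of the factors in a list that follow the partial product `P`. -/
noncomputable def kappaAux : Mod.{u, v} L → List (Mod.{u, v} L) → ℕ
  | _, [] => 0
  | P, V :: l =>
    Module.finrank ℂ (homs P P 1) * Module.finrank ℂ (homs V V 1) + kappaAux (irrProd P V) l

/-- `κ(V₁, …, V_ℓ) = ∑_{i=2}^ℓ dim End(V₁ ⊗̂ ⋯ ⊗̂ V_{i-1})₁ · dim End(V_i)₁`. -/
noncomputable def kappa : List (Mod.{u, v} L) → ℕ
  | [] => 0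
  | V :: l => kappaAux V l

end IrrProd

end LieSuper.Mod

namespace LieSuper.Mod

open SuperSpace

section Cohomology

variable {L : LieSuper.{u}} (V : Mod.{u, v} L) (U : Mod.{u, w} L)

/-- The cochains `Hom_ℂ(Λⁿ L ⊗ V, U)`: multilinear functions `c : Lⁿ → Hom_ℂ(V, U)` which change by
`-(-1)^{|x_i||x_{i+1}|}` when the neighbours `x_i`, `x_{i+1}` are interchanged. -/
def cochains (n : ℕ) : Submodule ℂ ((Fin n → L.carrier) → (V.carrier →ₗ[ℂ] U.carrier)) where
  carrier := {c |
    (∃ f : MultilinearMap ℂ (fun _ : Fin n => L.carrier) (V.carrier →ₗ[ℂ] U.carrier), c = ⇑f) ∧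
    ∀ (s : Fin n → ZMod 2) (x : Fin n → L.carrier), (∀ j, x j ∈ L.gr (s j)) →
      ∀ i j : Fin n, i.val + 1 = j.val → c (x ∘ Equiv.swap i j) = -(ksgn (s i) (s j) • c x)}
  add_mem' := by
    rintro _ _ ⟨⟨f, rfl⟩, hf⟩ ⟨⟨f', rfl⟩, hf'⟩
    refine ⟨⟨f + f', rfl⟩, fun s x hx i j hij => ?_⟩
    simp only [Pi.add_apply, hf s x hx i j hij, hf' s x hx i j hij, smul_add, neg_add]
  zero_mem' := ⟨⟨0, rfl⟩, fun s x hx i j hij => by simp⟩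
  smul_mem' := by
    rintro a _ ⟨⟨f, rfl⟩, hf⟩
    refine ⟨⟨a • f, rfl⟩, fun s x hx i j hij => ?_⟩
    simp only [Pi.smul_apply, hf s x hx i j hij, smul_neg]
    rw [smul_comm]

variable {V U} in
/-- The value `(d c)(x₀, …, x_n)` at homogeneous `x_j` of parities `s_j`. It is
`∑_i (-1)^{i + |x_i|(|x_{i+1}| + ⋯ + |x_n|)} ((-1)^{|x_i||c_i|} x_i ∘ c_i - c_i ∘ x_i)`, where
`c_i = c(x₀, …, x̂_i, …, x_n)`, plus
`∑_{j<k} (-1)^{k + |x_k|(|x_{j+1}| + ⋯ + |x_{k-1}|)} c(x₀, …, [x_j, x_k], …, x̂_k, …, x_n)`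
with `[x_j, x_k]` in the place of `x_j`; with `[x_j, x_k]` moved to the front, the sign of the last
term becomes `(-1)^{j + k + η_j + η_k + |x_j||x_k|}`, `η_i = |x_i|(|x₀| + ⋯ + |x_{i-1}|)`. -/
noncomputable def codiffHom {n : ℕ}
    (c : (Fin n → L.carrier) → (V.carrier →ₗ[ℂ] U.carrier))
    (s : Fin (n + 1) → ZMod 2) (x : Fin (n + 1) → L) : V.carrier →ₗ[ℂ] U.carrier :=
  (∑ i : Fin (n + 1), (-1 : ℂ) ^ (i.val + (s i).val * ∑ j ∈ Finset.Ioi i, (s j).val) •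
      (U.act (x i) ∘ₗ twist V.toSuperSpace U.toSuperSpace (s i) (c fun a => x (i.succAbove a)) -
        (c fun a => x (i.succAbove a)) ∘ₗ V.act (x i))) +
  ∑ j : Fin (n + 1), ∑ k ∈ Finset.Ioi j,
    (-1 : ℂ) ^ (k.val + (s k).val * ∑ l ∈ Finset.Ioo j k, (s l).val) •
      c fun a => Function.update x j (L.bracket (x j) (x k)) (k.succAbove a)

/-- The differential `c ↦ d c`; arbitrary arguments are decomposed into their homogeneous components.
If `c` is a cochain, so is `d c`. -/
noncomputable def codiff (n : ℕ) :
    ((Fin n → L.carrier) → (V.carrier →ₗ[ℂ] U.carrier)) →ₗ[ℂ]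
      ((Fin (n + 1) → L.carrier) → (V.carrier →ₗ[ℂ] U.carrier)) where
  toFun c x := ∑ s : Fin (n + 1) → ZMod 2,
    codiffHom c s fun j => L.toSuperSpace.proj (s j) (x j)
  map_add' c c' := by
    funext x
    simp only [Pi.add_apply, ← Finset.sum_add_distrib]
    refine Finset.sum_congr rfl fun s _ => ?_
    have ht : ∀ (i : ZMod 2) (f f' : V.carrier →ₗ[ℂ] U.carrier),
        twist V.toSuperSpace U.toSuperSpace i (f + f') = twist V.toSuperSpace U.toSuperSpace i f +
          twist V.toSuperSpace U.toSuperSpace i f' := by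
      intro i f f'
      rcases zmod2_cases i with rfl | rfl <;> ext v <;> simp [twist]
    simp only [codiffHom, Pi.add_apply, ht, LinearMap.comp_add,
      LinearMap.add_comp, add_sub_add_comm, smul_add, Finset.sum_add_distrib]
    abel
  map_smul' a c := by
    funext x
    simp only [Pi.smul_apply, RingHom.id_apply, Finset.smul_sum]
    refine Finset.sum_congr rfl fun s _ => ?_
    have ht : ∀ (i : ZMod 2) (f : V.carrier →ₗ[ℂ] U.carrier),
        twist V.toSuperSpace U.toSuperSpace i (a • f) =
          a • twist V.toSuperSpace U.toSuperSpace i f := by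
      intro i f
      rcases zmod2_cases i with rfl | rfl <;> ext v <;> simp [twist]
    simp only [codiffHom, Pi.smul_apply, ht, LinearMap.comp_smul,
      LinearMap.smul_comp, ← smul_sub, smul_add, Finset.smul_sum, smul_comm a]

/-- The cocycles of degree `p`. -/
noncomputable def cocycles (p : ℕ) :
    Submodule ℂ ((Fin p → L.carrier) → (V.carrier →ₗ[ℂ] U.carrier)) :=
  cochains V U p ⊓ LinearMap.ker (codiff V U p)

/-- The coboundaries of degree `p`. -/
noncomputable def coboundaries :
    ∀ p : ℕ, Submodule ℂ ((Fin p → L.carrier) → (V.carrier →ₗ[ℂ] U.carrier))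
  | 0 => ⊥
  | p + 1 => (cochains V U p).map (codiff V U p)

/-- `Ext^p_L(V, U)`: cocycles modulo coboundaries in the complex `Hom_ℂ(Λ^• L ⊗ V, U)`. -/
abbrev Ext (p : ℕ) : Type (max u v w) :=
  cocycles V U p ⧸ (coboundaries V U p).comap (cocycles V U p).subtype

/-- `H^p(L, U) = Ext^p_L(ℂ, U)`. -/
abbrev H (p : ℕ) : Type (max u w) := Ext (triv.{u, 0} L) U p

end Cohomology

end LieSuper.Mod

namespace LieSuper

variable {g : LieSuper.{u}} {A : Type v} [CommRing A] [Algebra ℂ A] {Γ : Type t} [Group Γ]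

/-- The maximal ideal `γ m = {γ a | a ∈ m}`. -/
def maxMap (e : A ≃ₐ[ℂ] A) (m : MaximalSpectrum A) : MaximalSpectrum A :=
  ⟨m.asIdeal.map e, inferInstance⟩

/-- The elements of `𝒫`, with chosen representatives of the isomorphism classes: `Γ`-equivariant
assignments, to the maximal ideals `m` of `A`, of finite-dimensional irreducible
`g ⊗ A/m^{n(m)}`-modules, trivial for almost all `m`. Equivariance says that `π(γ m)` is isomorphic
to `π(m)` with `x` acting as `γ⁻¹ x`, both inflated to `g ⊗ A`. -/
structure Param (σ : Action Γ g) (τ : Γ →* (A ≃ₐ[ℂ] A)) where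
  n : MaximalSpectrum A → ℕ
  n_pos : ∀ m, 0 < n m
  rep : ∀ m : MaximalSpectrum A, Mod.{max u v, w} (mapAlg g (A ⧸ m.asIdeal ^ n m))
  finiteDimensional : ∀ m, FiniteDimensional ℂ (rep m)
  irreducible : ∀ m, (rep m).IsIrreducible
  n_equivariant : ∀ γ m, n (maxMap (τ γ) m) = n m
  equivariant : ∀ γ m,
    ((rep (maxMap (τ γ) m)).pullback (ev g _)).Iso
      (((rep m).pullback (ev g _)).pullback ((σ.map τ).toHom γ⁻¹))
  finite_support : {m | ¬ (rep m).Iso (Mod.triv.{max u v, w} _)}.Finite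

namespace Param

variable {σ : Action Γ g} {τ : Γ →* (A ≃ₐ[ℂ] A)} (π : Param.{u, v, w, t} σ τ)

/-- The support of `π`. -/
def support : Set (MaximalSpectrum A) := {m | ¬ (π.rep m).Iso (Mod.triv.{max u v, w} _)}

/-- An enumerated choice of `Supp_*(π)`: one element of each `Γ`-orbit in the support. -/
structure SuppStar where
  l : ℕ
  m : Fin l → MaximalSpectrum A
  mem_support : ∀ i, m i ∈ π.support
  distinct_orbits : ∀ i j, i ≠ j → ∀ γ, maxMap (τ γ) (m i) ≠ m j
  meets_orbits : ∀ m' ∈ π.support, ∃ i γ, maxMap (τ γ) (m i) = m'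

variable {π}

/-- `⨁_{m ∈ Supp_*(π)} g ⊗ A/m^{n(m)}`. -/
noncomputable def SuppStar.alg (S : π.SuppStar) : LieSuper.{max u v} :=
  pi fun i => mapAlg g (A ⧸ (S.m i).asIdeal ^ π.n (S.m i))

/-- The homomorphism `(g ⊗ A)^Γ → ⨁_{m ∈ Supp_*(π)} g ⊗ A/m^{n(m)}` with components
`ev_{m^{n(m)}}^Γ`. -/
noncomputable def SuppStar.ev (S : π.SuppStar) : Hom (equivMap σ τ) S.alg :=
  piLift _ fun i => evΓ σ τ ((S.m i).asIdeal ^ π.n (S.m i))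

/-- The modules `π(m)`, `m ∈ Supp_*(π)`, as modules over `⨁_{m ∈ Supp_*(π)} g ⊗ A/m^{n(m)}`, on which
only the summand of `m` acts. -/
noncomputable def SuppStar.mods (S : π.SuppStar) : List (Mod.{max u v, w} S.alg) :=
  List.ofFn fun i => (π.rep (S.m i)).pullback (piProj _ i)

/-- The `(g ⊗ A)^Γ`-module `𝒱(π) = ⨂̂_{m ∈ Supp_*(π)} ev_{m^{n(m)}}^Γ π(m)`. -/
noncomputable def SuppStar.irrMod (S : π.SuppStar) : Mod.{max u v, w} (equivMap σ τ) :=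
  (Mod.irrProdList S.mods).pullback S.ev

/-- `κ(π)`. -/
noncomputable def SuppStar.kappa (S : π.SuppStar) : ℕ := Mod.kappa S.mods

end Param

end LieSuper

/-!
A homomorphism in the super sense that is not homogeneous differs from a linear map commuting with
the action only by signs, and the signs can be removed: conjugation with the operator that is `1`
on the even and `√-1` on the odd part turns the isomorphisms of the super sense into isomorphisms
of ungraded modules (`iso_iff_ungradedIso`). All isomorphisms of modules are therefore constructed
as ungraded ones. Tensor products, spaces of linear maps, direct sums and pull-backs respect
these; for tensor products and spaces of linear maps the given isomorphisms have to be corrected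
on odd elements (`tensor_left`, `hom_left`).

Write `V` for `𝒱(π)` and `V'` for `𝒱(π')`. By Schur's lemma the endomorphisms of a
finite-dimensional irreducible module, as an ungraded module, are spanned by `1` and an odd
operator that is zero or of square `1` (`IsSchur`). This property, rather than irreducibility, is
carried through the irreducible products. If the acting algebra contains the actions on the two
factors separately, the commutant of a tensor product is found by comparing matrix coefficients
(`IsSchur.exists_eq_tensor`), and it follows that the irreducible product again has the property
and that the tensor product is the sum of one copy or of two copies of it. Two copies appear
precisely if both factors have odd endomorphisms (`IsSchur.irrProd_spec`). Consequently
`V^{⊕ 2^κ(π)}` is the ordinary tensor product of the evaluation modules (`tensorR_irrProdList`).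

Up to isomorphism an evaluation module depends only on the orbit of its maximal ideal, and it is
trivial outside the support. So the tensor products for `π` and for `π'` may both be extended over
a common finite set of orbit representatives `m₁, …, m_ℓ` (`SuppStar.copies_irrMod`). Then
`Hom(V, V')^{⊕ 2^(κ(π) + κ(π'))}` is the tensor product of the `Hom(π(m_i), π'(m_i))`, all of which are
modules over `g ⊗ A/m_i^n` for a large common exponent `n`. Decomposing each of them into
indecomposable summands and expanding the tensor product gives the isomorphism of modules.

The cochain complex computing `Ext(V, V')` is the one computing the cohomology of `Hom(V, V')`.
The differential involves the coefficient module only through linear maps compatible with the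
action, so that isomorphic modules have isomorphic cohomology and direct sums can be taken out,
even though the isomorphisms are not homogeneous (`CochainIso`). The isomorphism for `Ext` is
therefore a consequence of the one for `Hom` (`nonempty_extEquiv_of_iso`).
-/

/-! ### Parity of linear maps -/

namespace SuperSpace

lemma parity_even {V : SuperSpace.{u}} {W : SuperSpace.{v}} {f : V →ₗ[ℂ] W}
    (hf : f ∈ homGr V W 0) (v : V) : W.parity (f v) = f (V.parity v) := by
  have h := LinearMap.congr_fun (twist_one_of_mem hf) (V.parity v)
  simpa [twist] using h

lemma parity_odd {V : SuperSpace.{u}} {W : SuperSpace.{v}} {f : V →ₗ[ℂ] W}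
    (hf : f ∈ homGr V W 1) (v : V) : W.parity (f v) = -f (V.parity v) := by
  have h := LinearMap.congr_fun (twist_one_of_mem hf) (V.parity v)
  simpa [twist] using h

lemma mem_homGr_zero {V : SuperSpace.{u}} {W : SuperSpace.{v}} {f : V →ₗ[ℂ] W}
    (h : ∀ v, W.parity (f v) = f (V.parity v)) : f ∈ homGr V W 0 := by
  apply mem_homGr_of_twist
  ext v; simp [twist, h]

lemma mem_homGr_one {V : SuperSpace.{u}} {W : SuperSpace.{v}} {f : V →ₗ[ℂ] W}
    (h : ∀ v, W.parity (f v) = -f (V.parity v)) : f ∈ homGr V W 1 := by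
  apply mem_homGr_of_twist
  ext v; simp [twist, h]

/-- The operator acting by `1` on `V₀` and by `√-1` on `V₁`. -/
noncomputable def quarterTurn (V : SuperSpace.{u}) : V ≃ₗ[ℂ] V :=
  LinearEquiv.ofLinearMap
    (((1 + Complex.I) / 2) • LinearMap.id + ((1 - Complex.I) / 2) • V.parity)
    (((1 - Complex.I) / 2) • LinearMap.id + ((1 + Complex.I) / 2) • V.parity)
    (by
      ext v
      simp only [LinearMap.comp_apply, LinearMap.add_apply, LinearMap.smul_apply,
        LinearMap.id_apply, map_add, map_smul, parity_parity]
      match_scalars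
      · linear_combination (-1/2 : ℂ) * Complex.I_sq
      · linear_combination (1/2 : ℂ) * Complex.I_sq)
    (by
      ext v
      simp only [LinearMap.comp_apply, LinearMap.add_apply, LinearMap.smul_apply,
        LinearMap.id_apply, map_add, map_smul, parity_parity]
      match_scalars
      · linear_combination (-1/2 : ℂ) * Complex.I_sq
      · linear_combination (1/2 : ℂ) * Complex.I_sq)

lemma quarterTurn_apply (V : SuperSpace.{u}) (v : V) : V.quarterTurn v =
    ((1 + Complex.I) / 2) • v + ((1 - Complex.I) / 2) • V.parity v := rfl

lemma quarterTurn_symm_apply (V : SuperSpace.{u}) (v : V) : V.quarterTurn.symm v =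
    ((1 - Complex.I) / 2) • v + ((1 + Complex.I) / 2) • V.parity v := rfl

/-- The even part `(e + P e P) / 2` of a linear map, for the parity operators `P`. -/
noncomputable def evenPart {V : SuperSpace.{u}} {W : SuperSpace.{v}} (e : V →ₗ[ℂ] W) :
    V →ₗ[ℂ] W := (1/2 : ℂ) • (e + W.parity ∘ₗ e ∘ₗ V.parity)

/-- The odd part `(e - P e P) / 2` of a linear map, for the parity operators `P`. -/
noncomputable def oddPart {V : SuperSpace.{u}} {W : SuperSpace.{v}} (e : V →ₗ[ℂ] W) :
    V →ₗ[ℂ] W := (1/2 : ℂ) • (e - W.parity ∘ₗ e ∘ₗ V.parity)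

section
variable {V : SuperSpace.{u}} {W : SuperSpace.{v}} (e : V →ₗ[ℂ] W)

lemma evenPart_add_oddPart : evenPart e + oddPart e = e := by
  simp only [evenPart, oddPart]; module

lemma evenPart_mem : evenPart e ∈ homGr V W 0 :=
  mem_homGr_zero fun v => by simp [evenPart, add_comm]

lemma oddPart_mem : oddPart e ∈ homGr V W 1 :=
  mem_homGr_one fun v => by simp [oddPart, ← smul_neg]

end

end SuperSpace

/-! ### Isomorphisms of ungraded modules -/

namespace LieSuper.Mod

open SuperSpace

variable {L : LieSuper.{u}}

lemma act_parity (V : Mod.{u, v} L) {i : ZMod 2} {x : L} (hx : x ∈ L.gr i) (v : V) :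
    V.act x (V.toSuperSpace.parity v) = ksgn 1 i • V.toSuperSpace.parity (V.act x v) := by
  rw [V.parity_act hx, smul_smul]
  rcases zmod2_cases i with rfl | rfl <;> simp

/-- An additive property of elements of a Lie superalgebra may be checked on homogeneous ones. -/
lemma homogeneous_ind {P : L → Prop} (hadd : ∀ x y, P x → P y → P (x + y))
    (h : ∀ i, ∀ x ∈ L.gr i, P x) (x : L) : P x := by
  rw [← L.toSuperSpace.proj_add x]
  exact hadd _ _ (h 0 _ (L.toSuperSpace.proj_mem 0 x)) (h 1 _ (L.toSuperSpace.proj_mem 1 x))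

/-- `V` and `W` are isomorphic as ungraded modules: there is a linear bijection commuting with the
action, without signs and regardless of the gradings. -/
def UngradedIso (V : Mod.{u, v} L) (W : Mod.{u, w} L) : Prop :=
  ∃ e : V ≃ₗ[ℂ] W, ∀ x v, e (V.act x v) = W.act x (e v)

namespace UngradedIso

lemma of_homogeneous {V : Mod.{u, v} L} {W : Mod.{u, w} L} (e : V ≃ₗ[ℂ] W)
    (h : ∀ i, ∀ x ∈ L.gr i, ∀ v, e (V.act x v) = W.act x (e v)) : UngradedIso V W :=
  ⟨e, fun x v => homogeneous_ind (P := fun x => e (V.act x v) = W.act x (e v))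
    (fun x y hx hy => by simp [hx, hy]) (fun i x hx => h i x hx v) x⟩

lemma refl (V : Mod.{u, v} L) : UngradedIso V V := ⟨LinearEquiv.refl ℂ _, fun _ _ => rfl⟩

lemma symm {V : Mod.{u, v} L} {W : Mod.{u, w} L} : UngradedIso V W → UngradedIso W V :=
  fun ⟨e, he⟩ => ⟨e.symm, fun x v => by rw [LinearEquiv.symm_apply_eq, he]; simp⟩

lemma trans {V : Mod.{u, v} L} {W : Mod.{u, w} L} {U : Mod.{u, t} L} :
    UngradedIso V W → UngradedIso W U → UngradedIso V U :=
  fun ⟨e, he⟩ ⟨e', he'⟩ => ⟨e.trans e', fun x v => by simp [he, he']⟩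

lemma pullback {V : Mod.{u, v} L} {W : Mod.{u, w} L} {L' : LieSuper.{t}} (φ : Hom L' L) :
    UngradedIso V W → UngradedIso (V.pullback φ) (W.pullback φ) :=
  fun ⟨e, he⟩ => ⟨e, fun x v => he (φ.toLin x) v⟩

end UngradedIso

section Commuting

variable {V : Mod.{u, v} L} {W : Mod.{u, w} L} {e : V →ₗ[ℂ] W}

lemma evenPart_act (he : ∀ x v, e (V.act x v) = W.act x (e v)) (x : L) (v : V) :
    evenPart (V := V.toSuperSpace) (W := W.toSuperSpace) e (V.act x v) =
      W.act x (evenPart (V := V.toSuperSpace) (W := W.toSuperSpace) e v) := by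
  refine homogeneous_ind (P := fun x => evenPart (V := V.toSuperSpace) (W := W.toSuperSpace) e
    (V.act x v) = W.act x (evenPart (V := V.toSuperSpace) (W := W.toSuperSpace) e v))
    (fun x y hx hy => by simp [hx, hy]) (fun i x hx => ?_) x
  simp only [evenPart, LinearMap.smul_apply, LinearMap.add_apply, LinearMap.comp_apply,
    V.parity_act hx, W.act_parity hx, he, map_smul, map_add]

lemma oddPart_act (he : ∀ x v, e (V.act x v) = W.act x (e v)) (x : L) (v : V) :
    oddPart (V := V.toSuperSpace) (W := W.toSuperSpace) e (V.act x v) =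
      W.act x (oddPart (V := V.toSuperSpace) (W := W.toSuperSpace) e v) := by
  refine homogeneous_ind (P := fun x => oddPart (V := V.toSuperSpace) (W := W.toSuperSpace) e
    (V.act x v) = W.act x (oddPart (V := V.toSuperSpace) (W := W.toSuperSpace) e v))
    (fun x y hx hy => by simp [hx, hy]) (fun i x hx => ?_) x
  simp only [oddPart, LinearMap.smul_apply, LinearMap.sub_apply, LinearMap.comp_apply,
    V.parity_act hx, W.act_parity hx, he, map_smul, map_sub]

lemma mem_homs_zero (h : e ∈ homGr V.toSuperSpace W.toSuperSpace 0)
    (he : ∀ x v, e (V.act x v) = W.act x (e v)) : e ∈ homs V W 0 :=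
  ⟨h, fun i x _ v => by simp [he]⟩

/-- Odd maps commuting with the action without signs become odd homomorphisms after composition
with the parity operator. -/
lemma comp_parity_mem_homs_one (h : e ∈ homGr V.toSuperSpace W.toSuperSpace 1)
    (he : ∀ x v, e (V.act x v) = W.act x (e v)) : e ∘ₗ V.toSuperSpace.parity ∈ homs V W 1 := by
  refine ⟨mem_homGr_one fun v => ?_, fun i x hx v => ?_⟩
  · simp [SuperSpace.parity_odd h]
  · simp [V.parity_act hx, he]

lemma homs_zero_act {f : V →ₗ[ℂ] W} (hf : f ∈ homs V W 0) (x : L) (v : V) :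
    f (V.act x v) = W.act x (f v) :=
  homogeneous_ind (P := fun x => f (V.act x v) = W.act x (f v))
    (fun x y hx hy => by simp [hx, hy]) (fun i x hx => by simpa using hf.2 i x hx v) x

lemma homs_one_parity_act {f : V →ₗ[ℂ] W} (hf : f ∈ homs V W 1) (x : L) (v : V) :
    f (V.toSuperSpace.parity (V.act x v)) = W.act x (f (V.toSuperSpace.parity v)) := by
  refine homogeneous_ind (P := fun x => f (V.toSuperSpace.parity (V.act x v)) =
    W.act x (f (V.toSuperSpace.parity v)))
    (fun x y hx hy => by simp [hx, hy]) (fun i x hx => ?_) x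
  rw [V.parity_act hx, map_smul, hf.2 i x hx, smul_smul]
  rcases zmod2_cases i with rfl | rfl <;> simp

end Commuting

/-- Let `Q` be the operator `quarterTurn`. For an even homomorphism `f₀` and an odd one `f₁`,
`Q⁻¹ (f₀ + f₁) Q = f₀ - √-1 f₁ P` with the parity operator `P`, and `f₁ P` commutes with the action
without signs. Hence conjugation by `Q` turns the not necessarily homogeneous isomorphisms of the
super sense into the isomorphisms of ungraded modules. -/
lemma iso_iff_ungradedIso {V : Mod.{u, v} L} {W : Mod.{u, w} L} : V.Iso W ↔ UngradedIso V W := by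
  constructor
  · rintro ⟨f₀, h₀, f₁, h₁, hb⟩
    have key : ∀ v, W.toSuperSpace.quarterTurn.symm ((f₀ + f₁) (V.toSuperSpace.quarterTurn v)) =
        f₀ v - Complex.I • f₁ (V.toSuperSpace.parity v) := fun v => by
      have p0 := SuperSpace.parity_even h₀.1
      have p1 := SuperSpace.parity_odd h₁.1
      simp only [quarterTurn_apply, quarterTurn_symm_apply, LinearMap.add_apply, map_add, map_smul,
        p0, p1, parity_parity, smul_add]
      match_scalars
      · linear_combination (-1/2 : ℂ) * Complex.I_sq
      · linear_combination (1/2 : ℂ) * Complex.I_sq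
      · ring
      · ring
    refine ⟨(V.toSuperSpace.quarterTurn.trans (LinearEquiv.ofBijective (f₀ + f₁) hb)).trans
      W.toSuperSpace.quarterTurn.symm, fun x v => ?_⟩
    have e : ∀ v, ((V.toSuperSpace.quarterTurn.trans
      (LinearEquiv.ofBijective (f₀ + f₁) hb)).trans W.toSuperSpace.quarterTurn.symm) v =
        f₀ v - Complex.I • f₁ (V.toSuperSpace.parity v) := key
    rw [e, e, homs_zero_act h₀, homs_one_parity_act h₁]
    simp
  · rintro ⟨e, he⟩
    let e₀ : V →ₗ[ℂ] W := evenPart (V := V.toSuperSpace) (W := W.toSuperSpace) e.toLinearMap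
    let e₁ : V →ₗ[ℂ] W := oddPart (V := V.toSuperSpace) (W := W.toSuperSpace) e.toLinearMap
    have h0 : e₀ ∈ homGr V.toSuperSpace W.toSuperSpace 0 := evenPart_mem _
    have h1 : e₁ ∈ homGr V.toSuperSpace W.toSuperSpace 1 := oddPart_mem _
    refine ⟨e₀, mem_homs_zero h0 (evenPart_act (e := e.toLinearMap) he),
      Complex.I • (e₁ ∘ₗ V.toSuperSpace.parity), Submodule.smul_mem _ _
      (comp_parity_mem_homs_one h1 (oddPart_act (e := e.toLinearMap) he)), ?_⟩
    have key : ∀ v, W.toSuperSpace.quarterTurn (e (V.toSuperSpace.quarterTurn.symm v)) =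
        (e₀ + Complex.I • (e₁ ∘ₗ V.toSuperSpace.parity)) v := fun v => by
      have p0 := SuperSpace.parity_even h0
      have p1 := SuperSpace.parity_odd h1
      have hs : ∀ v, e v = e₀ v + e₁ v := fun v =>
        (LinearMap.congr_fun (evenPart_add_oddPart (V := V.toSuperSpace) (W := W.toSuperSpace)
          e.toLinearMap) v).symm
      simp only [quarterTurn_apply, quarterTurn_symm_apply, LinearMap.add_apply, map_add, map_smul,
        hs, p0, p1, parity_parity, smul_add, LinearMap.smul_apply, LinearMap.comp_apply]
      match_scalars
      · linear_combination (-1/2 : ℂ) * Complex.I_sq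
      · linear_combination (1/2 : ℂ) * Complex.I_sq
      · ring
      · ring
    have hb :=
      ((V.toSuperSpace.quarterTurn.symm.trans e).trans W.toSuperSpace.quarterTurn).bijective
    have : ⇑((V.toSuperSpace.quarterTurn.symm.trans e).trans W.toSuperSpace.quarterTurn) =
      ⇑(e₀ + Complex.I • (e₁ ∘ₗ V.toSuperSpace.parity)) := funext key
    rwa [this] at hb

end LieSuper.Mod

/-! ### Signed tensor products and compositions of linear maps -/

namespace SuperSpace

/-- Linear maps out of a super space which agree on homogeneous elements agree. -/
lemma linearMap_ext {V : SuperSpace.{u}} {E : Type*} [AddCommGroup E] [Module ℂ E]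
    {f g : V →ₗ[ℂ] E} (h : ∀ j, ∀ v ∈ V.gr j, f v = g v) : f = g := by
  ext v
  rw [← V.proj_add v, map_add, map_add, h 0 _ (V.proj_mem 0 v), h 1 _ (V.proj_mem 1 v)]

lemma tensor_ext {V : Type v} [AddCommGroup V] [Module ℂ V] {W : SuperSpace.{u}} {E : Type*}
    [AddCommGroup E] [Module ℂ E] {f g : V ⊗[ℂ] W.carrier →ₗ[ℂ] E}
    (h : ∀ v, ∀ j, ∀ w ∈ W.gr j, f (v ⊗ₜ w) = g (v ⊗ₜ w)) : f = g :=
  TensorProduct.ext' fun v w => LinearMap.congr_fun (linearMap_ext (V := W)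
    (f := f ∘ₗ TensorProduct.mk ℂ V W v) (g := g ∘ₗ TensorProduct.mk ℂ V W v) (h v)) w

lemma proj_zero_of_odd {V : SuperSpace.{u}} {v : V} (hv : v ∈ V.gr 1) : V.proj 0 v = 0 :=
  zmod2_one_add_one ▸ V.proj_of_mem' hv

lemma proj_one_of_even {V : SuperSpace.{u}} {v : V} (hv : v ∈ V.gr 0) : V.proj 1 v = 0 :=
  zero_add (1 : ZMod 2) ▸ V.proj_of_mem' hv

lemma parity_pi_apply {ι : Type v} (V : ι → SuperSpace.{u}) (v : SuperSpace.pi V) (i : ι) :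
    (SuperSpace.pi V).parity v i = (V i).parity (v i) :=
  congrFun (LinearMap.congr_fun (parity_eq_of (SuperSpace.pi V)
    (LinearMap.pi fun i => (V i).parity ∘ₗ LinearMap.proj i)
    (fun _ _ hv => funext fun i => (V i).parity_of_mem (hv i trivial))) v) i

/-- The map `V ⊗ W → V' ⊗ W` which is `e ⊗ 1` on `V ⊗ W₀` and `P e P ⊗ 1` on `V ⊗ W₁`, for the
parity operators `P`. -/
noncomputable def leftMap {V : SuperSpace.{u}} {V' : SuperSpace.{v}} (W : SuperSpace.{w})
    (e : V →ₗ[ℂ] V') : V.carrier ⊗[ℂ] W.carrier →ₗ[ℂ] V'.carrier ⊗[ℂ] W.carrier :=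
  TensorProduct.map e (W.proj 0) + TensorProduct.map (V'.parity ∘ₗ e ∘ₗ V.parity) (W.proj 1)

section
variable {V : SuperSpace.{u}} {V' : SuperSpace.{v}} {W : SuperSpace.{w}}

lemma leftMap_even (e : V →ₗ[ℂ] V') (v : V) {w : W} (hw : w ∈ W.gr 0) :
    leftMap W e (v ⊗ₜ w) = e v ⊗ₜ w := by
  simp [leftMap, W.proj_of_mem hw, proj_one_of_even hw]

lemma leftMap_odd (e : V →ₗ[ℂ] V') (v : V) {w : W} (hw : w ∈ W.gr 1) :
    leftMap W e (v ⊗ₜ w) = V'.parity (e (V.parity v)) ⊗ₜ w := by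
  simp [leftMap, W.proj_of_mem hw, proj_zero_of_odd hw]

/-- `leftMap` of a linear bijection. -/
noncomputable def leftEquiv (W : SuperSpace.{w}) (e : V ≃ₗ[ℂ] V') :
    V.carrier ⊗[ℂ] W.carrier ≃ₗ[ℂ] V'.carrier ⊗[ℂ] W.carrier :=
  LinearEquiv.ofLinearMap (leftMap W e.toLinearMap) (leftMap W e.symm.toLinearMap)
    (by
      refine tensor_ext fun v j w hw => ?_
      rcases zmod2_cases j with rfl | rfl
      · simp [leftMap_even _ _ hw]
      · simp [leftMap_odd _ _ hw])
    (by
      refine tensor_ext fun v j w hw => ?_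
      rcases zmod2_cases j with rfl | rfl
      · simp [leftMap_even _ _ hw]
      · simp [leftMap_odd _ _ hw])

/-- The map `Hom(W, V) → Hom(W, V')` which takes `F` to `e F` on `W₀` and to `P e P F` on `W₁`. -/
noncomputable def postMap (W : SuperSpace.{w}) (e : V →ₗ[ℂ] V') :
    (W →ₗ[ℂ] V) →ₗ[ℂ] (W →ₗ[ℂ] V') where
  toFun F := e ∘ₗ F ∘ₗ W.proj 0 + (V'.parity ∘ₗ e ∘ₗ V.parity) ∘ₗ F ∘ₗ W.proj 1
  map_add' F F' := by ext; simp; abel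
  map_smul' c F := by ext; simp

lemma postMap_even (e : V →ₗ[ℂ] V') (F : W →ₗ[ℂ] V) {w : W} (hw : w ∈ W.gr 0) :
    postMap W e F w = e (F w) := by
  simp [postMap, W.proj_of_mem hw, proj_one_of_even hw]

lemma postMap_odd (e : V →ₗ[ℂ] V') (F : W →ₗ[ℂ] V) {w : W} (hw : w ∈ W.gr 1) :
    postMap W e F w = V'.parity (e (V.parity (F w))) := by
  simp [postMap, W.proj_of_mem hw, proj_zero_of_odd hw]

/-- `postMap` of a linear bijection. -/
noncomputable def postEquiv (W : SuperSpace.{w}) (e : V ≃ₗ[ℂ] V') :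
    (W →ₗ[ℂ] V) ≃ₗ[ℂ] (W →ₗ[ℂ] V') :=
  LinearEquiv.ofLinearMap (postMap W e.toLinearMap) (postMap W e.symm.toLinearMap)
    (by
      refine LinearMap.ext fun F => linearMap_ext fun j w hw => ?_
      rcases zmod2_cases j with rfl | rfl
      · simp [postMap_even _ _ hw]
      · simp [postMap_odd _ _ hw])
    (by
      refine LinearMap.ext fun F => linearMap_ext fun j w hw => ?_
      rcases zmod2_cases j with rfl | rfl
      · simp [postMap_even _ _ hw]
      · simp [postMap_odd _ _ hw])

/-- The involution of `V ⊗ W` which is the identity on `V ⊗ W₀` and `s ⊗ 1` on `V ⊗ W₁`, for an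
involution `s` of `V`. -/
noncomputable def twistEquiv {V : Type v} [AddCommGroup V] [Module ℂ V] (s : V →ₗ[ℂ] V)
    (hs : ∀ v, s (s v) = v) (W : SuperSpace.{w}) : V ⊗[ℂ] W.carrier ≃ₗ[ℂ] V ⊗[ℂ] W.carrier :=
  have h : (TensorProduct.map LinearMap.id (W.proj 0) + TensorProduct.map s (W.proj 1)) ∘ₗ
      (TensorProduct.map LinearMap.id (W.proj 0) + TensorProduct.map s (W.proj 1)) =
      LinearMap.id := by
    refine tensor_ext fun v j w hw => ?_
    rcases zmod2_cases j with rfl | rfl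
    · simp [W.proj_of_mem hw, proj_one_of_even hw]
    · simp [W.proj_of_mem hw, proj_zero_of_odd hw, hs]
  LinearEquiv.ofLinearMap _ _ h h

lemma twistEquiv_even {V : Type v} [AddCommGroup V] [Module ℂ V] (s : V →ₗ[ℂ] V)
    (hs : ∀ v, s (s v) = v) (v : V) {w : W} (hw : w ∈ W.gr 0) :
    twistEquiv s hs W (v ⊗ₜ w) = v ⊗ₜ w := by
  simp [twistEquiv, W.proj_of_mem hw, proj_one_of_even hw]

lemma twistEquiv_odd {V : Type v} [AddCommGroup V] [Module ℂ V] (s : V →ₗ[ℂ] V)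
    (hs : ∀ v, s (s v) = v) (v : V) {w : W} (hw : w ∈ W.gr 1) :
    twistEquiv s hs W (v ⊗ₜ w) = s v ⊗ₜ w := by
  simp [twistEquiv, W.proj_of_mem hw, proj_zero_of_odd hw]

end

end SuperSpace

/-! ### Tensor products and spaces of linear maps -/

namespace LieSuper.Mod

open SuperSpace

variable {L : LieSuper.{u}}

lemma tensorAct_even (V : Mod.{u, v} L) (W : Mod.{u, w} L) {x : L} (hx : x ∈ L.gr 0) (v : V)
    (y : W) : tensorAct V W x (v ⊗ₜ[ℂ] y) = V.act x v ⊗ₜ[ℂ] y + v ⊗ₜ[ℂ] W.act x y :=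
  tensorAct_of_mem V W hx v y

lemma tensorAct_odd (V : Mod.{u, v} L) (W : Mod.{u, w} L) {x : L} (hx : x ∈ L.gr 1) (v : V)
    (y : W) : tensorAct V W x (v ⊗ₜ[ℂ] y) =
      V.act x v ⊗ₜ[ℂ] y + V.toSuperSpace.parity v ⊗ₜ[ℂ] W.act x y :=
  tensorAct_of_mem V W hx v y

lemma homAct_even (V : Mod.{u, v} L) (W : Mod.{u, w} L) {x : L} (hx : x ∈ L.gr 0)
    (f : V →ₗ[ℂ] W) : homAct V W x f = W.act x ∘ₗ f - f ∘ₗ V.act x :=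
  homAct_apply_of_mem V W hx f

lemma homAct_odd (V : Mod.{u, v} L) (W : Mod.{u, w} L) {x : L} (hx : x ∈ L.gr 1)
    (f : V →ₗ[ℂ] W) : homAct V W x f =
      W.act x ∘ₗ f - (W.toSuperSpace.parity ∘ₗ f ∘ₗ V.toSuperSpace.parity) ∘ₗ V.act x :=
  homAct_apply_of_mem V W hx f

/-- The identification of `V ⊗ W`, as a module, with the tensor product of the underlying spaces. It
is the identity, and serves to state which of the two is meant. -/
noncomputable def tensorEquiv (V : Mod.{u, v} L) (W : Mod.{u, w} L) :
    (tensor V W).carrier ≃ₗ[ℂ] V.carrier ⊗[ℂ] W.carrier := LinearEquiv.refl ℂ _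

@[simp] lemma act_tensorEquiv_symm (V : Mod.{u, v} L) (W : Mod.{u, w} L) (x : L)
    (s : V.carrier ⊗[ℂ] W.carrier) : (tensor V W).act x ((tensorEquiv V W).symm s) =
      (tensorEquiv V W).symm (tensorAct V W x s) := rfl

lemma parity_tensorEquiv_symm (V : Mod.{u, v} L) (W : Mod.{u, w} L)
    (s : V.carrier ⊗[ℂ] W.carrier) :
    (tensor V W).toSuperSpace.parity ((tensorEquiv V W).symm s) = (tensorEquiv V W).symm
      (TensorProduct.map V.toSuperSpace.parity W.toSuperSpace.parity s) :=
  LinearMap.congr_fun (parity_tensor V.toSuperSpace W.toSuperSpace) s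

/-- The identification of `Hom_ℂ(V, W)`, as a module, with the space of linear maps. -/
noncomputable def homEquiv (V : Mod.{u, v} L) (W : Mod.{u, w} L) :
    (hom V W).carrier ≃ₗ[ℂ] (V.carrier →ₗ[ℂ] W.carrier) := LinearEquiv.refl ℂ _

@[simp] lemma homEquiv_act (V : Mod.{u, v} L) (W : Mod.{u, w} L) (x : L) (f : hom V W) :
    homEquiv V W ((hom V W).act x f) = homAct V W x (homEquiv V W f) := rfl

@[simp] lemma act_homEquiv_symm (V : Mod.{u, v} L) (W : Mod.{u, w} L) (x : L)
    (f : V.carrier →ₗ[ℂ] W.carrier) : (hom V W).act x ((homEquiv V W).symm f) =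
      (homEquiv V W).symm (homAct V W x f) := rfl

lemma homEquiv_parity (V : Mod.{u, v} L) (W : Mod.{u, w} L) (f : hom V W) :
    homEquiv V W ((hom V W).toSuperSpace.parity f) =
      W.toSuperSpace.parity ∘ₗ homEquiv V W f ∘ₗ V.toSuperSpace.parity :=
  SuperSpace.parity_hom V.toSuperSpace W.toSuperSpace f

lemma parity_act_odd (V : Mod.{u, v} L) {x : L} (hx : x ∈ L.gr 1) (v : V) :
    V.toSuperSpace.parity (V.act x v) = -V.act x (V.toSuperSpace.parity v) := by
  simpa using V.parity_act hx v

lemma parity_of_even (V : SuperSpace.{u}) {v : V} (hv : v ∈ V.gr 0) : V.parity v = v := by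
  simpa using V.parity_of_mem hv

lemma parity_of_odd (V : SuperSpace.{u}) {v : V} (hv : v ∈ V.gr 1) : V.parity v = -v := by
  simpa using V.parity_of_mem hv

lemma act_mem_even_even {V : Mod.{u, v} L} {x : L} (hx : x ∈ L.gr 0) {j : ZMod 2} {v : V}
    (hv : v ∈ V.gr j) : V.act x v ∈ V.gr j := zero_add j ▸ V.act_mem hx hv

lemma act_mem_odd_even {V : Mod.{u, v} L} {x : L} (hx : x ∈ L.gr 1) {v : V}
    (hv : v ∈ V.gr 0) : V.act x v ∈ V.gr 1 := add_zero (1 : ZMod 2) ▸ V.act_mem hx hv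

lemma act_mem_odd_odd {V : Mod.{u, v} L} {x : L} (hx : x ∈ L.gr 1) {v : V}
    (hv : v ∈ V.gr 1) : V.act x v ∈ V.gr 0 := zmod2_one_add_one ▸ V.act_mem hx hv

namespace UngradedIso

/-- An isomorphism of modules whose source is a tensor product may be checked on pure tensors with
homogeneous second factor. -/
lemma of_tensor {V : Mod.{u, v} L} {W : Mod.{u, w} L} {U : Mod.{u, t} L}
    (e : V.carrier ⊗[ℂ] W.carrier ≃ₗ[ℂ] U)
    (h : ∀ i, ∀ x ∈ L.gr i, ∀ v, ∀ j, ∀ y ∈ W.gr j,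
      e (tensorAct V W x (v ⊗ₜ[ℂ] y)) = U.act x (e (v ⊗ₜ y))) : UngradedIso (tensor V W) U :=
  of_homogeneous (V := tensor V W) e fun i x hx =>
    LinearMap.congr_fun (f := e.toLinearMap ∘ₗ tensorAct V W x) (g := U.act x ∘ₗ e.toLinearMap)
      (tensor_ext (W := W.toSuperSpace) (h i x hx))

lemma of_tensor_tensor {V : Mod.{u, v} L} {W : Mod.{u, w} L} {V' : Mod.{u, v} L}
    {W' : Mod.{u, w} L} (e : V.carrier ⊗[ℂ] W.carrier ≃ₗ[ℂ] V'.carrier ⊗[ℂ] W'.carrier)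
    (h : ∀ i, ∀ x ∈ L.gr i, ∀ v, ∀ j, ∀ y ∈ W.gr j,
      e (tensorAct V W x (v ⊗ₜ[ℂ] y)) = tensorAct V' W' x (e (v ⊗ₜ y))) :
    UngradedIso (tensor V W) (tensor V' W') :=
  of_tensor (U := tensor V' W') e h

lemma of_hom_hom {V : Mod.{u, v} L} {W : Mod.{u, w} L} {V' : Mod.{u, v} L}
    {W' : Mod.{u, w} L} (e : (V.carrier →ₗ[ℂ] W.carrier) ≃ₗ[ℂ] (V'.carrier →ₗ[ℂ] W'.carrier))
    (h : ∀ i, ∀ x ∈ L.gr i, ∀ f, e (homAct V W x f) = homAct V' W' x (e f)) :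
    UngradedIso (hom V W) (hom V' W') :=
  of_homogeneous (V := hom V W) (W := hom V' W') e h

lemma tensor_right (V : Mod.{u, v} L) {W W' : Mod.{u, w} L}
    (h : UngradedIso W W') : UngradedIso (tensor V W) (tensor V W') := by
  obtain ⟨e, he⟩ := h
  refine of_tensor_tensor (TensorProduct.congr (LinearEquiv.refl ℂ _) e)
    fun i x hx v j y hy => ?_
  rcases zmod2_cases i with rfl | rfl
  · simp [tensorAct_even _ _ hx, he]
  · simp [tensorAct_odd _ _ hx, he]

/-- An isomorphism `e : V → V'` of ungraded modules need not be homogeneous, so that `e ⊗ 1` does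
not respect the signs in the action on `V ⊗ W`; `leftMap` does. -/
lemma tensor_left {V V' : Mod.{u, v} L} (W : Mod.{u, w} L)
    (h : UngradedIso V V') : UngradedIso (tensor V W) (tensor V' W) := by
  obtain ⟨e, he⟩ := h
  refine of_tensor_tensor
    (leftEquiv (V := V.toSuperSpace) (V' := V'.toSuperSpace) W.toSuperSpace e)
    fun i x hx v j y hy => ?_
  change leftMap (V := V.toSuperSpace) (V' := V'.toSuperSpace) W.toSuperSpace e.toLinearMap _ =
    tensorAct V' W x
      (leftMap (V := V.toSuperSpace) (V' := V'.toSuperSpace) W.toSuperSpace e.toLinearMap _)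
  rcases zmod2_cases i with rfl | rfl
  · rcases zmod2_cases j with rfl | rfl
    · simp [tensorAct_even _ _ hx, leftMap_even _ _ hy, leftMap_even _ _ (act_mem_even_even hx hy),
        he]
    · have p := fun v => V.parity_act hx v
      have p' := fun v => V'.parity_act hx v
      simp only [ksgn_zero_right, one_smul] at p p'
      simp [tensorAct_even _ _ hx, leftMap_odd _ _ hy, leftMap_odd _ _ (act_mem_even_even hx hy),
        he, p, p']
  · rcases zmod2_cases j with rfl | rfl
    · simp [tensorAct_odd _ _ hx, leftMap_even _ _ hy, leftMap_odd _ _ (act_mem_odd_even hx hy),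
        he]
    · simp [tensorAct_odd _ _ hx, leftMap_odd _ _ hy, leftMap_even _ _ (act_mem_odd_odd hx hy),
        he, parity_act_odd _ hx]

lemma tensor_congr {V : Mod.{u, v} L} {V' : Mod.{u, v} L} {W : Mod.{u, w} L} {W' : Mod.{u, w} L}
    (h : UngradedIso V V') (h' : UngradedIso W W') : UngradedIso (tensor V W) (tensor V' W') :=
  (tensor_left W h).trans (tensor_right V' h')

/-- The isomorphism is `v ⊗ w ↦ (-1)^{|v||w|} w ⊗ v`. -/
lemma tensor_comm (V W : Mod.{u, v} L) :
    UngradedIso (tensor V W) (tensor W V) := by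
  refine of_tensor_tensor ((twistEquiv V.toSuperSpace.parity
    V.toSuperSpace.parity_parity W.toSuperSpace).trans (TensorProduct.comm ℂ _ _))
    fun i x hx v j y hy => ?_
  rcases zmod2_cases i with rfl | rfl
  · have p := fun v => V.parity_act hx v
    simp only [ksgn_zero_right, one_smul] at p
    rcases zmod2_cases j with rfl | rfl
    · simp [tensorAct_even _ _ hx, twistEquiv_even _ _ _ hy,
        twistEquiv_even _ _ _ (act_mem_even_even hx hy), add_comm]
    · simp [tensorAct_even _ _ hx, twistEquiv_odd _ _ _ hy,
        twistEquiv_odd _ _ _ (act_mem_even_even hx hy), add_comm, p]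
  · rcases zmod2_cases j with rfl | rfl
    · simp [tensorAct_odd _ _ hx, twistEquiv_even _ _ _ hy,
        twistEquiv_odd _ _ _ (act_mem_odd_even hx hy), add_comm, parity_of_even _ hy]
    · simp [tensorAct_odd _ _ hx, twistEquiv_odd _ _ _ hy,
        twistEquiv_even _ _ _ (act_mem_odd_odd hx hy), add_comm, parity_of_odd _ hy,
        parity_act_odd _ hx, TensorProduct.neg_tmul]

lemma tensor_assoc (V W U : Mod.{u, v} L) :
    UngradedIso (tensor (tensor V W) U) (tensor V (tensor W U)) := by
  let e : (tensor V W).carrier ⊗[ℂ] U.carrier ≃ₗ[ℂ] V.carrier ⊗[ℂ] (tensor W U).carrier :=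
    ((TensorProduct.congr (tensorEquiv V W) (LinearEquiv.refl ℂ U)).trans
      (TensorProduct.assoc ℂ V W U)).trans
      (TensorProduct.congr (LinearEquiv.refl ℂ V) (tensorEquiv W U).symm)
  have he : ∀ v y z, e ((tensorEquiv V W).symm (v ⊗ₜ y) ⊗ₜ z) =
      v ⊗ₜ (tensorEquiv W U).symm (y ⊗ₜ z) := fun v y z => by simp [e]
  refine of_tensor_tensor e fun i x hx s j z hz => ?_
  obtain ⟨s, rfl⟩ := (tensorEquiv V W).symm.surjective s
  induction s using TensorProduct.induction_on with
  | zero => simp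
  | add s s' hs hs' => simp only [map_add, TensorProduct.add_tmul, hs, hs']
  | tmul v y =>
    rw [he]
    rcases zmod2_cases i with rfl | rfl
    · simp only [tensorAct_even _ _ hx, act_tensorEquiv_symm, map_add, TensorProduct.add_tmul,
        TensorProduct.tmul_add, he, add_assoc]
    · simp only [tensorAct_odd _ _ hx, act_tensorEquiv_symm, map_add, TensorProduct.add_tmul,
        TensorProduct.tmul_add, he, add_assoc, parity_tensorEquiv_symm, TensorProduct.map_tmul]

/-- The identification of the trivial module with `ℂ`. -/
noncomputable def _root_.LieSuper.Mod.trivEquiv (L : LieSuper.{u}) :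
    (triv.{u, v} L).carrier ≃ₗ[ℂ] ℂ :=
  show ULift.{v} ℂ ≃ₗ[ℂ] ℂ from ULift.moduleEquiv

@[simp] lemma _root_.LieSuper.Mod.triv_act (x : L) (c : triv.{u, v} L) :
    (triv.{u, v} L).act x c = 0 := rfl

lemma triv_tensor (V : Mod.{u, v} L) : UngradedIso (tensor (triv.{u, v} L) V) V := by
  refine of_tensor ((TensorProduct.congr (trivEquiv L) (LinearEquiv.refl ℂ V)).trans
    (TensorProduct.lid ℂ V)) fun i x hx c j y hy => ?_
  have hp : (triv.{u, v} L).toSuperSpace.parity c = c := parity_of_even _ trivial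
  rcases zmod2_cases i with rfl | rfl
  · simp [tensorAct_even _ _ hx]
  · simp [tensorAct_odd _ _ hx, hp]

/-- As for `tensor_left`, the isomorphism is corrected by the parity operators on the odd part of
`V`. -/
lemma hom_right (V : Mod.{u, v} L) {W W' : Mod.{u, w} L}
    (h : UngradedIso W W') : UngradedIso (hom V W) (hom V W') := by
  obtain ⟨e, he⟩ := h
  refine of_hom_hom
    (postEquiv (V := W.toSuperSpace) (V' := W'.toSuperSpace) V.toSuperSpace e)
    fun i x hx F => ?_
  change postMap (V := W.toSuperSpace) (V' := W'.toSuperSpace) V.toSuperSpace e.toLinearMap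
    (homAct V W x F) = homAct V W' x
      (postMap (V := W.toSuperSpace) (V' := W'.toSuperSpace) V.toSuperSpace e.toLinearMap F)
  refine linearMap_ext (V := V.toSuperSpace) fun j y hy => ?_
  rcases zmod2_cases i with rfl | rfl
  · rw [homAct_even _ _ hx, homAct_even _ _ hx]
    rcases zmod2_cases j with rfl | rfl
    · simp [postMap_even _ _ hy, postMap_even _ _ (act_mem_even_even hx hy), he]
    · have p := fun v => W.parity_act hx v
      have p' := fun v => W'.parity_act hx v
      simp only [ksgn_zero_right, one_smul] at p p'
      simp [postMap_odd _ _ hy, postMap_odd _ _ (act_mem_even_even hx hy), he, p, p']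
  · rw [homAct_odd _ _ hx, homAct_odd _ _ hx]
    rcases zmod2_cases j with rfl | rfl
    · simp [postMap_even _ _ hy, postMap_odd _ _ (act_mem_odd_even hx hy), he,
        parity_act_odd _ hx, parity_of_even _ hy]
    · simp [postMap_odd _ _ hy, postMap_even _ _ (act_mem_odd_odd hx hy), he,
        parity_act_odd _ hx, parity_of_odd _ hy]

/-- Here an isomorphism of ungraded modules is first turned into one of modules in the super sense,
by conjugation with `quarterTurn`; composition with the latter is compatible with the signs. -/
lemma hom_left {V V' : Mod.{u, v} L} (W : Mod.{u, w} L)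
    (h : UngradedIso V V') : UngradedIso (hom V W) (hom V' W) := by
  obtain ⟨e, he⟩ := h.symm
  let d : V' ≃ₗ[ℂ] V := (V'.toSuperSpace.quarterTurn.trans e).trans V.toSuperSpace.quarterTurn.symm
  -- `d` commutes with even elements `x` and with the operators `P x` for odd `x`, `P` the parity.
  have d0 : ∀ x ∈ L.gr 0, ∀ v, d (V'.act x v) = V.act x (d v) := fun x hx v => by
    have p := fun v => V.parity_act hx v
    have p' := fun v => V'.parity_act hx v
    simp only [ksgn_zero_right, one_smul] at p p'
    simp [d, quarterTurn_apply, quarterTurn_symm_apply, he, p, p']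
  have d1 : ∀ x ∈ L.gr 1, ∀ v, d (V'.toSuperSpace.parity (V'.act x v)) =
      V.toSuperSpace.parity (V.act x (d v)) := fun x hx v => by
    simp only [d, LinearEquiv.trans_apply, quarterTurn_apply, quarterTurn_symm_apply, he,
      parity_act_odd _ hx, map_neg, map_add, map_smul, parity_parity, smul_add, smul_neg]
    match_scalars
    · ring
    · linear_combination (1/2 : ℂ) * Complex.I_sq
    · linear_combination (1/2 : ℂ) * Complex.I_sq
    · ring
  refine of_hom_hom (LinearEquiv.arrowCongr d.symm (LinearEquiv.refl ℂ W)) fun i x hx F => ?_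
  have ed : ∀ F : V →ₗ[ℂ] W, (LinearEquiv.arrowCongr d.symm (LinearEquiv.refl ℂ W)) F =
      F ∘ₗ d.toLinearMap := fun F => rfl
  rw [ed, ed]
  rcases zmod2_cases i with rfl | rfl
  · rw [homAct_even _ _ hx, homAct_even _ _ hx]
    ext v; simp [d0 x hx]
  · rw [homAct_odd _ _ hx, homAct_odd _ _ hx]
    ext v; simp [d1 x hx]

lemma hom_congr {V : Mod.{u, v} L} {V' : Mod.{u, v} L} {W : Mod.{u, w} L} {W' : Mod.{u, w} L}
    (h : UngradedIso V V') (h' : UngradedIso W W') : UngradedIso (hom V W) (hom V' W') :=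
  (hom_left W h).trans (hom_right V' h')

lemma hom_triv_triv : UngradedIso (hom (triv.{u, v} L) (triv.{u, v} L)) (triv.{u, v} L) := by
  refine of_homogeneous (V := hom (triv.{u, v} L) (triv.{u, v} L)) (W := triv.{u, v} L)
    (((homEquiv _ _).trans (LinearEquiv.arrowCongr (trivEquiv L) (trivEquiv L))).trans
      ((LinearMap.ringLmapEquivSelf ℂ ℂ ℂ).trans (trivEquiv L).symm)) fun i x hx F => ?_
  have h : homAct (triv.{u, v} L) (triv.{u, v} L) x (homEquiv _ _ F) = 0 := by
    rcases zmod2_cases i with rfl | rfl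
    · rw [homAct_even _ _ hx]; ext c; simp
    · rw [homAct_odd _ _ hx]; ext c; simp
  simp [h]

/-- For finite-dimensional `V₁` and `W₁`,
`Hom(V₁, V₂) ⊗ Hom(W₁, W₂) ≅ Hom(V₁ ⊗ W₁, V₂ ⊗ W₂)`, where `f ⊗ g` is sent to
`v ⊗ w ↦ (-1)^{|g||v|} f v ⊗ g w`. -/
lemma hom_tensor_hom (V₁ V₂ W₁ W₂ : Mod.{u, v} L) [FiniteDimensional ℂ V₁]
    [FiniteDimensional ℂ W₁] :
    UngradedIso (tensor (hom V₁ V₂) (hom W₁ W₂)) (hom (tensor V₁ W₁) (tensor V₂ W₂)) := by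
  let s : hom V₁ V₂ →ₗ[ℂ] hom V₁ V₂ := (homEquiv V₁ V₂).symm.toLinearMap ∘ₗ
    LinearMap.lcomp ℂ V₂ V₁.toSuperSpace.parity ∘ₗ (homEquiv V₁ V₂).toLinearMap
  have hs : ∀ f, s (s f) = f := fun f => (homEquiv V₁ V₂).injective (by ext v; simp [s])
  let Φ : (hom V₁ V₂).carrier ⊗[ℂ] (hom W₁ W₂).carrier ≃ₗ[ℂ]
      (V₁.carrier ⊗[ℂ] W₁.carrier →ₗ[ℂ] V₂.carrier ⊗[ℂ] W₂.carrier) :=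
    ((twistEquiv s hs (hom W₁ W₂).toSuperSpace).trans
      (TensorProduct.congr (homEquiv V₁ V₂) (homEquiv W₁ W₂))).trans
      (homTensorHomEquiv ℂ V₁ W₁ V₂ W₂)
  have key0 : ∀ f, ∀ g ∈ (hom W₁ W₂).gr 0, Φ (f ⊗ₜ[ℂ] g) =
      TensorProduct.map (homEquiv V₁ V₂ f) (homEquiv W₁ W₂ g) := fun f g hg => by
    simp [Φ, twistEquiv_even s hs f hg]
  have key1 : ∀ f, ∀ g ∈ (hom W₁ W₂).gr 1, Φ (f ⊗ₜ[ℂ] g) =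
      TensorProduct.map (homEquiv V₁ V₂ f ∘ₗ V₁.toSuperSpace.parity) (homEquiv W₁ W₂ g) :=
    fun f g hg => by
      simp only [Φ, LinearEquiv.trans_apply, twistEquiv_odd s hs f hg]
      simp [s]; rfl
  suffices h : ∀ i, ∀ x ∈ L.gr i, ∀ f, ∀ j, ∀ g ∈ (hom W₁ W₂).gr j,
      Φ (tensorAct (hom V₁ V₂) (hom W₁ W₂) x (f ⊗ₜ[ℂ] g)) =
        (tensorEquiv V₂ W₂).toLinearMap ∘ₗ homAct (tensor V₁ W₁) (tensor V₂ W₂) x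
          ((tensorEquiv V₂ W₂).symm.toLinearMap ∘ₗ Φ (f ⊗ₜ g) ∘ₗ
            (tensorEquiv V₁ W₁).toLinearMap) ∘ₗ (tensorEquiv V₁ W₁).symm.toLinearMap from
    of_tensor (V := hom V₁ V₂) (W := hom W₁ W₂) (U := hom (tensor V₁ W₁) (tensor V₂ W₂)) Φ h
  intro i x hx f j g hg
  refine TensorProduct.ext' fun v y => ?_
  rcases zmod2_cases i with rfl | rfl
  · rw [tensorAct_even _ _ hx, map_add, homAct_even _ _ hx]
    rcases zmod2_cases j with rfl | rfl
    · rw [key0 _ _ hg, key0 _ _ hg, key0 _ _ (act_mem_even_even hx hg), homEquiv_act,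
        homEquiv_act, homAct_even _ _ hx, homAct_even _ _ hx]
      simp only [LinearMap.add_apply, LinearMap.sub_apply, LinearMap.comp_apply,
        LinearEquiv.coe_coe, LinearEquiv.apply_symm_apply, act_tensorEquiv_symm, map_sub,
        TensorProduct.map_tmul, tensorAct_even _ _ hx, map_add, TensorProduct.sub_tmul,
        TensorProduct.tmul_sub]
      abel
    · have p := fun v => V₁.parity_act hx v
      simp only [ksgn_zero_right, one_smul] at p
      rw [key1 _ _ hg, key1 _ _ hg, key1 _ _ (act_mem_even_even hx hg), homEquiv_act,
        homEquiv_act, homAct_even _ _ hx, homAct_even _ _ hx]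
      simp only [LinearMap.add_apply, LinearMap.sub_apply, LinearMap.comp_apply,
        LinearEquiv.coe_coe, LinearEquiv.apply_symm_apply, act_tensorEquiv_symm, map_sub,
        TensorProduct.map_tmul, tensorAct_even _ _ hx, map_add, TensorProduct.sub_tmul,
        TensorProduct.tmul_sub, p]
      abel
  · rw [tensorAct_odd _ _ hx, map_add, homAct_odd _ _ hx]
    rcases zmod2_cases j with rfl | rfl
    · have q := SuperSpace.parity_even (f := homEquiv W₁ W₂ g) hg
      rw [key0 _ _ hg, key0 _ _ hg, key1 _ _ (act_mem_odd_even hx hg), homEquiv_act,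
        homEquiv_act, homAct_odd _ _ hx, homAct_odd _ _ hx, homEquiv_parity]
      simp only [LinearMap.add_apply, LinearMap.sub_apply, LinearMap.comp_apply,
        LinearEquiv.coe_coe, LinearEquiv.apply_symm_apply, act_tensorEquiv_symm, map_sub,
        TensorProduct.map_tmul, tensorAct_odd _ _ hx, map_add, TensorProduct.sub_tmul,
        TensorProduct.tmul_sub, parity_tensorEquiv_symm, parity_parity, q]
      abel
    · have q := SuperSpace.parity_odd (f := homEquiv W₁ W₂ g) hg
      rw [key1 _ _ hg, key1 _ _ hg, key0 _ _ (act_mem_odd_odd hx hg), homEquiv_act,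
        homEquiv_act, homAct_odd _ _ hx, homAct_odd _ _ hx, homEquiv_parity]
      simp only [LinearMap.add_apply, LinearMap.sub_apply, LinearMap.comp_apply,
        LinearEquiv.coe_coe, LinearEquiv.apply_symm_apply, act_tensorEquiv_symm, map_sub,
        TensorProduct.map_tmul, tensorAct_odd _ _ hx, map_add, TensorProduct.sub_tmul,
        TensorProduct.tmul_sub, parity_tensorEquiv_symm, parity_parity, q, parity_act_odd _ hx,
        map_neg, TensorProduct.neg_tmul, TensorProduct.tmul_neg]
      abel

/-! ### Direct sums -/

lemma pi_congr {ι : Type t} {V W : ι → Mod.{u, v} L} (h : ∀ i, UngradedIso (V i) (W i)) :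
    UngradedIso (Mod.pi V) (Mod.pi W) := by
  choose e he using h
  exact ⟨LinearEquiv.piCongrRight e, fun x v => funext fun i => he i x (v i)⟩

lemma pi_equiv {ι : Type t} {κ : Type w} (e : ι ≃ κ) (V : κ → Mod.{u, v} L) :
    UngradedIso (Mod.pi fun i => V (e i)) (Mod.pi V) := by
  refine symm ⟨LinearEquiv.ofBijective (LinearMap.pi fun i => LinearMap.proj (e i) :
    (∀ k, V k) →ₗ[ℂ] ∀ i, V (e i)) ?_, fun x v => rfl⟩
  exact (Equiv.piCongrLeft (fun k => (V k).carrier) e).symm.bijective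

lemma pi_pi {ι : Type t} {κ : Type w} (V : ι → κ → Mod.{u, v} L) :
    UngradedIso (Mod.pi fun i => Mod.pi (V i)) (Mod.pi fun p : ι × κ => V p.1 p.2) :=
  ⟨{ toFun := fun f p => f p.1 p.2
     invFun := fun f i k => f (i, k)
     map_add' := fun _ _ => rfl
     map_smul' := fun _ _ => rfl
     left_inv := fun _ => rfl
     right_inv := fun _ => rfl }, fun _ _ => rfl⟩

/-- The identification of a direct sum, as a module, with the product of the underlying spaces. -/
noncomputable def _root_.LieSuper.Mod.piEquiv {ι : Type t} (V : ι → Mod.{u, v} L) :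
    (Mod.pi V).carrier ≃ₗ[ℂ] ∀ i, (V i).carrier := LinearEquiv.refl ℂ _

lemma tensor_pi {ι : Type} [Finite ι] (V : Mod.{u, v} L) (W : ι → Mod.{u, v} L) :
    UngradedIso (tensor V (Mod.pi W)) (Mod.pi fun i => tensor V (W i)) := by
  classical
  have := Fintype.ofFinite ι
  let e : V.carrier ⊗[ℂ] (Mod.pi W).carrier ≃ₗ[ℂ] ∀ i, V.carrier ⊗[ℂ] (W i).carrier :=
    (TensorProduct.congr (LinearEquiv.refl ℂ V) (piEquiv W)).trans
      (TensorProduct.piRight ℂ ℂ V fun i => (W i).carrier)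
  have he : ∀ v y i, e (v ⊗ₜ y) i = v ⊗ₜ piEquiv W y i := fun v y i => by simp [e]
  have ha : ∀ x y i, piEquiv W ((Mod.pi W).act x y) i = (W i).act x (piEquiv W y i) :=
    fun _ _ _ => rfl
  suffices h : ∀ i, ∀ x ∈ L.gr i, ∀ v, ∀ j, ∀ y ∈ (Mod.pi W).gr j,
      e (tensorAct V (Mod.pi W) x (v ⊗ₜ[ℂ] y)) = fun k => tensorAct V (W k) x (e (v ⊗ₜ y) k) from
    of_tensor (W := Mod.pi W) (U := Mod.pi fun i => tensor V (W i)) e h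
  intro i x hx v j y hy
  funext k
  rcases zmod2_cases i with rfl | rfl
  · simp [tensorAct_even _ _ hx, he, ha]
  · simp [tensorAct_odd _ _ hx, he, ha]

lemma pi_tensor {ι : Type} [Finite ι] (V : ι → Mod.{u, v} L) (W : Mod.{u, v} L) :
    UngradedIso (tensor (Mod.pi V) W) (Mod.pi fun i => tensor (V i) W) :=
  ((tensor_comm (Mod.pi V) W).trans (tensor_pi W V)).trans (pi_congr fun i => tensor_comm W (V i))

/-- The identification of `Hom_ℂ(V, ⨁ W_i)` with `∏ Hom_ℂ(V, W_i)`. -/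
noncomputable def _root_.LieSuper.Mod.homPiEquiv {ι : Type t} (V : Mod.{u, v} L)
    (W : ι → Mod.{u, w} L) :
    (V.carrier →ₗ[ℂ] (Mod.pi W).carrier) ≃ₗ[ℂ] ∀ i, V.carrier →ₗ[ℂ] (W i).carrier where
  toFun F i := LinearMap.proj i ∘ₗ (piEquiv W).toLinearMap ∘ₗ F
  invFun F := (piEquiv W).symm.toLinearMap ∘ₗ LinearMap.pi F
  map_add' F F' := by ext; simp
  map_smul' c F := by ext; simp
  left_inv F := by ext v; simp
  right_inv F := by ext; simp

lemma _root_.LieSuper.Mod.homPiEquiv_apply {ι : Type t} (V : Mod.{u, v} L) (W : ι → Mod.{u, w} L)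
    (F : V.carrier →ₗ[ℂ] (Mod.pi W).carrier) (i : ι) (v : V) :
    homPiEquiv V W F i v = piEquiv W (F v) i := rfl

lemma hom_pi {ι : Type} (V : Mod.{u, v} L) (W : ι → Mod.{u, w} L) :
    UngradedIso (hom V (Mod.pi W)) (Mod.pi fun i => hom V (W i)) := by
  let e := homPiEquiv V W
  have he : ∀ F i v, e F i v = piEquiv W (F v) i := fun _ _ _ => rfl
  have ha : ∀ x y i, piEquiv W ((Mod.pi W).act x y) i = (W i).act x (piEquiv W y i) :=
    fun _ _ _ => rfl
  have hp : ∀ y i, piEquiv W ((Mod.pi W).toSuperSpace.parity y) i =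
      (W i).toSuperSpace.parity (piEquiv W y i) :=
    parity_pi_apply fun i => (W i).toSuperSpace
  suffices h : ∀ i, ∀ x ∈ L.gr i, ∀ F, e (homAct V (Mod.pi W) x F) =
      fun k => homAct V (W k) x (e F k) from
    of_homogeneous (V := hom V (Mod.pi W)) (W := Mod.pi fun i => hom V (W i)) e h
  intro i x hx F
  funext k
  ext v
  rcases zmod2_cases i with rfl | rfl
  · simp [homAct_even _ _ hx, he, ha]
  · simp [homAct_odd _ _ hx, he, ha, hp]

lemma pi_hom {ι : Type} [Finite ι] (V : ι → Mod.{u, v} L) (W : Mod.{u, w} L) :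
    UngradedIso (hom (Mod.pi V) W) (Mod.pi fun i => hom (V i) W) := by
  classical
  have := Fintype.ofFinite ι
  let e : ((Mod.pi V).carrier →ₗ[ℂ] W.carrier) ≃ₗ[ℂ] ∀ i, (V i).carrier →ₗ[ℂ] W.carrier :=
    (LinearEquiv.arrowCongr (piEquiv V) (LinearEquiv.refl ℂ W)).trans
      (LinearMap.lsum ℂ (fun i => (V i).carrier) ℂ).symm
  have he : ∀ F i v, e F i v = F ((piEquiv V).symm (Pi.single i v)) := fun F i v => by
    have h := LinearMap.congr_fun ((LinearMap.lsum ℂ (fun i => (V i).carrier) ℂ).apply_symm_apply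
      (LinearEquiv.arrowCongr (piEquiv V) (LinearEquiv.refl ℂ W) F)) (Pi.single i v)
    rw [LinearMap.lsum_piSingle] at h
    exact h
  have ha : ∀ x i v, (Mod.pi V).act x ((piEquiv V).symm (Pi.single i v)) =
      (piEquiv V).symm (Pi.single i ((V i).act x v)) := fun x i v => funext fun k => by
    change (V k).act x ((Pi.single i v : ∀ i, (V i).carrier) k) =
      (Pi.single i ((V i).act x v) : ∀ i, (V i).carrier) k
    rcases eq_or_ne k i with rfl | h
    · simp
    · simp [h]
  have hp : ∀ i v, (Mod.pi V).toSuperSpace.parity ((piEquiv V).symm (Pi.single i v)) =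
      (piEquiv V).symm (Pi.single i ((V i).toSuperSpace.parity v)) := fun i v =>
    funext fun k => by
      refine (parity_pi_apply (fun i => (V i).toSuperSpace) _ k).trans ?_
      change (V k).toSuperSpace.parity ((Pi.single i v : ∀ i, (V i).carrier) k) =
        (Pi.single i ((V i).toSuperSpace.parity v) : ∀ i, (V i).carrier) k
      rcases eq_or_ne k i with rfl | h
      · simp
      · simp [h]
  suffices h : ∀ i, ∀ x ∈ L.gr i, ∀ F, e (homAct (Mod.pi V) W x F) =
      fun k => homAct (V k) W x (e F k) from
    of_homogeneous (V := hom (Mod.pi V) W) (W := Mod.pi fun i => hom (V i) W) e h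
  intro i x hx F
  funext k
  ext v
  rcases zmod2_cases i with rfl | rfl
  · simp [homAct_even _ _ hx, he, ha]
  · simp [homAct_odd _ _ hx, he, ha, hp]

lemma copies_congr {V W : Mod.{u, v} L} (n : ℕ) (h : UngradedIso V W) :
    UngradedIso (copies n V) (copies n W) := pi_congr fun _ => h

lemma copies_copies (m n : ℕ) (V : Mod.{u, v} L) :
    UngradedIso (copies m (copies n V)) (copies (m * n) V) :=
  (pi_pi fun (_ : Fin m) (_ : Fin n) => V).trans
    (pi_equiv finProdFinEquiv fun _ : Fin (m * n) => V)

lemma copies_one (V : Mod.{u, v} L) : UngradedIso (copies 1 V) V :=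
  ⟨LinearEquiv.funUnique (Fin 1) ℂ V.carrier, fun _ _ => rfl⟩

lemma hom_copies (m n : ℕ) (V W : Mod.{u, v} L) :
    UngradedIso (hom (copies m V) (copies n W)) (copies (m * n) (hom V W)) :=
  ((pi_hom (fun _ : Fin m => V) (copies n W)).trans
    (pi_congr fun _ => hom_pi V fun _ : Fin n => W)).trans (copies_copies m n (hom V W))

/-! ### Pull-backs -/

lemma pullback_tensor {L' : LieSuper.{t}} (φ : Hom L' L) (V W : Mod.{u, v} L) :
    UngradedIso ((tensor V W).pullback φ) (tensor (V.pullback φ) (W.pullback φ)) := by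
  refine symm (of_tensor (V := V.pullback φ) (W := W.pullback φ) (U := (tensor V W).pullback φ)
    (LinearEquiv.refl ℂ (V.carrier ⊗[ℂ] W.carrier)) fun i x hx v j y hy => ?_)
  refine (tensorAct_of_mem (V.pullback φ) (W.pullback φ) hx v y).trans ?_
  exact (tensorAct_of_mem V W (φ.map_gr hx) v y).symm

lemma pullback_hom {L' : LieSuper.{t}} (φ : Hom L' L) (V W : Mod.{u, v} L) :
    UngradedIso ((hom V W).pullback φ) (hom (V.pullback φ) (W.pullback φ)) := by
  refine symm (of_homogeneous (V := hom (V.pullback φ) (W.pullback φ)) (W := (hom V W).pullback φ)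
    (LinearEquiv.refl ℂ (V.carrier →ₗ[ℂ] W.carrier)) fun i x hx F => ?_)
  refine (homAct_apply_of_mem (V.pullback φ) (W.pullback φ) hx F).trans ?_
  exact (homAct_apply_of_mem V W (φ.map_gr hx) F).symm

end UngradedIso

end LieSuper.Mod

/-! ### Schur's lemma -/

namespace LieSuper.Mod

open SuperSpace

variable {L : LieSuper.{u}}

/-- A module satisfying the conclusion of the super version of Schur's lemma: the endomorphisms of
the ungraded module are the combinations of `1` and `α`, where `α` is zero or odd of square `1`. -/
structure IsSchur (V : Mod.{u, v} L) (α : V →ₗ[ℂ] V) : Prop where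
  nontrivial : Nontrivial V
  comm : ∀ x v, α (V.act x v) = V.act x (α v)
  odd : ∀ v, V.toSuperSpace.parity (α v) = -α (V.toSuperSpace.parity v)
  zero_or : α = 0 ∨ ∀ v, α (α v) = v
  exists_eq : ∀ a : V →ₗ[ℂ] V, (∀ x v, a (V.act x v) = V.act x (a v)) →
    ∃ s t : ℂ, ∀ v, a v = s • v + t • α v

section Schur

lemma isSubmodule_ker {V : Mod.{u, v} L} {a : V →ₗ[ℂ] V}
    (ha : ∀ x v, a (V.act x v) = V.act x (a v))
    (hp : ∀ v, a v = 0 → a (V.toSuperSpace.parity v) = 0) : V.IsSubmodule (LinearMap.ker a) where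
  graded := isGraded_of_parity fun v hv => hp v hv
  act_mem x v hv := by
    rw [LinearMap.mem_ker] at hv ⊢
    rw [ha, hv, map_zero]

lemma IsIrreducible.eq_zero_or_injective {V : Mod.{u, v} L} (hV : V.IsIrreducible) {a : V →ₗ[ℂ] V}
    (ha : ∀ x v, a (V.act x v) = V.act x (a v))
    (hp : ∀ v, a v = 0 → a (V.toSuperSpace.parity v) = 0) : a = 0 ∨ Function.Injective a := by
  rcases hV.eq_bot_or_eq_top _ (isSubmodule_ker ha hp) with h | h
  · exact Or.inr (LinearMap.ker_eq_bot.1 h)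
  · exact Or.inl (LinearMap.ker_eq_top.1 h)

lemma IsIrreducible.even_scalar {V : Mod.{u, v} L} (hV : V.IsIrreducible) [FiniteDimensional ℂ V]
    {a : V →ₗ[ℂ] V} (ha : ∀ x v, a (V.act x v) = V.act x (a v))
    (hp : ∀ v, V.toSuperSpace.parity (a v) = a (V.toSuperSpace.parity v)) :
    ∃ s : ℂ, ∀ v, a v = s • v := by
  have := hV.nontrivial
  obtain ⟨s, hs⟩ := Module.End.exists_eigenvalue a
  obtain ⟨v, hv⟩ := hs.exists_hasEigenvector
  refine ⟨s, ?_⟩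
  rcases hV.eq_zero_or_injective (a := a - s • LinearMap.id) (fun x v => by simp [ha])
    (fun v hv => by
      rw [LinearMap.sub_apply, LinearMap.smul_apply, LinearMap.id_apply, ← hp, ← map_smul,
        ← map_sub]
      exact (congrArg _ hv).trans (map_zero _)) with h | h
  · intro v
    have := LinearMap.congr_fun h v
    simpa [sub_eq_zero] using this
  · refine absurd (h (a₁ := v) (a₂ := 0) ?_) hv.2
    simp [hv.apply_eq_smul]

/-- Schur's lemma. The square of an odd operator commuting with the action is even, hence a scalar;
if such an operator is not zero, it is injective, and can be normalized to have square `1`. -/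
lemma IsIrreducible.exists_isSchur {V : Mod.{u, v} L} (hV : V.IsIrreducible)
    [FiniteDimensional ℂ V] : ∃ α, V.IsSchur α := by
  have hnt := hV.nontrivial
  by_cases hodd : ∃ b : V →ₗ[ℂ] V, b ≠ 0 ∧ (∀ x v, b (V.act x v) = V.act x (b v)) ∧
    ∀ v, V.toSuperSpace.parity (b v) = -b (V.toSuperSpace.parity v)
  · obtain ⟨b, hb0, hb, hbp⟩ := hodd
    have hinj : Function.Injective b := (hV.eq_zero_or_injective hb fun v hv => by
      rw [← neg_eq_zero, ← hbp, hv, map_zero]).resolve_left hb0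
    obtain ⟨c, hc⟩ := hV.even_scalar (a := b ∘ₗ b) (fun x v => by simp [hb])
      (fun v => by simp [hbp])
    simp only [LinearMap.comp_apply] at hc
    have hc0 : c ≠ 0 := by
      rintro rfl
      obtain ⟨v, hv⟩ := exists_ne (0 : V)
      exact hv (hinj (hinj (by simp [hc])))
    obtain ⟨r, hr⟩ := IsAlgClosed.exists_pow_nat_eq c (n := 2) (by norm_num)
    have hr0 : r ≠ 0 := by rintro rfl; exact hc0 (by simpa using hr.symm)
    have hrr : r⁻¹ * (r⁻¹ * c) = 1 := by rw [← hr]; field_simp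
    have hα2 : ∀ v, (r⁻¹ • b) ((r⁻¹ • b) v) = v := fun v => by
      simp only [LinearMap.smul_apply, map_smul, hc, smul_smul, hrr, one_smul]
    refine ⟨r⁻¹ • b, hnt, fun x v => by simp [hb], fun v => by simp [hbp], Or.inr hα2,
      fun a ha => ?_⟩
    have h0 := evenPart_act ha
    have h1 := oddPart_act ha
    obtain ⟨s, hs⟩ := hV.even_scalar h0 (SuperSpace.parity_even (evenPart_mem a))
    have hop := SuperSpace.parity_odd (oddPart_mem (V := V.toSuperSpace) (W := V.toSuperSpace) a)
    obtain ⟨t, ht⟩ := hV.even_scalar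
      (a := (r⁻¹ • b) ∘ₗ (oddPart (V := V.toSuperSpace) (W := V.toSuperSpace) a))
      (fun x v => by simp [hb, h1]) (fun v => by simp [hop, hbp])
    refine ⟨s, t, fun v => ?_⟩
    have h2 : oddPart (V := V.toSuperSpace) (W := V.toSuperSpace) a v = t • (r⁻¹ • b) v := by
      rw [← map_smul, ← ht v, LinearMap.comp_apply, hα2]
    rw [← hs, ← h2]
    exact (LinearMap.congr_fun
      (evenPart_add_oddPart (V := V.toSuperSpace) (W := V.toSuperSpace) a) v).symm
  · push Not at hodd
    refine ⟨0, hnt, fun x v => by simp, fun v => by simp, Or.inl rfl, fun a ha => ?_⟩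
    obtain ⟨s, hs⟩ := hV.even_scalar (evenPart_act ha) (SuperSpace.parity_even (evenPart_mem a))
    have hop := SuperSpace.parity_odd (oddPart_mem (V := V.toSuperSpace) (W := V.toSuperSpace) a)
    have h1 : oddPart (V := V.toSuperSpace) (W := V.toSuperSpace) a = 0 := by
      by_contra h
      obtain ⟨v, hv⟩ := hodd _ h (oddPart_act ha)
      exact hv (hop v)
    refine ⟨s, 0, fun v => ?_⟩
    rw [zero_smul, add_zero, ← hs]
    have := LinearMap.congr_fun
      (evenPart_add_oddPart (V := V.toSuperSpace) (W := V.toSuperSpace) a) v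
    rw [h1] at this
    simpa using this.symm

namespace IsSchur

variable {V : Mod.{u, v} L} {α : V →ₗ[ℂ] V}

lemma homs_one_eq_span (h : V.IsSchur α) :
    homs V V 1 = Submodule.span ℂ {α ∘ₗ V.toSuperSpace.parity} := by
  refine le_antisymm (fun φ hφ => ?_) ?_
  · obtain ⟨s, t, hst⟩ := h.exists_eq (φ ∘ₗ V.toSuperSpace.parity) fun x v => by
      simp [homs_one_parity_act hφ]
    refine Submodule.mem_span_singleton.2 ⟨t, LinearMap.ext fun v => ?_⟩
    simp only [LinearMap.comp_apply] at hst
    have hφp := SuperSpace.parity_odd hφ.1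
    -- The even part of `φ P = s + t α` is `s`, hence `s = 0`.
    have e1 := hst v
    have e2 := congrArg V.toSuperSpace.parity (hst (V.toSuperSpace.parity v))
    simp only [parity_parity, map_add, map_smul, hφp, h.odd] at e2
    have e3 := hst (V.toSuperSpace.parity v)
    rw [parity_parity] at e3
    have e4 : s • v = 0 := by
      have : (2 : ℂ) • (s • v) = 0 := by
        rw [e1] at e2
        linear_combination (norm := module) -e2
      simpa using this
    rw [LinearMap.smul_apply, LinearMap.comp_apply, e3, ← map_smul, ← map_smul,
      map_smul V.toSuperSpace.parity]
    have e5 : s • V.toSuperSpace.parity v = 0 := by rw [← map_smul, e4, map_zero]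
    rw [e5, zero_add]
  · rw [Submodule.span_singleton_le_iff_mem]
    exact comp_parity_mem_homs_one (mem_homGr_one h.odd) h.comm

lemma finrank_of_eq_zero (h : V.IsSchur α) (h0 : α = 0) : Module.finrank ℂ (homs V V 1) = 0 := by
  rw [h.homs_one_eq_span, h0, LinearMap.zero_comp, Submodule.span_zero_singleton]
  simp

lemma comp_parity_ne_zero (h0 : α ≠ 0) : α ∘ₗ V.toSuperSpace.parity ≠ 0 := fun h' =>
  h0 (LinearMap.ext fun v => by
    simpa using LinearMap.congr_fun h' (V.toSuperSpace.parity v))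

lemma finrank_of_ne_zero (h : V.IsSchur α) (h0 : α ≠ 0) : Module.finrank ℂ (homs V V 1) = 1 := by
  rw [h.homs_one_eq_span]
  exact finrank_span_singleton (comp_parity_ne_zero h0)

lemma nonempty_oddRoot_iff (h : V.IsSchur α) : Nonempty (OddRoot V) ↔ α ≠ 0 := by
  constructor
  · rintro ⟨φ, hφ, h2⟩ rfl
    have := h.nontrivial
    rw [h.homs_one_eq_span, LinearMap.zero_comp, Submodule.span_zero_singleton,
      Submodule.mem_bot] at hφ
    obtain ⟨v, hv⟩ := exists_ne (0 : V)
    have := LinearMap.congr_fun h2 v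
    simp [hφ, hv] at this
  · intro h0
    refine ⟨⟨α ∘ₗ V.toSuperSpace.parity,
      comp_parity_mem_homs_one (mem_homGr_one h.odd) h.comm, LinearMap.ext fun v => ?_⟩⟩
    simp [h.odd, h.zero_or.resolve_left h0]

/-- In `IsSchur`, the operator `α` may be replaced by the one coming from any odd root of `-1`. -/
lemma of_oddRoot (h : V.IsSchur α) {φ : V →ₗ[ℂ] V} (hφ : φ ∈ homs V V 1)
    (h2 : φ ∘ₗ φ = -LinearMap.id) :
    V.IsSchur (φ ∘ₗ V.toSuperSpace.parity) := by
  have hp := SuperSpace.parity_odd hφ.1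
  have h2' : ∀ v, φ (φ v) = -v := fun v => LinearMap.congr_fun h2 v
  have hmem := hφ
  rw [h.homs_one_eq_span, Submodule.mem_span_singleton] at hmem
  obtain ⟨c, rfl⟩ := hmem
  have hc : c ≠ 0 := by
    rintro rfl
    have := h.nontrivial
    obtain ⟨v, hv⟩ := exists_ne (0 : V)
    have := h2' v
    simp [hv] at this
  refine ⟨h.nontrivial, fun x v => ?_, fun v => ?_, Or.inr fun v => ?_, fun a ha => ?_⟩
  · simp [h.comm]
  · simp [h.odd]
  · have := h2' v
    simp only [LinearMap.smul_apply, LinearMap.comp_apply, parity_parity, h.odd, map_smul, map_neg,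
      smul_neg, neg_inj, neg_neg] at this ⊢
    exact this
  · obtain ⟨s, t, hst⟩ := h.exists_eq a ha
    refine ⟨s, t * c⁻¹, fun v => ?_⟩
    rw [hst]
    simp [smul_smul, hc]

end IsSchur

end Schur

/-! ### The commutant of a tensor product -/

section Tensor

/-- The algebra acting on `V ⊗ W` contains operators acting on each factor as given, and by zero on
the other one. -/
structure ActIndependently (V : Mod.{u, v} L) (W : Mod.{u, w} L) : Prop where
  left : ∀ i, ∀ x ∈ L.gr i, ∃ y ∈ L.gr i, V.act y = V.act x ∧ W.act y = 0
  right : ∀ i, ∀ x ∈ L.gr i, ∃ y ∈ L.gr i, V.act y = 0 ∧ W.act y = W.act x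

lemma eq_zero_of_tmul_eq_zero {V W : Type*} [AddCommGroup V] [Module ℂ V] [AddCommGroup W]
    [Module ℂ W] {v : V} {p : W} (h : v ⊗ₜ[ℂ] p = 0) (hv : v ≠ 0) : p = 0 := by
  by_contra hp
  obtain ⟨f, hf⟩ := not_forall.1 (mt (Module.forall_dual_apply_eq_zero_iff ℂ v).1 hv)
  obtain ⟨g, hg⟩ := not_forall.1 (mt (Module.forall_dual_apply_eq_zero_iff ℂ p).1 hp)
  have := congrArg ((TensorProduct.lid ℂ ℂ).toLinearMap ∘ₗ TensorProduct.map f g) h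
  simp at this
  tauto

/-- The identity and the odd operator `α` are linearly independent, unless `α = 0`, even with
coefficients in a vector space `W`: the parity operator separates the two terms. -/
lemma IsSchur.independent {V : Mod.{u, v} L} {α : V →ₗ[ℂ] V} (h : V.IsSchur α) {W : Type*}
    [AddCommGroup W] [Module ℂ W] {p q : W} (hpq : ∀ v : V, v ⊗ₜ[ℂ] p + α v ⊗ₜ[ℂ] q = 0) :
    p = 0 ∧ (α = 0 ∨ q = 0) := by
  have := h.nontrivial
  have h1 : ∀ v : V, v ⊗ₜ[ℂ] p - α v ⊗ₜ[ℂ] q = 0 := fun v => by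
    have := congrArg (TensorProduct.map V.toSuperSpace.parity (LinearMap.id (R := ℂ) (M := W)))
      (hpq (V.toSuperSpace.parity v))
    simpa [h.odd, TensorProduct.neg_tmul, sub_eq_add_neg] using this
  have h2 : ∀ v : V, v ⊗ₜ[ℂ] p = 0 := fun v => by
    have : (2 : ℂ) • (v ⊗ₜ[ℂ] p) = 0 := by
      linear_combination (norm := module) hpq v + h1 v
    simpa using this
  obtain ⟨v, hv⟩ := exists_ne (0 : V)
  refine ⟨eq_zero_of_tmul_eq_zero (h2 v) hv, ?_⟩
  rcases h.zero_or with h0 | h0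
  · exact Or.inl h0
  · refine Or.inr (eq_zero_of_tmul_eq_zero (v := α v) ?_ ?_)
    · have := hpq v
      rwa [h2, zero_add] at this
    · intro h'
      exact hv (by rw [← h0 v, h', map_zero])

/-- The commutant of `V ⊗ W` is spanned by `1`, `1 ⊗ β`, `α ⊗ P` and `α ⊗ β P`, where `P` is the
parity operator. Indeed, an operator `f` commuting with the first action has matrix coefficients,
with respect to a basis of `W`, in the commutant of `V`, so that `f = 1 ⊗ A + α ⊗ B`; since `f`
commutes with the second action as well, `A` and `B P` are in the commutant of `W`. -/
lemma IsSchur.exists_eq_tensor {V : Mod.{u, v} L} {W : Mod.{u, w} L} {α : V →ₗ[ℂ] V}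
    {β : W →ₗ[ℂ] W} (hV : V.IsSchur α) (hW : W.IsSchur β) [FiniteDimensional ℂ W]
    (hVW : ActIndependently V W) (f : V.carrier ⊗[ℂ] W.carrier →ₗ[ℂ] V.carrier ⊗[ℂ] W.carrier)
    (hf : ∀ x s, f (tensorAct V W x s) = tensorAct V W x (f s)) :
    ∃ s t s' t' : ℂ, ∀ v y, f (v ⊗ₜ y) = s • (v ⊗ₜ y) + t • (v ⊗ₜ β y) +
      s' • (α v ⊗ₜ W.toSuperSpace.parity y) + t' • (α v ⊗ₜ β (W.toSuperSpace.parity y)) := by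
  -- `f` commutes with the operators of the first factor.
  have hf1 : ∀ x s, f (TensorProduct.map (V.act x) LinearMap.id s) =
      TensorProduct.map (V.act x) LinearMap.id (f s) := by
    intro x
    refine homogeneous_ind (P := fun x => ∀ s, f (TensorProduct.map (V.act x) LinearMap.id s) =
      TensorProduct.map (V.act x) LinearMap.id (f s)) (fun x y hx hy s => ?_) (fun i x hx s => ?_) x
    · rw [map_add, TensorProduct.map_add_left, LinearMap.add_apply, LinearMap.add_apply, map_add,
        hx, hy]
    · obtain ⟨z, hz, z1, z2⟩ := hVW.left i x hx
      have e : tensorAct V W z = TensorProduct.map (V.act x) LinearMap.id :=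
        TensorProduct.ext' fun v y => by simp [tensorAct_of_mem V W hz, z1, z2]
      rw [← e]; exact hf z s
  let b := Module.finBasis ℂ W
  let a : ∀ k l, V →ₗ[ℂ] V := fun k l => (TensorProduct.rid ℂ V).toLinearMap ∘ₗ
    TensorProduct.map LinearMap.id (b.coord k) ∘ₗ f ∘ₗ (TensorProduct.mk ℂ V W).flip (b l)
  have ha : ∀ k l x v, a k l (V.act x v) = V.act x (a k l v) := by
    intro k l x v
    have h1 := hf1 x (v ⊗ₜ b l)
    simp only [TensorProduct.map_tmul, LinearMap.id_apply] at h1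
    simp only [a, LinearMap.comp_apply, LinearMap.flip_apply, TensorProduct.mk_apply, h1]
    generalize f (v ⊗ₜ b l) = s
    induction s using TensorProduct.induction_on with
    | zero => simp
    | add s s' hs hs' => simp only [map_add, hs, hs']
    | tmul v' y => simp
  choose S T hST using fun k l => hV.exists_eq (a k l) (ha k l)
  have hsum : ∀ s : V.carrier ⊗[ℂ] W.carrier, s = ∑ k, (TensorProduct.rid ℂ V)
      (TensorProduct.map LinearMap.id (b.coord k) s) ⊗ₜ b k := by
    intro s
    induction s using TensorProduct.induction_on with
    | zero => simp
    | add s s' hs hs' =>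
      simp only [map_add, TensorProduct.add_tmul, Finset.sum_add_distrib]
      rw [← hs, ← hs']
    | tmul v y =>
      conv_lhs => rw [← b.sum_repr y, TensorProduct.tmul_sum]
      simp [TensorProduct.smul_tmul]
  -- For `α = 0` the operator `B` is not determined by `f`, and is chosen to be zero.
  obtain ⟨A, B, hAB, hB⟩ : ∃ A B : W →ₗ[ℂ] W, (∀ v y, f (v ⊗ₜ y) = v ⊗ₜ A y + α v ⊗ₜ B y) ∧
      (α = 0 → B = 0) := by
    suffices h : ∃ A B : W →ₗ[ℂ] W, ∀ v y, f (v ⊗ₜ y) = v ⊗ₜ A y + α v ⊗ₜ B y by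
      obtain ⟨A, B, h⟩ := h
      by_cases h0 : α = 0
      · exact ⟨A, 0, by simpa [h0] using h, fun _ => rfl⟩
      · exact ⟨A, B, h, fun h' => absurd h' h0⟩
    refine ⟨b.constr ℂ fun l => ∑ k, S k l • b k, b.constr ℂ fun l => ∑ k, T k l • b k,
      fun v => ?_⟩
    have h : f ∘ₗ TensorProduct.mk ℂ V W v = TensorProduct.mk ℂ V W v ∘ₗ
        (b.constr ℂ fun l => ∑ k, S k l • b k) + TensorProduct.mk ℂ V W (α v) ∘ₗ
        (b.constr ℂ fun l => ∑ k, T k l • b k) := by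
      refine b.ext fun l => ?_
      simp only [LinearMap.comp_apply, LinearMap.add_apply, TensorProduct.mk_apply,
        Module.Basis.constr_basis]
      rw [hsum (f (v ⊗ₜ b l)), TensorProduct.tmul_sum, TensorProduct.tmul_sum,
        ← Finset.sum_add_distrib]
      refine Finset.sum_congr rfl fun k _ => ?_
      have := hST k l v
      simp only [a, LinearMap.comp_apply, LinearMap.flip_apply, TensorProduct.mk_apply,
        LinearEquiv.coe_coe] at this
      rw [this, TensorProduct.add_tmul, TensorProduct.smul_tmul, TensorProduct.smul_tmul]
    exact fun y => LinearMap.congr_fun h y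
  have hz : ∀ i, ∀ x ∈ L.gr i, ∀ v y, f (parityPow V.toSuperSpace i v ⊗ₜ W.act x y) =
      TensorProduct.map (parityPow V.toSuperSpace i) (W.act x) (f (v ⊗ₜ y)) := by
    intro i x hx v y
    obtain ⟨z, hz, z1, z2⟩ := hVW.right i x hx
    have e : tensorAct V W z = TensorProduct.map (parityPow V.toSuperSpace i) (W.act x) :=
        TensorProduct.ext' fun v y => by simp [tensorAct_of_mem V W hz, z1, z2]
    rw [← e, ← hf z, e, TensorProduct.map_tmul]
  have key : (∀ x y, A (W.act x y) = W.act x (A y)) ∧ ∀ i, ∀ x ∈ L.gr i, ∀ y,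
      B (W.act x y) = ksgn 1 i • W.act x (B y) := by
    have h : ∀ i, ∀ x ∈ L.gr i, ∀ y, A (W.act x y) = W.act x (A y) ∧
        B (W.act x y) = ksgn 1 i • W.act x (B y) := by
      intro i x hx y
      have h' : A (W.act x y) - W.act x (A y) = 0 ∧
          (α = 0 ∨ B (W.act x y) - ksgn 1 i • W.act x (B y) = 0) := by
        refine hV.independent fun v => ?_
        rcases zmod2_cases i with rfl | rfl
        · have := hz 0 x hx v y
          simp only [parityPow, hAB, if_true, LinearMap.id_apply, map_add,
            TensorProduct.map_tmul] at this
          simp only [ksgn_zero_right, one_smul, TensorProduct.tmul_sub]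
          linear_combination (norm := module) this
        · have := hz 1 x hx (V.toSuperSpace.parity v) y
          simp only [parityPow, hAB, one_ne_zero, if_false, map_add,
            TensorProduct.map_tmul, parity_parity, hV.odd, TensorProduct.neg_tmul] at this
          simp only [ksgn_one_one, neg_smul, one_smul, TensorProduct.tmul_sub,
            TensorProduct.tmul_neg]
          linear_combination (norm := module) this
      refine ⟨sub_eq_zero.1 h'.1, ?_⟩
      rcases h'.2 with h0 | h0
      · simp [hB h0]
      · exact sub_eq_zero.1 h0
    exact ⟨fun x y => homogeneous_ind (P := fun x => A (W.act x y) = W.act x (A y))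
      (fun x x' hx hx' => by simp [hx, hx']) (fun i x hx => (h i x hx y).1) x,
      fun i x hx y => (h i x hx y).2⟩
  obtain ⟨s, t, hst⟩ := hW.exists_eq A key.1
  obtain ⟨s', t', hst'⟩ := hW.exists_eq (B ∘ₗ W.toSuperSpace.parity) fun x y =>
    homogeneous_ind (P := fun x => (B ∘ₗ W.toSuperSpace.parity) (W.act x y) =
        W.act x ((B ∘ₗ W.toSuperSpace.parity) y))
      (fun x x' hx hx' => by simp only [map_add, LinearMap.add_apply, hx, hx']) (fun i x hx => by
        simp only [LinearMap.comp_apply, W.parity_act hx, map_smul, key.2 i x hx, smul_smul]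
        rcases zmod2_cases i with rfl | rfl <;> simp) x
  refine ⟨s, t, s', t', fun v y => ?_⟩
  have e := hst' (W.toSuperSpace.parity y)
  simp only [LinearMap.comp_apply, parity_parity] at e
  rw [hAB, hst, e]
  simp only [TensorProduct.tmul_add, TensorProduct.tmul_smul]
  abel

end Tensor

end LieSuper.Mod

/-! ### The irreducible product of two modules -/

namespace LieSuper.Mod

open SuperSpace

variable {L : LieSuper.{u}}

section IrrProd

variable {V : Mod.{u, v} L} {W : Mod.{u, w} L} {α : V →ₗ[ℂ] V} {β : W →ₗ[ℂ] W}

lemma map_id_comm (hW : W.IsSchur β) (x : L) (s : V.carrier ⊗[ℂ] W.carrier) :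
    TensorProduct.map LinearMap.id β (tensorAct V W x s) =
      tensorAct V W x (TensorProduct.map LinearMap.id β s) := by
  refine homogeneous_ind (P := fun x => TensorProduct.map LinearMap.id β (tensorAct V W x s) =
      tensorAct V W x (TensorProduct.map LinearMap.id β s)) (fun x y hx hy => ?_)
    (fun i x hx => ?_) x
  · simp only [map_add, LinearMap.add_apply, hx, hy]
  · induction s using TensorProduct.induction_on with
    | zero => simp
    | add s s' hs hs' => simp only [map_add, hs, hs']
    | tmul v y => simp [tensorAct_of_mem V W hx, hW.comm]

lemma map_parity_comm (hV : V.IsSchur α) (x : L) (s : V.carrier ⊗[ℂ] W.carrier) :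
    TensorProduct.map α W.toSuperSpace.parity (tensorAct V W x s) =
      tensorAct V W x (TensorProduct.map α W.toSuperSpace.parity s) := by
  refine homogeneous_ind (P := fun x => TensorProduct.map α W.toSuperSpace.parity
      (tensorAct V W x s) = tensorAct V W x (TensorProduct.map α W.toSuperSpace.parity s))
    (fun x y hx hy => ?_) (fun i x hx => ?_) x
  · simp only [map_add, LinearMap.add_apply, hx, hy]
  · induction s using TensorProduct.induction_on with
    | zero => simp
    | add s s' hs hs' => simp only [map_add, hs, hs']
    | tmul v y =>
      have p := fun v => W.parity_act hx v
      rcases zmod2_cases i with rfl | rfl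
      · simp only [ksgn_zero_right, one_smul] at p
        simp [tensorAct_even _ _ hx, hV.comm, p]
      · simp [tensorAct_odd _ _ hx, hV.comm, hV.odd, parity_act_odd _ hx, TensorProduct.neg_tmul,
          TensorProduct.tmul_neg]

lemma nontrivial_tensor (hV : Nontrivial V) (hW : Nontrivial W) :
    Nontrivial (V.carrier ⊗[ℂ] W.carrier) := by
  obtain ⟨v, hv⟩ := exists_ne (0 : V)
  obtain ⟨y, hy⟩ := exists_ne (0 : W)
  exact ⟨v ⊗ₜ y, 0, fun h => hy (eq_zero_of_tmul_eq_zero h hv)⟩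

lemma isSchur_tensor {γ : V.carrier ⊗[ℂ] W.carrier →ₗ[ℂ] V.carrier ⊗[ℂ] W.carrier}
    (hn : Nontrivial (V.carrier ⊗[ℂ] W.carrier))
    (hc : ∀ x s, γ (tensorAct V W x s) = tensorAct V W x (γ s))
    (ho : ∀ s, TensorProduct.map V.toSuperSpace.parity W.toSuperSpace.parity (γ s) =
      -γ (TensorProduct.map V.toSuperSpace.parity W.toSuperSpace.parity s))
    (h0 : γ = 0 ∨ ∀ s, γ (γ s) = s)
    (he : ∀ f : V.carrier ⊗[ℂ] W.carrier →ₗ[ℂ] V.carrier ⊗[ℂ] W.carrier,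
      (∀ x s, f (tensorAct V W x s) = tensorAct V W x (f s)) →
      ∃ s t : ℂ, ∀ e, f e = s • e + t • γ e) : (tensor V W).IsSchur γ where
  nontrivial := hn
  comm := hc
  odd s := by
    have hp := LinearMap.congr_fun (parity_tensor V.toSuperSpace W.toSuperSpace)
    exact ((hp _).trans (ho s)).trans (congrArg (fun s => -γ s) (hp s).symm)
  zero_or := h0
  exists_eq := he

/-- If only the second factor may have odd endomorphisms, `V ⊗ W` satisfies Schur's lemma. -/
lemma IsSchur.tensor_of_left (hV : V.IsSchur α) (hW : W.IsSchur β) [FiniteDimensional ℂ W]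
    (hVW : ActIndependently V W) (h0 : α = 0) :
    (tensor V W).IsSchur (TensorProduct.map (LinearMap.id : V →ₗ[ℂ] V) β) := by
  refine isSchur_tensor (nontrivial_tensor hV.nontrivial hW.nontrivial) (map_id_comm hW)
    (fun s => ?_) ?_ fun f hf => ?_
  · induction s using TensorProduct.induction_on with
    | zero => simp
    | add s s' hs hs' => simp only [map_add, hs, hs', neg_add]
    | tmul v y => simp [hW.odd, TensorProduct.tmul_neg]
  · rcases hW.zero_or with rfl | h
    · exact Or.inl (TensorProduct.map_zero_right _)
    · refine Or.inr fun s => ?_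
      induction s using TensorProduct.induction_on with
      | zero => simp
      | add s s' hs hs' => simp only [map_add, hs, hs']
      | tmul v y => simp [h]
  · obtain ⟨s, t, s', t', h⟩ := hV.exists_eq_tensor hW hVW f hf
    refine ⟨s, t, fun e => ?_⟩
    induction e using TensorProduct.induction_on with
    | zero => simp
    | add e e' he he' => rw [map_add, map_add, he, he']; module
    | tmul v y => simp [h, h0]

/-- If only the first factor may have odd endomorphisms, `V ⊗ W` satisfies Schur's lemma. -/
lemma IsSchur.tensor_of_right (hV : V.IsSchur α) (hW : W.IsSchur β) [FiniteDimensional ℂ W]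
    (hVW : ActIndependently V W) (h0 : β = 0) :
    (tensor V W).IsSchur (TensorProduct.map α W.toSuperSpace.parity) := by
  refine isSchur_tensor (nontrivial_tensor hV.nontrivial hW.nontrivial) (map_parity_comm hV)
    (fun s => ?_) ?_ fun f hf => ?_
  · induction s using TensorProduct.induction_on with
    | zero => simp
    | add s s' hs hs' => simp only [map_add, hs, hs', neg_add]
    | tmul v y => simp [hV.odd, TensorProduct.neg_tmul]
  · rcases hV.zero_or with rfl | h
    · exact Or.inl (TensorProduct.map_zero_left _)
    · refine Or.inr fun s => ?_
      induction s using TensorProduct.induction_on with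
      | zero => simp
      | add s s' hs hs' => simp only [map_add, hs, hs']
      | tmul v y => simp [h]
  · obtain ⟨s, t, s', t', h⟩ := hV.exists_eq_tensor hW hVW f hf
    refine ⟨s, s', fun e => ?_⟩
    induction e using TensorProduct.induction_on with
    | zero => simp
    | add e e' he he' => rw [map_add, map_add, he, he']; module
    | tmul v y => simp [h, h0]

section Hat

variable {φ₁ : V →ₗ[ℂ] V} {φ₂ : W →ₗ[ℂ] W}

lemma hatOp_hatOp (h₁ : φ₁ ∈ homs V V 1) (r₁ : φ₁ ∘ₗ φ₁ = -LinearMap.id)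
    (r₂ : φ₂ ∘ₗ φ₂ = -LinearMap.id) (s : V.carrier ⊗[ℂ] W.carrier) :
    hatOp V W φ₁ φ₂ (hatOp V W φ₁ φ₂ s) = s := by
  have r₁ := LinearMap.congr_fun r₁
  have r₂ := LinearMap.congr_fun r₂
  simp only [LinearMap.comp_apply, LinearMap.neg_apply, LinearMap.id_apply] at r₁ r₂
  induction s using TensorProduct.induction_on with
  | zero => simp
  | add s s' hs hs' => simp only [map_add, hs, hs']
  | tmul v y =>
    simp [hatOp, SuperSpace.parity_odd h₁.1, r₁, r₂, smul_smul, TensorProduct.tmul_neg]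

lemma hatOp_act (h₁ : φ₁ ∈ homs V V 1) (h₂ : φ₂ ∈ homs W W 1) (x : L)
    (s : V.carrier ⊗[ℂ] W.carrier) :
    hatOp V W φ₁ φ₂ (tensorAct V W x s) = tensorAct V W x (hatOp V W φ₁ φ₂ s) := by
  refine homogeneous_ind (P := fun x => hatOp V W φ₁ φ₂ (tensorAct V W x s) =
      tensorAct V W x (hatOp V W φ₁ φ₂ s)) (fun x y hx hy => ?_) (fun i x hx => ?_) x
  · simp only [map_add, LinearMap.add_apply, hx, hy]
  · induction s using TensorProduct.induction_on with
    | zero => simp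
    | add s s' hs hs' => simp only [map_add, hs, hs']
    | tmul v y =>
      have c1 := fun v => h₁.2 i x hx v
      have c2 := fun v => h₂.2 i x hx v
      rcases zmod2_cases i with rfl | rfl
      · have c3 := fun v => V.parity_act hx v
        simp only [ksgn_zero_right, one_smul] at c1 c2 c3
        simp [hatOp, tensorAct_even _ _ hx, c1, c2, c3]
      · simp only [ksgn_one_one, neg_smul, one_smul] at c1 c2
        simp [hatOp, tensorAct_odd _ _ hx, c1, c2, parity_act_odd _ hx, SuperSpace.parity_odd h₁.1,
          TensorProduct.neg_tmul, TensorProduct.tmul_neg]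

/-- The operator `a (1 ⊗ φ₂ P) + b (φ₁ P ⊗ P)` on `V ⊗ W`, for the parity operators `P`. -/
noncomputable def antiOp (V : Mod.{u, v} L) (W : Mod.{u, w} L) (φ₁ : V →ₗ[ℂ] V) (φ₂ : W →ₗ[ℂ] W)
    (a b : ℂ) : V.carrier ⊗[ℂ] W.carrier →ₗ[ℂ] V.carrier ⊗[ℂ] W.carrier :=
  a • TensorProduct.map LinearMap.id (φ₂ ∘ₗ W.toSuperSpace.parity) +
    b • TensorProduct.map (φ₁ ∘ₗ V.toSuperSpace.parity) W.toSuperSpace.parity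

lemma hatOp_antiOp (h₁ : φ₁ ∈ homs V V 1) (h₂ : φ₂ ∈ homs W W 1) (a b : ℂ)
    (s : V.carrier ⊗[ℂ] W.carrier) :
    hatOp V W φ₁ φ₂ (antiOp V W φ₁ φ₂ a b s) = -antiOp V W φ₁ φ₂ a b (hatOp V W φ₁ φ₂ s) := by
  induction s using TensorProduct.induction_on with
  | zero => simp
  | add s s' hs hs' => simp only [map_add, hs, hs', neg_add]
  | tmul v y =>
    simp only [hatOp, antiOp, LinearMap.add_apply, LinearMap.smul_apply,
      TensorProduct.map_tmul, LinearMap.comp_apply, LinearMap.id_apply, map_add, map_smul,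
      SuperSpace.parity_odd h₁.1,
      SuperSpace.parity_odd h₂.1, map_neg, TensorProduct.neg_tmul, TensorProduct.tmul_neg]
    module

/-- The projection of `V ⊗ W` onto the eigenspace of `hatOp` for the eigenvalue `1`. -/
noncomputable def hatProj (h₁ : φ₁ ∈ homs V V 1) (h₂ : φ₂ ∈ homs W W 1)
    (r₁ : φ₁ ∘ₗ φ₁ = -LinearMap.id) (r₂ : φ₂ ∘ₗ φ₂ = -LinearMap.id) :
    V.carrier ⊗[ℂ] W.carrier →ₗ[ℂ] hat V W h₁ h₂ :=
  LinearMap.codRestrict (LinearMap.eqLocus (hatOp V W φ₁ φ₂) LinearMap.id)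
    ((1/2 : ℂ) • (LinearMap.id + hatOp V W φ₁ φ₂)) fun s => by
      change hatOp V W φ₁ φ₂ _ = _
      simp [hatOp_hatOp h₁ r₁ r₂, add_comm]

/-- The inclusion of the eigenspace of `hatOp` for the eigenvalue `1`. -/
noncomputable def hatIncl (h₁ : φ₁ ∈ homs V V 1) (h₂ : φ₂ ∈ homs W W 1) :
    hat V W h₁ h₂ →ₗ[ℂ] V.carrier ⊗[ℂ] W.carrier :=
  Submodule.subtype (LinearMap.eqLocus (hatOp V W φ₁ φ₂) LinearMap.id)

section
variable (h₁ : φ₁ ∈ homs V V 1) (h₂ : φ₂ ∈ homs W W 1)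
    (r₁ : φ₁ ∘ₗ φ₁ = -LinearMap.id) (r₂ : φ₂ ∘ₗ φ₂ = -LinearMap.id)

lemma hatIncl_injective : Function.Injective (hatIncl h₁ h₂) := Subtype.val_injective

lemma hatIncl_hatProj (s : V.carrier ⊗[ℂ] W.carrier) :
    hatIncl h₁ h₂ (hatProj h₁ h₂ r₁ r₂ s) = (1/2 : ℂ) • (s + hatOp V W φ₁ φ₂ s) := rfl

lemma hatOp_hatIncl (e : hat V W h₁ h₂) :
    hatOp V W φ₁ φ₂ (hatIncl h₁ h₂ e) = hatIncl h₁ h₂ e := e.2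

lemma hatIncl_act (x : L) (e : hat V W h₁ h₂) :
    hatIncl h₁ h₂ ((hat V W h₁ h₂).act x e) = tensorAct V W x (hatIncl h₁ h₂ e) := rfl

lemma hatProj_act (x : L) (s : V.carrier ⊗[ℂ] W.carrier) :
    hatProj h₁ h₂ r₁ r₂ (tensorAct V W x s) =
      (hat V W h₁ h₂).act x (hatProj h₁ h₂ r₁ r₂ s) := by
  apply hatIncl_injective h₁ h₂
  rw [hatIncl_act, hatIncl_hatProj, hatIncl_hatProj, hatOp_act h₁ h₂]
  simp

lemma hatProj_hatIncl (e : hat V W h₁ h₂) : hatProj h₁ h₂ r₁ r₂ (hatIncl h₁ h₂ e) = e := by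
  apply hatIncl_injective h₁ h₂
  rw [hatIncl_hatProj, hatOp_hatIncl]
  module

lemma hatProj_eq_zero {s : V.carrier ⊗[ℂ] W.carrier} (hs : hatOp V W φ₁ φ₂ s = -s) :
    hatProj h₁ h₂ r₁ r₂ s = 0 := by
  apply hatIncl_injective h₁ h₂
  rw [hatIncl_hatProj, hs]
  simp

end

/-- The two eigenspaces of `hatOp` are interchanged by the operator `φ₁ P ⊗ P`, which commutes with
the action. -/
lemma ungradedIso_tensor_hat (hV : V.IsSchur α) (h₁ : φ₁ ∈ homs V V 1) (h₂ : φ₂ ∈ homs W W 1)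
    (r₁ : φ₁ ∘ₗ φ₁ = -LinearMap.id) (r₂ : φ₂ ∘ₗ φ₂ = -LinearMap.id) :
    UngradedIso (tensor V W) (copies 2 (hat V W h₁ h₂)) := by
  have hV' := hV.of_oddRoot h₁ r₁
  obtain ⟨D, hD⟩ : ∃ D : V.carrier ⊗[ℂ] W.carrier →ₗ[ℂ] V.carrier ⊗[ℂ] W.carrier,
    D = TensorProduct.map (φ₁ ∘ₗ V.toSuperSpace.parity) W.toSuperSpace.parity := ⟨_, rfl⟩
  have hDD : ∀ s, D (D s) = s := fun s => by
    have r₁ := LinearMap.congr_fun r₁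
    simp only [LinearMap.comp_apply, LinearMap.neg_apply, LinearMap.id_apply] at r₁
    rw [hD]
    induction s using TensorProduct.induction_on with
    | zero => simp
    | add s s' hs hs' => simp only [map_add, hs, hs']
    | tmul v y => simp [SuperSpace.parity_odd h₁.1, r₁]
  have hDact : ∀ x s, D (tensorAct V W x s) = tensorAct V W x (D s) := by
    rw [hD]; exact map_parity_comm hV'
  have hDT : ∀ s, hatOp V W φ₁ φ₂ (D s) = -D (hatOp V W φ₁ φ₂ s) := fun s => by
    have := hatOp_antiOp h₁ h₂ 0 1 s
    rw [hD]
    simpa [antiOp] using this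
  let e : V.carrier ⊗[ℂ] W.carrier ≃ₗ[ℂ] (Fin 2 → hat V W h₁ h₂) :=
    LinearEquiv.ofLinearMap
      (LinearMap.pi ![hatProj h₁ h₂ r₁ r₂, hatProj h₁ h₂ r₁ r₂ ∘ₗ D])
      (hatIncl h₁ h₂ ∘ₗ LinearMap.proj 0 + D ∘ₗ hatIncl h₁ h₂ ∘ₗ LinearMap.proj 1)
      (by
        refine LinearMap.ext fun p => funext fun k => ?_
        have z : ∀ e, hatProj h₁ h₂ r₁ r₂ (D (hatIncl h₁ h₂ e)) = 0 := fun e =>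
          hatProj_eq_zero h₁ h₂ r₁ r₂ (by rw [hDT, hatOp_hatIncl])
        fin_cases k
        · simp [hatProj_hatIncl, z]
        · simp [hatProj_hatIncl, z, hDD])
      (by
        refine LinearMap.ext fun s => ?_
        simp only [LinearMap.comp_apply, LinearMap.add_apply, LinearMap.proj_apply,
          LinearMap.pi_apply, Matrix.cons_val_zero, Matrix.cons_val_one, LinearMap.id_apply,
          hatIncl_hatProj, hDT, map_smul, map_add, hDD, map_neg]
        module)
  refine ⟨(tensorEquiv V W).trans e, fun x s => funext fun k => ?_⟩
  fin_cases k
  · exact hatProj_act h₁ h₂ r₁ r₂ x _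
  · exact (congrArg _ (hDact x _)).trans (hatProj_act h₁ h₂ r₁ r₂ x _)

lemma nontrivial_hat (hV : V.IsSchur α) (hW : W.IsSchur β) (h₁ : φ₁ ∈ homs V V 1)
    (h₂ : φ₂ ∈ homs W W 1) (r₁ : φ₁ ∘ₗ φ₁ = -LinearMap.id) (r₂ : φ₂ ∘ₗ φ₂ = -LinearMap.id) :
    Nontrivial (hat V W h₁ h₂) := by
  obtain ⟨e, -⟩ := ungradedIso_tensor_hat hV h₁ h₂ r₁ r₂
  by_contra h
  rw [not_nontrivial_iff_subsingleton] at h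
  have := nontrivial_tensor hV.nontrivial hW.nontrivial
  have h2 : Subsingleton (copies 2 (hat V W h₁ h₂)) :=
    inferInstanceAs (Subsingleton (Fin 2 → hat V W h₁ h₂))
  exact not_subsingleton (V.carrier ⊗[ℂ] W.carrier)
    (((tensorEquiv V W).symm.trans e).injective.subsingleton)

/-- If both factors have odd roots of `-1`, the eigenspace of `hatOp` has scalar endomorphisms only:
among the operators spanning the commutant of `V ⊗ W`, two are combined in `antiOp`, which
anticommutes with `hatOp`, and the other two are `1` and a multiple of `hatOp`. -/
lemma IsSchur.hat_of_oddRoots (hV : V.IsSchur α) (hW : W.IsSchur β) [FiniteDimensional ℂ W]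
    (hVW : ActIndependently V W) (h₁ : φ₁ ∈ homs V V 1) (h₂ : φ₂ ∈ homs W W 1)
    (r₁ : φ₁ ∘ₗ φ₁ = -LinearMap.id) (r₂ : φ₂ ∘ₗ φ₂ = -LinearMap.id) :
    (hat V W h₁ h₂).IsSchur 0 where
  nontrivial := nontrivial_hat hV hW h₁ h₂ r₁ r₂
  comm x v := by simp
  odd v := by simp
  zero_or := Or.inl rfl
  exists_eq a ha := by
    obtain ⟨s, t, s', t', h⟩ := (hV.of_oddRoot h₁ r₁).exists_eq_tensor (hW.of_oddRoot h₂ r₂) hVW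
      (hatIncl h₁ h₂ ∘ₗ a ∘ₗ hatProj h₁ h₂ r₁ r₂)
      (fun x s => by simp only [LinearMap.comp_apply, hatProj_act, ha, hatIncl_act])
    have h' : ∀ e, hatIncl h₁ h₂ (a (hatProj h₁ h₂ r₁ r₂ e)) = s • e +
        antiOp V W φ₁ φ₂ t s' e -
        (t' * Complex.I) • hatOp V W φ₁ φ₂ e := fun e => by
      induction e using TensorProduct.induction_on with
      | zero => simp
      | add e e' he he' => simp only [map_add, he, he']; module
      | tmul v y =>
        refine (h v y).trans ?_
        simp only [hatOp, antiOp, LinearMap.add_apply, LinearMap.smul_apply,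
          TensorProduct.map_tmul, LinearMap.comp_apply, LinearMap.id_apply, parity_parity]
        match_scalars
        · ring
        · ring
        · ring
        · linear_combination t' * Complex.I_sq
    refine ⟨s - t' * Complex.I, 0, fun e => hatIncl_injective h₁ h₂ ?_⟩
    have e1 := h' (hatIncl h₁ h₂ e)
    rw [hatProj_hatIncl, hatOp_hatIncl] at e1
    -- The off-diagonal part maps the eigenspace to the other one, and is therefore zero on it.
    have e2 := congrArg (hatOp V W φ₁ φ₂) e1
    rw [hatOp_hatIncl, map_sub, map_add, map_smul, map_smul, hatOp_hatIncl, hatOp_antiOp h₁ h₂,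
      hatOp_hatIncl] at e2
    rw [zero_smul, add_zero, map_smul]
    linear_combination (norm := module) (1/2 : ℂ) • e1 + (1/2 : ℂ) • e2

/-- If both factors have odd roots of `-1`, then `V ⊗ W` is reducible: the eigenspaces of `hatOp`
are proper submodules. -/
lemma IsSchur.not_isIrreducible_tensor (hV : V.IsSchur α) (hW : W.IsSchur β)
    (h₁ : φ₁ ∈ homs V V 1) (h₂ : φ₂ ∈ homs W W 1)
    (r₁ : φ₁ ∘ₗ φ₁ = -LinearMap.id) (r₂ : φ₂ ∘ₗ φ₂ = -LinearMap.id) :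
    ¬ (tensor V W).IsIrreducible := by
  intro h
  have hn := nontrivial_hat hV hW h₁ h₂ r₁ r₂
  obtain ⟨e, he⟩ := exists_ne (0 : hat V W h₁ h₂)
  have he' : hatIncl h₁ h₂ e ≠ 0 := fun h' =>
    he (hatIncl_injective h₁ h₂ (h'.trans (map_zero _).symm))
  rcases h.eq_bot_or_eq_top _ (hat_isSubmodule V W h₁ h₂) with h0 | h0
  · have h1 : hatIncl h₁ h₂ e ∈ LinearMap.eqLocus (hatOp V W φ₁ φ₂) LinearMap.id :=
      hatOp_hatIncl h₁ h₂ e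
    have h2 : hatIncl h₁ h₂ e ∈ (⊥ : Submodule ℂ (V.carrier ⊗[ℂ] W.carrier)) := h0 ▸ h1
    exact he' h2
  · have h1 : ∀ s, hatOp V W φ₁ φ₂ s = s := fun s => by
      have : s ∈ (⊤ : Submodule ℂ (V.carrier ⊗[ℂ] W.carrier)) := trivial
      have h2 : s ∈ LinearMap.eqLocus (hatOp V W φ₁ φ₂) LinearMap.id := h0 ▸ this
      exact h2
    have h2 := hatOp_antiOp h₁ h₂ 0 1 (hatIncl h₁ h₂ e)
    rw [h1, hatOp_hatIncl] at h2
    simp only [antiOp, zero_smul, one_smul, zero_add] at h2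
    have h3 : TensorProduct.map (φ₁ ∘ₗ V.toSuperSpace.parity) W.toSuperSpace.parity
        (hatIncl h₁ h₂ e) = 0 := by
      have : (2 : ℂ) • TensorProduct.map (φ₁ ∘ₗ V.toSuperSpace.parity) W.toSuperSpace.parity
        (hatIncl h₁ h₂ e) = 0 := by linear_combination (norm := module) h2
      simpa using this
    apply he'
    have hα := (hV.of_oddRoot h₁ r₁).zero_or
    have r₁' := LinearMap.congr_fun r₁
    simp only [LinearMap.comp_apply, LinearMap.neg_apply, LinearMap.id_apply] at r₁'
    have h4 : TensorProduct.map (φ₁ ∘ₗ V.toSuperSpace.parity) W.toSuperSpace.parity ∘ₗ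
      TensorProduct.map (φ₁ ∘ₗ V.toSuperSpace.parity) W.toSuperSpace.parity = LinearMap.id :=
      TensorProduct.ext' fun v y => by simp [SuperSpace.parity_odd h₁.1, r₁']
    have h5 := LinearMap.congr_fun h4 (hatIncl h₁ h₂ e)
    rw [LinearMap.comp_apply, h3, map_zero] at h5
    exact h5.symm

end Hat

end IrrProd

/-- The irreducible product of two modules satisfying Schur's lemma, on which the algebra acts
independently, satisfies Schur's lemma, and `V ⊗ W` is a sum of one or two copies of it. If one of
the factors has no odd endomorphisms, the definition of the irreducible product yields `V ⊗ W`
whether this is irreducible or not, so that its irreducibility need not be established. -/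
theorem IsSchur.irrProd_spec {V W : Mod.{u, v} L} {α : V →ₗ[ℂ] V} {β : W →ₗ[ℂ] W}
    (hV : V.IsSchur α) (hW : W.IsSchur β) [FiniteDimensional ℂ V] [FiniteDimensional ℂ W]
    (hVW : ActIndependently V W) :
    (∃ γ, (irrProd V W).IsSchur γ) ∧ FiniteDimensional ℂ (irrProd V W) ∧
    (∀ x, tensorAct V W x = 0 → (irrProd V W).act x = 0) ∧
    UngradedIso (tensor V W) (copies (2 ^ (Module.finrank ℂ (homs V V 1) *
      Module.finrank ℂ (homs W W 1))) (irrProd V W)) := by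
  have hfd : FiniteDimensional ℂ (V.carrier ⊗[ℂ] W.carrier) := inferInstance
  by_cases h : Nonempty (OddRoot V) ∧ Nonempty (OddRoot W)
  · have hi : ¬ (tensor V W).IsIrreducible :=
      hV.not_isIrreducible_tensor hW h.1.some.2.1 h.2.some.2.1 h.1.some.2.2 h.2.some.2.2
    have e : Mod.irrProd V W = hat V W h.1.some.2.1 h.2.some.2.1 := by
      unfold Mod.irrProd
      rw [if_neg hi, dif_pos h]
    rw [e, hV.finrank_of_ne_zero (hV.nonempty_oddRoot_iff.1 h.1),
      hW.finrank_of_ne_zero (hW.nonempty_oddRoot_iff.1 h.2)]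
    refine ⟨⟨0, hV.hat_of_oddRoots hW hVW h.1.some.2.1 h.2.some.2.1 h.1.some.2.2 h.2.some.2.2⟩,
      FiniteDimensional.of_injective _ (hatIncl_injective h.1.some.2.1 h.2.some.2.1),
      fun x hx => LinearMap.ext fun s => hatIncl_injective h.1.some.2.1 h.2.some.2.1 ?_,
      ungradedIso_tensor_hat hV h.1.some.2.1 h.2.some.2.1 h.1.some.2.2 h.2.some.2.2⟩
    rw [hatIncl_act, hx]
    simp
  · have e : Mod.irrProd V W = tensor V W := by
      unfold Mod.irrProd
      rw [dif_neg h, ite_self]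
    have hα : α = 0 ∨ β = 0 := by
      by_contra h'
      push Not at h'
      exact h ⟨hV.nonempty_oddRoot_iff.2 h'.1, hW.nonempty_oddRoot_iff.2 h'.2⟩
    rw [e]
    refine ⟨?_, hfd, fun x hx => hx, ?_⟩
    · rcases hα with h0 | h0
      · exact ⟨_, hV.tensor_of_left hW hVW h0⟩
      · exact ⟨_, hV.tensor_of_right hW hVW h0⟩
    · have : Module.finrank ℂ (homs V V 1) * Module.finrank ℂ (homs W W 1) = 0 := by
        rcases hα with h0 | h0
        · rw [hV.finrank_of_eq_zero h0, zero_mul]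
        · rw [hW.finrank_of_eq_zero h0, mul_zero]
      rw [this, pow_zero]
      exact (UngradedIso.copies_one _).symm

end LieSuper.Mod

/-! ### Cohomology -/

namespace LieSuper.Mod

open SuperSpace

variable {L : LieSuper.{u}}

section Ext

universe v' w'

/-- If the subspaces `B` and `Z` of `E` are given componentwise, then so is the quotient `Z / B`. -/
lemma nonempty_quotientEquiv_pi {ι E : Type*} {F : ι → Type*} [AddCommGroup E] [Module ℂ E]
    [∀ i, AddCommGroup (F i)] [∀ i, Module ℂ (F i)] (θ : ∀ i, E →ₗ[ℂ] F i) {Z B : Submodule ℂ E}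
    {Z' B' : ∀ i, Submodule ℂ (F i)} (hZ : ∀ c, c ∈ Z ↔ ∀ i, θ i c ∈ Z' i)
    (hB : ∀ c, c ∈ B ↔ ∀ i, θ i c ∈ B' i) (hθ : ∀ c : ∀ i, F i, ∃ b, ∀ i, θ i b = c i) :
    Nonempty ((Z ⧸ B.comap Z.subtype) ≃ₗ[ℂ] ∀ i, Z' i ⧸ (B' i).comap (Z' i).subtype) := by
  let Φ : Z →ₗ[ℂ] ∀ i, Z' i ⧸ (B' i).comap (Z' i).subtype := LinearMap.pi fun i =>
    Submodule.mkQ _ ∘ₗ (θ i).restrict (p := Z) (q := Z' i) fun c hc => (hZ c).1 hc i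
  have hs : Function.Surjective Φ := by
    intro y
    choose c hc using fun i => Submodule.mkQ_surjective _ (y i)
    obtain ⟨b, hb⟩ := hθ fun i => (c i).1
    refine ⟨⟨b, (hZ b).2 fun i => ?_⟩, funext fun i => ?_⟩
    · rw [hb]; exact (c i).2
    · rw [← hc i]
      exact congrArg (Submodule.mkQ _) (Subtype.ext (hb i))
  have hk : LinearMap.ker Φ = B.comap Z.subtype := by
    ext c
    rw [LinearMap.mem_ker, Submodule.mem_comap, Submodule.subtype_apply, hB, funext_iff]
    exact forall_congr' fun i => Submodule.Quotient.mk_eq_zero _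
  exact ⟨(Submodule.quotEquivOfEq _ _ hk.symm).trans (Φ.quotKerEquivOfSurjective hs)⟩

/-- Linear bijections from `Hom_ℂ(V, U)` to a product of spaces `Hom_ℂ(V'_i, U'_i)` which are
compatible with the part of the Chevalley–Eilenberg differential that involves the actions. -/
structure CochainIso (V : Mod.{u, v} L) (U : Mod.{u, w} L) {ι : Type t} (V' : ι → Mod.{u, v'} L)
    (U' : ι → Mod.{u, w'} L) where
  e : (V.carrier →ₗ[ℂ] U.carrier) ≃ₗ[ℂ] ∀ i, (V' i).carrier →ₗ[ℂ] (U' i).carrier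
  compat : ∀ s, ∀ x ∈ L.gr s, ∀ c i,
    e (U.act x ∘ₗ twist V.toSuperSpace U.toSuperSpace s c - c ∘ₗ V.act x) i =
      (U' i).act x ∘ₗ twist (V' i).toSuperSpace (U' i).toSuperSpace s (e c i) -
        e c i ∘ₗ (V' i).act x

namespace CochainIso

variable {V : Mod.{u, v} L} {U : Mod.{u, w} L} {ι : Type t} {V' : ι → Mod.{u, v'} L}
  {U' : ι → Mod.{u, w'} L} (Θ : CochainIso V U V' U')

/-- The `i`-th component of the image of a cochain. -/
def app (i : ι) {n : ℕ} : ((Fin n → L.carrier) → (V.carrier →ₗ[ℂ] U.carrier)) →ₗ[ℂ]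
    ((Fin n → L.carrier) → ((V' i).carrier →ₗ[ℂ] (U' i).carrier)) where
  toFun c x := Θ.e (c x) i
  map_add' c c' := by ext; simp
  map_smul' a c := by ext; simp

lemma app_apply (i : ι) {n : ℕ} (c : (Fin n → L.carrier) → (V.carrier →ₗ[ℂ] U.carrier))
    (x : Fin n → L.carrier) : Θ.app i c x = Θ.e (c x) i := rfl

/-- A family of functions as the components of a function. -/
def glue {n : ℕ} (c : ∀ i, (Fin n → L.carrier) → ((V' i).carrier →ₗ[ℂ] (U' i).carrier)) :
    (Fin n → L.carrier) → (V.carrier →ₗ[ℂ] U.carrier) := fun x => Θ.e.symm fun i => c i x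

lemma app_glue {n : ℕ} (c : ∀ i, (Fin n → L.carrier) → ((V' i).carrier →ₗ[ℂ] (U' i).carrier))
    (i : ι) : Θ.app i (Θ.glue c) = c i := by
  funext x
  simp [app_apply, glue]

lemma ext_app {n : ℕ} {c c' : (Fin n → L.carrier) → (V.carrier →ₗ[ℂ] U.carrier)}
    (h : ∀ i, Θ.app i c = Θ.app i c') : c = c' :=
  funext fun x => Θ.e.injective (funext fun i => congrFun (h i) x)

lemma app_codiff (i : ι) {n : ℕ} (c : (Fin n → L.carrier) → (V.carrier →ₗ[ℂ] U.carrier)) :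
    Θ.app i (codiff V U n c) = codiff (V' i) (U' i) n (Θ.app i c) := by
  funext x
  let E : (V.carrier →ₗ[ℂ] U.carrier) →ₗ[ℂ] ((V' i).carrier →ₗ[ℂ] (U' i).carrier) :=
    LinearMap.proj i ∘ₗ Θ.e.toLinearMap
  change E (∑ s : Fin (n + 1) → ZMod 2, codiffHom c s fun j => L.toSuperSpace.proj (s j) (x j)) =
    ∑ s : Fin (n + 1) → ZMod 2,
      codiffHom (Θ.app i c) s fun j => L.toSuperSpace.proj (s j) (x j)
  rw [map_sum]
  refine Finset.sum_congr rfl fun s _ => ?_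
  simp only [codiffHom, map_add, map_sum, map_smul]
  congr 1
  refine Finset.sum_congr rfl fun j _ => ?_
  congr 1
  exact Θ.compat (s j) _ (L.toSuperSpace.proj_mem _ _) _ i

lemma mem_cochains_iff {n : ℕ} {c : (Fin n → L.carrier) → (V.carrier →ₗ[ℂ] U.carrier)} :
    c ∈ cochains V U n ↔ ∀ i, Θ.app i c ∈ cochains (V' i) (U' i) n := by
  constructor
  · rintro ⟨⟨f, rfl⟩, hf⟩ i
    refine ⟨⟨(LinearMap.proj i ∘ₗ Θ.e.toLinearMap).compMultilinearMap f, rfl⟩,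
      fun s x hx j k hjk => ?_⟩
    rw [app_apply, app_apply, hf s x hx j k hjk]
    simp
  · intro h
    choose f hf using fun i => (h i).1
    refine ⟨⟨Θ.e.symm.toLinearMap.compMultilinearMap (MultilinearMap.pi f), ?_⟩,
      fun s x hx j k hjk => Θ.e.injective (funext fun i => ?_)⟩
    · funext x
      rw [← Θ.e.injective.eq_iff]
      funext i
      simpa [app_apply] using congrFun (hf i) x
    · have := (h i).2 s x hx j k hjk
      rw [app_apply, app_apply] at this
      rw [this]
      simp

lemma mem_cocycles_iff {p : ℕ} {c : (Fin p → L.carrier) → (V.carrier →ₗ[ℂ] U.carrier)} :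
    c ∈ cocycles V U p ↔ ∀ i, Θ.app i c ∈ cocycles (V' i) (U' i) p := by
  simp only [cocycles, Submodule.mem_inf, LinearMap.mem_ker, Θ.mem_cochains_iff, forall_and,
    ← Θ.app_codiff]
  refine and_congr_right fun _ => ⟨fun h i => by rw [h, map_zero], fun h => Θ.ext_app fun i => ?_⟩
  rw [h, map_zero]

lemma mem_coboundaries_iff {p : ℕ} {c : (Fin p → L.carrier) → (V.carrier →ₗ[ℂ] U.carrier)} :
    c ∈ coboundaries V U p ↔ ∀ i, Θ.app i c ∈ coboundaries (V' i) (U' i) p := by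
  cases p with
  | zero =>
    simp only [coboundaries, Submodule.mem_bot]
    exact ⟨fun h i => by rw [h, map_zero], fun h => Θ.ext_app fun i => by rw [h, map_zero]⟩
  | succ p =>
    simp only [coboundaries, Submodule.mem_map]
    constructor
    · rintro ⟨b, hb, rfl⟩ i
      exact ⟨Θ.app i b, Θ.mem_cochains_iff.1 hb i, (Θ.app_codiff i b).symm⟩
    · intro h
      choose b hb hbc using h
      refine ⟨Θ.glue b, Θ.mem_cochains_iff.2 fun i => ?_, Θ.ext_app fun i => ?_⟩
      · rw [app_glue]; exact hb i
      · rw [app_codiff, app_glue, hbc]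

/-- The isomorphism `Ext^p(V, U) ≅ ∏ Ext^p(V'_i, U'_i)`. -/
theorem nonempty_extEquiv (Θ : CochainIso V U V' U') (p : ℕ) :
    Nonempty (Ext V U p ≃ₗ[ℂ] ∀ i, Ext (V' i) (U' i) p) :=
  nonempty_quotientEquiv_pi (fun i => Θ.app i) (fun _ => Θ.mem_cocycles_iff)
    (fun _ => Θ.mem_coboundaries_iff) fun c => ⟨Θ.glue c, Θ.app_glue c⟩

end CochainIso

/-- `Ext^p(V, U) ≅ H^p(L, Hom_ℂ(V, U))`: the two cochain complexes are the same. -/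
theorem nonempty_extEquiv_hom (V : Mod.{u, v} L) (U : Mod.{u, w} L) (p : ℕ) :
    Nonempty (Ext V U p ≃ₗ[ℂ] H (hom V U) p) := by
  let e : (V.carrier →ₗ[ℂ] U.carrier) ≃ₗ[ℂ] ((triv.{u, 0} L).carrier →ₗ[ℂ] (hom V U).carrier) :=
    (homEquiv V U).symm.trans ((LinearMap.ringLmapEquivSelf ℂ ℂ _).symm.trans
      (LinearEquiv.arrowCongr (trivEquiv L).symm (LinearEquiv.refl ℂ _)))
  have he : ∀ c z, e c z = trivEquiv L z • (homEquiv V U).symm c := fun c z => by simp [e]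
  let Θ : CochainIso V U (fun _ : Unit => triv.{u, 0} L) (fun _ => hom V U) :=
    { e := e.trans (LinearEquiv.funUnique Unit ℂ _).symm
      compat := fun s x hx c _ => by
        change e _ = (hom V U).act x ∘ₗ twist (triv.{u, 0} L).toSuperSpace (hom V U).toSuperSpace s
          (e c) - e c ∘ₗ (triv.{u, 0} L).act x
        have hp : ∀ z, (triv.{u, 0} L).toSuperSpace.parity z = z := fun z =>
          parity_of_even _ trivial
        refine LinearMap.ext fun z => (homEquiv V U).injective ?_
        rcases zmod2_cases s with rfl | rfl
        · simp [he, twist, homAct_even _ _ hx, smul_sub]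
        · simp only [he, twist, one_ne_zero, if_false, LinearMap.sub_apply, LinearMap.comp_apply,
            hp, map_smul, homEquiv_act, homEquiv_parity, LinearEquiv.apply_symm_apply, map_sub,
            homAct_odd _ _ hx, triv_act, map_zero]
          ext v
          simp [smul_sub] }
  obtain ⟨E⟩ := Θ.nonempty_extEquiv p
  exact ⟨E.trans (LinearEquiv.funUnique Unit ℂ _)⟩

/-- Isomorphic modules have isomorphic cohomology. -/
theorem Iso.nonempty_hEquiv {U : Mod.{u, v} L} {U' : Mod.{u, w} L} (h : U.Iso U') (p : ℕ) :
    Nonempty (H U p ≃ₗ[ℂ] H U' p) := by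
  obtain ⟨f₀, h₀, f₁, h₁, hb⟩ := h
  let e : ((triv.{u, 0} L).carrier →ₗ[ℂ] U.carrier) ≃ₗ[ℂ]
      ((triv.{u, 0} L).carrier →ₗ[ℂ] U'.carrier) :=
    LinearEquiv.arrowCongr (LinearEquiv.refl ℂ _) (LinearEquiv.ofBijective (f₀ + f₁) hb)
  have he : ∀ c z, e c z = f₀ (c z) + f₁ (c z) := fun c z => rfl
  have p0 := SuperSpace.parity_even h₀.1
  have p1 := SuperSpace.parity_odd h₁.1
  let Θ : CochainIso (triv.{u, 0} L) U (fun _ : Unit => triv.{u, 0} L) (fun _ => U') :=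
    { e := e.trans (LinearEquiv.funUnique Unit ℂ _).symm
      compat := fun s x hx c _ => by
        change e _ = U'.act x ∘ₗ twist (triv.{u, 0} L).toSuperSpace U'.toSuperSpace s
          (e c) - e c ∘ₗ (triv.{u, 0} L).act x
        have a0 := h₀.2 s x hx
        have a1 := h₁.2 s x hx
        refine LinearMap.ext fun z => ?_
        rcases zmod2_cases s with rfl | rfl
        · simp only [ksgn_zero_right, one_smul] at a0 a1
          simp [he, twist, a0, a1]
        · simp only [ksgn_zero_left, ksgn_one_one, one_smul, neg_smul] at a0 a1
          simp [he, twist, a0, a1, p0, p1] }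
  obtain ⟨E⟩ := Θ.nonempty_extEquiv p
  exact ⟨E.trans (LinearEquiv.funUnique Unit ℂ _)⟩

/-- Cohomology commutes with direct sums. -/
theorem nonempty_hEquiv_pi {ι : Type} (U : ι → Mod.{u, v} L) (p : ℕ) :
    Nonempty (H (Mod.pi U) p ≃ₗ[ℂ] ∀ i, H (U i) p) := by
  have ha : ∀ x y i, piEquiv U ((Mod.pi U).act x y) i = (U i).act x (piEquiv U y i) :=
    fun _ _ _ => rfl
  have hp : ∀ y i, piEquiv U ((Mod.pi U).toSuperSpace.parity y) i =
      (U i).toSuperSpace.parity (piEquiv U y i) :=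
    parity_pi_apply fun i => (U i).toSuperSpace
  let Θ : CochainIso (triv.{u, 0} L) (Mod.pi U) (fun _ : ι => triv.{u, 0} L) U :=
    { e := homPiEquiv (triv.{u, 0} L) U
      compat := fun s x hx c i => by
        refine LinearMap.ext fun z => ?_
        rcases zmod2_cases s with rfl | rfl
        · simp [homPiEquiv_apply, twist, ha]
        · simp [homPiEquiv_apply, twist, ha, hp] }
  exact Θ.nonempty_extEquiv p

/-- An isomorphism `Hom_ℂ(V, U)^{⊕ N} ≅ ⨁ T_j` induces one of `Ext^p(V, U)^{⊕ N}` with the sum of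
the cohomologies of the `T_j`. -/
theorem nonempty_extEquiv_of_iso {V U : Mod.{u, v} L} {N : ℕ} {ι : Type} {T : ι → Mod.{u, v} L}
    (h : (copies N (hom V U)).Iso (Mod.pi T)) (p : ℕ) :
    Nonempty ((Fin N → Ext V U p) ≃ₗ[ℂ] ∀ j, H (T j) p) := by
  obtain ⟨e₁⟩ := nonempty_extEquiv_hom V U p
  obtain ⟨e₂⟩ := nonempty_hEquiv_pi (fun _ : Fin N => hom V U) p
  obtain ⟨e₃⟩ := h.nonempty_hEquiv p
  obtain ⟨e₄⟩ := nonempty_hEquiv_pi T p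
  exact ⟨(LinearEquiv.piCongrRight fun _ => e₁).trans (e₂.symm.trans (e₃.trans e₄))⟩

end Ext

end LieSuper.Mod

/-! ### Iterated tensor products -/

namespace LieSuper.Mod

open SuperSpace

section TensorList

variable {L : LieSuper.{u}}

/-- `V₁ ⊗ (V₂ ⊗ (⋯ ⊗ ℂ))`, the form of `tensorList` that is suited to induction. -/
noncomputable def tensorR : List (Mod.{u, v} L) → Mod.{u, v} L
  | [] => triv L
  | V :: l => tensor V (tensorR l)

namespace UngradedIso

lemma of_eq {V W : Mod.{u, v} L} (h : V = W) : UngradedIso V W := h ▸ refl V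

lemma tensor_triv (V : Mod.{u, v} L) : UngradedIso (tensor V (triv.{u, v} L)) V :=
  (tensor_comm _ _).trans (triv_tensor V)

lemma foldl_tensor (V : Mod.{u, v} L) (l : List (Mod.{u, v} L)) :
    UngradedIso (l.foldl tensor V) (tensor V (tensorR l)) := by
  induction l generalizing V with
  | nil => exact (tensor_triv V).symm
  | cons W l ih => exact (ih (tensor V W)).trans (tensor_assoc _ _ _)

lemma tensorList_tensorR (l : List (Mod.{u, v} L)) : UngradedIso (tensorList l) (tensorR l) := by
  cases l with
  | nil => exact refl _
  | cons V l => exact foldl_tensor V l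

lemma foldl_tensor_congr {V W : Mod.{u, v} L} (h : UngradedIso V W) (l : List (Mod.{u, v} L)) :
    UngradedIso (l.foldl tensor V) (l.foldl tensor W) :=
  ((foldl_tensor V l).trans (tensor_left _ h)).trans (foldl_tensor W l).symm

lemma foldl_tensor_copies (n : ℕ) (V : Mod.{u, v} L) (l : List (Mod.{u, v} L)) :
    UngradedIso (l.foldl tensor (copies n V)) (copies n (l.foldl tensor V)) :=
  ((foldl_tensor _ l).trans (pi_tensor (fun _ : Fin n => V) _)).trans
    (copies_congr n (foldl_tensor V l).symm)

lemma tensorR_perm {l l' : List (Mod.{u, v} L)} (h : l.Perm l') :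
    UngradedIso (tensorR l) (tensorR l') := by
  induction h with
  | nil => exact refl _
  | cons V _ ih => exact tensor_right V ih
  | swap V W l =>
    exact ((tensor_assoc _ _ _).symm.trans (tensor_left _ (tensor_comm _ _))).trans
      (tensor_assoc _ _ _)
  | trans _ _ ih ih' => exact ih.trans ih'

variable {ι : Type t}

lemma tensorR_map_congr {f g : ι → Mod.{u, v} L} (h : ∀ i, UngradedIso (f i) (g i)) (l : List ι) :
    UngradedIso (tensorR (l.map f)) (tensorR (l.map g)) := by
  induction l with
  | nil => exact refl _
  | cons i l ih => exact tensor_congr (h i) ih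

/-- Trivial factors of a tensor product may be omitted. -/
lemma tensorR_filter (f : ι → Mod.{u, v} L) (p : ι → Prop) [DecidablePred p]
    (h : ∀ i, ¬ p i → UngradedIso (f i) (triv.{u, v} L)) (l : List ι) :
    UngradedIso (tensorR ((l.filter p).map f)) (tensorR (l.map f)) := by
  induction l with
  | nil => exact refl _
  | cons i l ih =>
    by_cases hi : p i
    · rw [List.filter_cons_of_pos (by simpa using hi)]
      exact tensor_right _ ih
    · rw [List.filter_cons_of_neg (by simpa using hi)]
      exact ih.trans ((triv_tensor _).symm.trans (tensor_left _ (h i hi).symm))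

lemma pullback_tensorR {L' : LieSuper.{w}} (φ : Hom L' L) (f : ι → Mod.{u, v} L) (l : List ι) :
    UngradedIso ((tensorR (l.map f)).pullback φ) (tensorR (l.map fun i => (f i).pullback φ)) := by
  induction l with
  | nil => exact refl (V := triv.{w, v} L')
  | cons i l ih => exact (pullback_tensor φ _ _).trans (tensor_right _ ih)

lemma _root_.LieSuper.Mod.finiteDimensional_tensorR (f : ι → Mod.{u, v} L)
    (hf : ∀ i, FiniteDimensional ℂ (f i)) (l : List ι) :
    FiniteDimensional ℂ (tensorR (l.map f)) := by
  induction l with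
  | nil => exact Module.Finite.equiv (trivEquiv.{u, v} L).symm
  | cons i l ih =>
    have := hf i
    exact inferInstanceAs (FiniteDimensional ℂ ((f i).carrier ⊗[ℂ] (tensorR (l.map f)).carrier))

/-- For finite-dimensional `f i`, the space of linear maps between tensor products is formed factor
by factor. -/
lemma hom_tensorR (f g : ι → Mod.{u, v} L) (hf : ∀ i, FiniteDimensional ℂ (f i)) (l : List ι) :
    UngradedIso (hom (tensorR (l.map f)) (tensorR (l.map g)))
      (tensorR (l.map fun i => hom (f i) (g i))) := by
  induction l with
  | nil => exact hom_triv_triv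
  | cons i l ih =>
    have := hf i
    have := finiteDimensional_tensorR f hf l
    exact (hom_tensor_hom _ _ _ _).symm.trans (tensor_right _ ih)

lemma tensorR_pi {l : ℕ} (q : Fin l → ℕ) (T : ∀ i, Fin (q i) → Mod.{u, v} L) :
    UngradedIso (tensorR (List.ofFn fun i => Mod.pi (T i)))
      (Mod.pi fun j : ∀ i, Fin (q i) => tensorR (List.ofFn fun i => T i (j i))) := by
  induction l with
  | zero =>
    have h : ∀ j : ∀ i, Fin (q i), tensorR (List.ofFn fun i => T i (j i)) = triv.{u, v} L :=
      fun j => by rw [List.ofFn_zero]; rfl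
    rw [List.ofFn_zero]
    refine trans ?_ (pi_congr fun j => of_eq (h j).symm)
    exact symm ⟨LinearEquiv.funUnique (∀ i : Fin 0, Fin (q i)) ℂ (triv.{u, v} L).carrier,
      fun _ _ => rfl⟩
  | succ l ih =>
    have e : ∀ p : Fin (q 0) × (∀ i : Fin l, Fin (q i.succ)),
        tensorR (List.ofFn fun i => T i (Fin.consEquiv (fun i => Fin (q i)) p i)) =
        tensor (T 0 p.1) (tensorR (List.ofFn fun i => T i.succ (p.2 i))) := fun p => by
      rw [List.ofFn_succ]; rfl
    rw [List.ofFn_succ]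
    refine ((pi_tensor (T 0) _).trans (pi_congr fun j => (tensor_right _
      (ih (fun i => q i.succ) fun i => T i.succ)).trans (tensor_pi _ _))).trans ?_
    refine (pi_pi _).trans (trans (pi_congr fun p => of_eq (e p).symm) ?_)
    exact pi_equiv (Fin.consEquiv fun i => Fin (q i))
      (fun j => tensorR (List.ofFn fun i => T i (j i)))

end UngradedIso

end TensorList

/-! ### Iterated irreducible products -/

section Kappa

variable {ι : Type t} {g : ι → LieSuper.{u}}

/-- Only the summands in `s` of a direct sum of Lie superalgebras act on `V`. -/
def SupportedOn (V : Mod.{max u t, v} (LieSuper.pi g)) (s : Set ι) : Prop :=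
  ∀ i, ∀ x ∈ (LieSuper.pi g).gr i, (∀ k ∈ s, x k = 0) → V.act x = 0

/-- An element may be cut off to the summands acting on `V`, and then acts by zero on `W`. -/
lemma SupportedOn.exists_act {V : Mod.{max u t, v} (LieSuper.pi g)}
    {W : Mod.{max u t, w} (LieSuper.pi g)} {s s' : Set ι} (hV : V.SupportedOn s)
    (hW : W.SupportedOn s') (h : Disjoint s s') (i : ZMod 2) (x : LieSuper.pi g)
    (hx : x ∈ (LieSuper.pi g).gr i) :
    ∃ y ∈ (LieSuper.pi g).gr i, V.act y = V.act x ∧ W.act y = 0 := by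
  classical
  let y : LieSuper.pi g := fun k => if k ∈ s then x k else 0
  have hy : y ∈ (LieSuper.pi g).gr i := fun k _ => by
    change (if k ∈ s then x k else 0) ∈ (g k).gr i
    split_ifs
    · exact hx k trivial
    · exact Submodule.zero_mem _
  refine ⟨y, hy, ?_, hW i y hy fun k hk => ?_⟩
  · rw [← sub_eq_zero, ← map_sub]
    refine hV i _ (Submodule.sub_mem _ hy hx) fun k hk => ?_
    change (if k ∈ s then x k else 0) - x k = 0
    rw [if_pos hk, sub_self]
  · exact if_neg fun hk' => Set.disjoint_left.1 h hk' hk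

lemma SupportedOn.actIndependently {V : Mod.{max u t, v} (LieSuper.pi g)}
    {W : Mod.{max u t, w} (LieSuper.pi g)} {s s' : Set ι} (hV : V.SupportedOn s)
    (hW : W.SupportedOn s') (h : Disjoint s s') : ActIndependently V W where
  left := hV.exists_act hW h
  right i x hx := by
    obtain ⟨y, hy, h1, h2⟩ := hW.exists_act hV h.symm i x hx
    exact ⟨y, hy, h2, h1⟩

/-- Passing from `P ⊗ V` to the irreducible product doubles the multiplicity whenever both `P` and
`V` have odd endomorphisms; `kappaAux` counts these doublings. -/
lemma foldl_tensor_irrProd (V : ι → Mod.{max u t, v} (LieSuper.pi g))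
    (hfd : ∀ i, FiniteDimensional ℂ (V i)) (hV : ∀ i, ∃ α, (V i).IsSchur α)
    (hs : ∀ i, (V i).SupportedOn {i}) (l : List ι) (hl : l.Nodup)
    (P : Mod.{max u t, v} (LieSuper.pi g)) [FiniteDimensional ℂ P] (hP : ∃ γ, P.IsSchur γ)
    (s : Set ι) (hPs : P.SupportedOn s) (hls : ∀ i ∈ l, i ∉ s) :
    UngradedIso ((l.map V).foldl tensor P)
      (copies (2 ^ kappaAux P (l.map V)) ((l.map V).foldl irrProd P)) := by
  induction l generalizing P s with
  | nil => exact (UngradedIso.copies_one P).symm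
  | cons i l ih =>
    obtain ⟨α, hα⟩ := hV i
    obtain ⟨γ, hγ⟩ := hP
    have := hfd i
    have hi : i ∉ s := hls i (by simp)
    obtain ⟨hQ, hQfd, hact, hiso⟩ := hγ.irrProd_spec hα
      (hPs.actIndependently (hs i) (Set.disjoint_singleton_right.2 hi))
    have hQs : (irrProd P (V i)).SupportedOn (s ∪ {i}) := fun j x hx h0 => by
      refine hact x (TensorProduct.ext' fun v y => ?_)
      rw [tensorAct_of_mem _ _ hx, hPs j x hx fun k hk => h0 k (Or.inl hk),
        hs i j x hx fun k hk => h0 k (Or.inr hk)]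
      simp
    have ih' := ih (List.nodup_cons.1 hl).2 (irrProd P (V i)) hQ (s ∪ {i}) hQs fun k hk hk' => by
      rcases hk' with hk' | hk'
      · exact hls k (by simp [hk]) hk'
      · rw [Set.mem_singleton_iff] at hk'
        exact (List.nodup_cons.1 hl).1 (hk' ▸ hk)
    rw [List.map_cons, List.foldl_cons, List.foldl_cons, kappaAux, pow_add]
    exact ((UngradedIso.foldl_tensor_congr hiso _).trans
      (UngradedIso.foldl_tensor_copies _ _ _)).trans
      ((UngradedIso.copies_congr _ ih').trans (UngradedIso.copies_copies _ _ _))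

/-- The tensor product of modules over different summands is a sum of `2 ^ κ` copies of their
irreducible product. -/
theorem tensorR_irrProdList (V : ι → Mod.{max u t, v} (LieSuper.pi g))
    (hfd : ∀ i, FiniteDimensional ℂ (V i)) (hV : ∀ i, ∃ α, (V i).IsSchur α)
    (hs : ∀ i, (V i).SupportedOn {i}) (l : List ι) (hl : l.Nodup) :
    UngradedIso (tensorR (l.map V)) (copies (2 ^ kappa (l.map V)) (irrProdList (l.map V))) := by
  cases l with
  | nil => exact (UngradedIso.copies_one _).symm
  | cons i l =>
    have := hfd i
    refine (UngradedIso.foldl_tensor _ _).symm.trans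
      (foldl_tensor_irrProd V hfd hV hs l (List.nodup_cons.1 hl).2 (V i) (hV i) {i} (hs i)
        fun k hk hk' => ?_)
    rw [Set.mem_singleton_iff] at hk'
    exact (List.nodup_cons.1 hl).1 (hk' ▸ hk)

end Kappa

end LieSuper.Mod

/-! ### Decomposition into indecomposable modules -/

namespace LieSuper.Mod

open SuperSpace

section Indecomposable

variable {L : LieSuper.{u}}

/-- If `N` and `N'` are complementary submodules of `V` that are direct sums of the `T i` and of the
`T' i`, then `V` is the direct sum of all of these. -/
lemma UngradedIso.of_isCompl {V : Mod.{u, v} L} {N N' : Submodule ℂ V} (hN : V.IsSubmodule N)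
    (hN' : V.IsSubmodule N') (h : IsCompl N N') {ι ι' : Type} {T : ι → Mod.{u, v} L}
    {T' : ι' → Mod.{u, v} L} (hT : UngradedIso (V.sub N hN) (Mod.pi T))
    (hT' : UngradedIso (V.sub N' hN') (Mod.pi T')) :
    UngradedIso V (Mod.pi (Sum.elim T T')) := by
  obtain ⟨e, he⟩ := hT.symm
  obtain ⟨e', he'⟩ := hT'.symm
  let s : (∀ i, (Sum.elim T T' i).carrier) ≃ₗ[ℂ] (∀ i, (T i).carrier) × (∀ i, (T' i).carrier) :=
    LinearEquiv.sumPiEquivProdPi ℂ ι ι' fun i => (Sum.elim T T' i).carrier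
  let f : (Mod.pi T).carrier ≃ₗ[ℂ] N := e
  let f' : (Mod.pi T').carrier ≃ₗ[ℂ] N' := e'
  refine UngradedIso.symm ⟨s.trans ((LinearEquiv.prodCongr f f').trans
    (Submodule.prodEquivOfIsCompl N N' h)), fun x y => ?_⟩
  have h1 := congrArg Subtype.val (he x fun i => y (Sum.inl i))
  have h2 := congrArg Subtype.val (he' x fun i => y (Sum.inr i))
  exact (congrArg₂ (· + ·) h1 h2).trans (map_add (V.act x) _ _).symm

/-- A nonzero finite-dimensional module is a nonempty finite direct sum of indecomposable ones. -/
theorem exists_indecomposable_decomposition (V : Mod.{u, v} L) [FiniteDimensional ℂ V]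
    [Nontrivial V] : ∃ (q : ℕ) (T : Fin q → Mod.{u, v} L), 0 < q ∧
      (∀ j, FiniteDimensional ℂ (T j) ∧ (T j).IsIndecomposable) ∧ UngradedIso V (Mod.pi T) := by
  suffices h : ∀ (d : ℕ) (V : Mod.{u, v} L), FiniteDimensional ℂ V → Nontrivial V →
      Module.finrank ℂ V = d → ∃ (ι : Type) (T : ι → Mod.{u, v} L), Finite ι ∧ Nonempty ι ∧
        (∀ i, FiniteDimensional ℂ (T i) ∧ (T i).IsIndecomposable) ∧ UngradedIso V (Mod.pi T) by
    obtain ⟨ι, T, _, _, hT, hV⟩ := h _ V inferInstance inferInstance rfl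
    have e := (Finite.equivFin ι).symm
    exact ⟨Nat.card ι, fun j => T (e j), Nat.card_pos, fun j => hT (e j),
      hV.trans (UngradedIso.pi_equiv e T).symm⟩
  intro d
  induction d using Nat.strong_induction_on with
  | _ d ih =>
    intro V _ hnt hd
    by_cases hV : V.IsIndecomposable
    · exact ⟨Unit, fun _ => V, inferInstance, inferInstance, fun _ => ⟨inferInstance, hV⟩,
        UngradedIso.symm ⟨LinearEquiv.funUnique Unit ℂ V.carrier, fun _ _ => rfl⟩⟩
    obtain ⟨N, N', hN, hN', hc, h0, h0'⟩ : ∃ N N' : Submodule ℂ V, V.IsSubmodule N ∧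
        V.IsSubmodule N' ∧ IsCompl N N' ∧ N ≠ ⊥ ∧ N' ≠ ⊥ := by
      by_contra! h
      exact hV ⟨hnt, fun N N' hN hN' hc => or_iff_not_imp_left.2 (h N N' hN hN' hc)⟩
    have hsum := Submodule.finrank_add_eq_of_isCompl hc
    have hpos : 0 < Module.finrank ℂ N := Submodule.one_le_finrank_iff.2 h0
    have hpos' : 0 < Module.finrank ℂ N' := Submodule.one_le_finrank_iff.2 h0'
    obtain ⟨ι, T, _, _, hT, hi⟩ := ih (Module.finrank ℂ N) (by omega) (V.sub N hN)
      (inferInstanceAs (FiniteDimensional ℂ N)) ((Submodule.nontrivial_iff_ne_bot).2 h0) rfl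
    obtain ⟨ι', T', _, _, hT', hi'⟩ := ih (Module.finrank ℂ N') (by omega) (V.sub N' hN')
      (inferInstanceAs (FiniteDimensional ℂ N')) ((Submodule.nontrivial_iff_ne_bot).2 h0') rfl
    refine ⟨ι ⊕ ι', Sum.elim T T', inferInstance, inferInstance, ?_,
      UngradedIso.of_isCompl hN hN' hc hi hi'⟩
    rintro (i | i)
    exacts [hT i, hT' i]

end Indecomposable

/-! ### Pull-backs of irreducible modules -/

section Pullback

lemma IsIrreducible.pullback {L : LieSuper.{u}} {L' : LieSuper.{w}} {V : Mod.{u, v} L}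
    (hV : V.IsIrreducible) (φ : Hom L' L) (hφ : Function.Surjective φ.toLin) :
    (V.pullback φ).IsIrreducible where
  nontrivial := hV.nontrivial
  eq_bot_or_eq_top N hN := hV.eq_bot_or_eq_top N ⟨hN.graded, fun x n hn => by
    obtain ⟨y, rfl⟩ := hφ x
    exact hN.act_mem y n hn⟩

variable {ι : Type t} {g : ι → LieSuper.{u}}

lemma _root_.LieSuper.piProj_surjective (i : ι) : Function.Surjective (piProj g i).toLin :=
  Function.surjective_eval i

lemma supportedOn_pullback_piProj (i : ι) (V : Mod.{u, v} (g i)) :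
    (V.pullback (piProj g i)).SupportedOn {i} := fun _ x _ h => by
  change V.act (x i) = 0
  rw [h i rfl, map_zero]

end Pullback

end LieSuper.Mod

/-! ### Orbits of maximal ideals -/

namespace LieSuper

section Orbits

variable {A : Type v} [CommRing A] [Algebra ℂ A] {Γ : Type t} [Group Γ] (τ : Γ →* (A ≃ₐ[ℂ] A))

lemma maxMap_one (m : MaximalSpectrum A) : maxMap (τ 1) m = m := by
  refine MaximalSpectrum.ext ?_
  change m.asIdeal.map (τ 1) = m.asIdeal
  rw [map_one]
  exact Ideal.map_id _

lemma maxMap_maxMap (γ δ : Γ) (m : MaximalSpectrum A) :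
    maxMap (τ γ) (maxMap (τ δ) m) = maxMap (τ (γ * δ)) m := by
  refine MaximalSpectrum.ext ?_
  change (m.asIdeal.map (τ δ)).map (τ γ) = m.asIdeal.map (τ (γ * δ))
  rw [map_mul]
  exact Ideal.map_map (τ δ : A →+* A) (τ γ : A →+* A)

lemma eq_maxMap_inv {γ : Γ} {m m' : MaximalSpectrum A} (h : maxMap (τ γ) m = m') :
    maxMap (τ γ⁻¹) m' = m := by
  rw [← h, maxMap_maxMap, inv_mul_cancel, maxMap_one]

/-- Representatives of the orbits that meet a given finite set of maximal ideals. -/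
lemma exists_orbit_representatives (F : Set (MaximalSpectrum A)) (hF : F.Finite)
    (hne : F.Nonempty) : ∃ (l : ℕ) (m : Fin l → MaximalSpectrum A), 0 < l ∧
      (∀ i j, i ≠ j → ∀ γ : Γ, maxMap (τ γ) (m i) ≠ m j) ∧
      ∀ m' ∈ F, ∃ k, ∃ γ : Γ, maxMap (τ γ) m' = m k := by
  let s : Setoid (MaximalSpectrum A) :=
    { r := fun m m' => ∃ γ : Γ, maxMap (τ γ) m = m'
      iseqv := ⟨fun m => ⟨1, maxMap_one τ m⟩, fun ⟨γ, h⟩ => ⟨γ⁻¹, eq_maxMap_inv τ h⟩,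
        fun ⟨γ, h⟩ ⟨δ, h'⟩ => ⟨δ * γ, by rw [← maxMap_maxMap, h, h']⟩⟩ }
  have : Finite (Quotient.mk s '' F) := hF.image _
  have : Nonempty (Quotient.mk s '' F) := (hne.image _).to_subtype
  let e := (Finite.equivFin (Quotient.mk s '' F)).symm
  refine ⟨Nat.card (Quotient.mk s '' F), fun k => (e k).1.out, Nat.card_pos, ?_, ?_⟩
  · intro i j hij γ h
    refine hij (e.injective (Subtype.ext ?_))
    rw [← (e i).1.out_eq, ← (e j).1.out_eq]
    exact Quotient.sound ⟨γ, h⟩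
  · intro m' hm'
    have h := Set.mem_image_of_mem (Quotient.mk s) hm'
    refine ⟨e.symm ⟨_, h⟩, ?_⟩
    change ∃ γ, maxMap (τ γ) m' = (e (e.symm ⟨_, h⟩)).1.out
    rw [Equiv.apply_symm_apply]
    exact s.symm (Quotient.mk_out (s := s) m')

end Orbits

end LieSuper

/-! ### Evaluation modules -/

namespace LieSuper.Param

open LieSuper.Mod

section Evaluation

variable {g : LieSuper.{u}} {A : Type v} [CommRing A] [Algebra ℂ A] {Γ : Type t} [Group Γ]
  {σ : Action Γ g} {τ : Γ →* (A ≃ₐ[ℂ] A)}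

/-- The `(g ⊗ A)^Γ`-module `ev^Γ π(m)`. -/
noncomputable def evRep (π : Param.{u, v, w, t} σ τ) (m : MaximalSpectrum A) :
    Mod.{max u v, w} (equivMap σ τ) :=
  (π.rep m).pullback (evΓ σ τ (m.asIdeal ^ π.n m))

variable (π : Param.{u, v, w, t} σ τ)

/-- Elements of `Γ` fix `(g ⊗ A)^Γ`, so that its evaluation modules depend on orbits only. -/
lemma evRep_maxMap (γ : Γ) (m : MaximalSpectrum A) :
    UngradedIso (π.evRep (maxMap (τ γ) m)) (π.evRep m) := by
  obtain ⟨e, he⟩ := (iso_iff_ungradedIso.1 (π.equivariant γ m)).pullback (σ.map τ).incl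
  refine ⟨e, fun x v => (he x v).trans ?_⟩
  have hx := x.2
  simp only [Submodule.mem_iInf, LinearMap.mem_eqLocus, LinearMap.id_apply] at hx
  change (π.rep m).act ((ev g _).toLin (((σ.map τ).toHom γ⁻¹).toLin x.1)) (e v) =
    (π.rep m).act ((ev g _).toLin x.1) (e v)
  rw [hx γ⁻¹]

lemma evRep_ungradedIso_of_eq {γ : Γ} {m m' : MaximalSpectrum A} (h : maxMap (τ γ) m = m') :
    UngradedIso (π.evRep m) (π.evRep m') := h ▸ (π.evRep_maxMap γ m).symm

lemma evRep_of_notMem_support {m : MaximalSpectrum A} (h : m ∉ π.support) :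
    UngradedIso (π.evRep m) (Mod.triv.{max u v, w} _) :=
  (iso_iff_ungradedIso.1 (not_not.1 h)).pullback (evΓ σ τ (m.asIdeal ^ π.n m))

variable {π}

/-- `2 ^ κ(π)` copies of `𝒱(π)` make up the ordinary tensor product of the evaluation modules at
any points of distinct orbits, provided that every orbit in the support is represented. -/
theorem SuppStar.copies_irrMod (S : π.SuppStar) {l : ℕ} (m : Fin l → MaximalSpectrum A)
    (hm : ∀ i j, i ≠ j → ∀ γ : Γ, maxMap (τ γ) (m i) ≠ m j)
    (hS : ∀ i, ∃ k, ∃ γ : Γ, maxMap (τ γ) (S.m i) = m k) :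
    UngradedIso (copies (2 ^ S.kappa) S.irrMod)
      (tensorR ((List.finRange l).map fun k => π.evRep (m k))) := by
  classical
  choose e γ he using hS
  have he_inj : Function.Injective e := fun i j hij => by
    by_contra h
    refine S.distinct_orbits i j h ((γ j)⁻¹ * γ i) ?_
    rw [← maxMap_maxMap, he i, hij]
    exact eq_maxMap_inv τ (he j)
  let V : Fin S.l → Mod.{max u v, w} S.alg := fun i => (π.rep (S.m i)).pullback (piProj _ i)
  have hfd : ∀ i, FiniteDimensional ℂ (V i) := fun i => π.finiteDimensional (S.m i)
  have hV : ∀ i, ∃ α, (V i).IsSchur α := fun i =>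
    have := hfd i
    ((π.irreducible (S.m i)).pullback _ (piProj_surjective i)).exists_isSchur
  have hmods : S.mods = (List.finRange S.l).map V := List.ofFn_eq_map
  have h1 : UngradedIso (L := S.alg) (tensorR ((List.finRange S.l).map V))
      (copies (2 ^ Mod.kappa ((List.finRange S.l).map V))
        (irrProdList ((List.finRange S.l).map V))) :=
    tensorR_irrProdList V hfd hV (fun i => supportedOn_pullback_piProj i _) _
      (List.nodup_finRange _)
  have h2 : UngradedIso (copies (2 ^ S.kappa) S.irrMod)
      ((tensorR ((List.finRange S.l).map V)).pullback S.ev) := by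
    rw [← hmods] at h1 ⊢
    exact h1.symm.pullback S.ev
  have h3 : UngradedIso ((tensorR ((List.finRange S.l).map V)).pullback S.ev)
      (tensorR ((List.finRange S.l).map fun i => π.evRep (S.m i))) :=
    UngradedIso.pullback_tensorR S.ev V _
  have h4 := UngradedIso.tensorR_map_congr
    (fun i => π.evRep_ungradedIso_of_eq (he i)) (List.finRange S.l)
  -- the chosen points outside the orbits of the support carry trivial modules
  have h5 := UngradedIso.tensorR_filter (fun k => π.evRep (m k)) (fun k => k ∈ Set.range e)
    (fun k hk => π.evRep_of_notMem_support fun hk' => hk <| by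
      obtain ⟨i, δ, hi⟩ := S.meets_orbits _ hk'
      refine ⟨i, ?_⟩
      by_contra h
      refine hm (e i) k h (δ * (γ i)⁻¹) ?_
      rw [← maxMap_maxMap, eq_maxMap_inv τ (he i), hi]) (List.finRange l)
  have h6 : ((List.finRange S.l).map e).Perm
      ((List.finRange l).filter fun k => k ∈ Set.range e) := by
    rw [List.perm_ext_iff_of_nodup ((List.nodup_finRange _).map he_inj)
      ((List.nodup_finRange _).filter _)]
    simp
  have h7 := UngradedIso.tensorR_perm (h6.map fun k => π.evRep (m k))
  rw [List.map_map] at h7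
  exact (((h2.trans h3).trans h4).trans h7).trans h5

end Evaluation

section Level

variable {g : LieSuper.{u}} {A : Type v} [CommRing A] [Algebra ℂ A]

/-- The homomorphism `g ⊗ A/I → g ⊗ A/J` for `I ⊆ J`. -/
noncomputable def factorHom (g : LieSuper.{u}) {I J : Ideal A} (h : I ≤ J) :
    Hom (mapAlg g (A ⧸ I)) (mapAlg g (A ⧸ J)) :=
  mapAlgMap (Hom.id g) (Ideal.Quotient.factorₐ ℂ h)

variable {Γ : Type t} [Group Γ] {σ : Action Γ g} {τ : Γ →* (A ≃ₐ[ℂ] A)}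

lemma factorHom_evΓ {I J : Ideal A} (h : I ≤ J) (x : equivMap σ τ) :
    (factorHom g h).toLin ((evΓ σ τ I).toLin x) = (evΓ σ τ J).toLin x := by
  have h' : TensorProduct.map (Hom.id g).toLin (Ideal.Quotient.factorₐ ℂ h).toLinearMap ∘ₗ
      TensorProduct.map (Hom.id g).toLin (Ideal.Quotient.mkₐ ℂ I).toLinearMap =
        TensorProduct.map (Hom.id g).toLin (Ideal.Quotient.mkₐ ℂ J).toLinearMap := by
    rw [← TensorProduct.map_comp]
    rfl
  exact LinearMap.congr_fun h' ((σ.map τ).incl.toLin x)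

lemma pullback_factorHom {I J : Ideal A} (h : I ≤ J)
    (V : Mod.{max u v, w} (mapAlg g (A ⧸ J))) :
    UngradedIso ((V.pullback (factorHom g h)).pullback (evΓ σ τ I)) (V.pullback (evΓ σ τ J)) :=
  ⟨LinearEquiv.refl ℂ V.carrier, fun x v =>
    congrArg (fun y => V.act y v) (factorHom_evΓ h x)⟩

/-- `Hom(π(m), π'(m))` is a module over `g ⊗ A/m^n` for every sufficiently large `n`, and decomposes
as such. -/
lemma exists_decomposition_hom (π π' : Param.{u, v, w, t} σ τ) (m : MaximalSpectrum A) {n : ℕ}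
    (h : π.n m ≤ n) (h' : π'.n m ≤ n) :
    ∃ (q : ℕ) (M : Fin q → Mod.{max u v, w} (mapAlg g (A ⧸ m.asIdeal ^ n))), 0 < q ∧
      (∀ j, FiniteDimensional ℂ (M j) ∧ (M j).IsIndecomposable) ∧
      UngradedIso ((π.evRep m).hom (π'.evRep m))
        (Mod.pi fun j => (M j).pullback (evΓ σ τ (m.asIdeal ^ n))) := by
  have := π.finiteDimensional m
  have := π'.finiteDimensional m
  have := (π.irreducible m).nontrivial
  have := (π'.irreducible m).nontrivial
  let V := (π.rep m).pullback (factorHom g (Ideal.pow_le_pow_right (I := m.asIdeal) h))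
  let V' := (π'.rep m).pullback (factorHom g (Ideal.pow_le_pow_right (I := m.asIdeal) h'))
  have : FiniteDimensional ℂ (V.hom V') :=
    inferInstanceAs (FiniteDimensional ℂ ((π.rep m).carrier →ₗ[ℂ] (π'.rep m).carrier))
  have : Nontrivial (V.hom V') :=
    inferInstanceAs (Nontrivial ((π.rep m).carrier →ₗ[ℂ] (π'.rep m).carrier))
  obtain ⟨q, M, hq, hM, hiso⟩ := exists_indecomposable_decomposition (V.hom V')
  exact ⟨q, M, hq, hM, (UngradedIso.hom_congr (pullback_factorHom _ _).symm
    (pullback_factorHom _ _).symm).trans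
      ((UngradedIso.pullback_hom _ _ _).symm.trans (hiso.pullback _))⟩

end Level

end LieSuper.Param

/-! ### The decomposition of `Hom` and `Ext` -/

theorem mainTheorem5
    (g : LieSuper.{u}) [FiniteDimensional ℂ g] (hg : g.IsSimple)
    (A : Type v) [CommRing A] [Nontrivial A] [Algebra ℂ A] [Algebra.FiniteType ℂ A]
    (Γ : Type t) [CommGroup Γ] [Finite Γ]
    (σ : LieSuper.Action Γ g) (τ : Γ →* (A ≃ₐ[ℂ] A))
    (hfree : ∀ (γ : Γ) (m : MaximalSpectrum A), LieSuper.maxMap (τ γ) m = m → γ = 1)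
    (π π' : LieSuper.Param.{u, v, w, t} σ τ) (S : π.SuppStar) (S' : π'.SuppStar) :
    ∃ (n l : ℕ) (q : Fin l → ℕ) (m : Fin l → MaximalSpectrum A)
      (M : ∀ i, Fin (q i) → LieSuper.Mod.{max u v, w} (LieSuper.mapAlg g (A ⧸ (m i).asIdeal ^ n))),
      0 < n ∧ 0 < l ∧ (∀ i, 0 < q i) ∧
      (∀ i j, i ≠ j → ∀ γ : Γ, LieSuper.maxMap (τ γ) (m i) ≠ m j) ∧
      (∀ i j, FiniteDimensional ℂ (M i j) ∧ (M i j).IsIndecomposable) ∧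
      (LieSuper.Mod.copies (2 ^ (S.kappa + S'.kappa)) (S.irrMod.hom S'.irrMod)).Iso
        (LieSuper.Mod.pi fun j : ∀ i, Fin (q i) => LieSuper.Mod.tensorList
          (List.ofFn fun i => (M i (j i)).pullback (LieSuper.evΓ σ τ ((m i).asIdeal ^ n)))) ∧
      ∀ p : ℕ, 0 < p →
        Nonempty ((Fin (2 ^ (S.kappa + S'.kappa)) → LieSuper.Mod.Ext S.irrMod S'.irrMod p) ≃ₗ[ℂ]
          ∀ j : ∀ i, Fin (q i), LieSuper.Mod.H (LieSuper.Mod.tensorList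
            (List.ofFn fun i =>
              (M i (j i)).pullback (LieSuper.evΓ σ τ ((m i).asIdeal ^ n)))) p) := by
  obtain ⟨m₀⟩ : Nonempty (MaximalSpectrum A) := inferInstance
  -- The ideal `m₀` ensures that there is a representative even if both supports are empty.
  obtain ⟨l, m, hl, hm, hF⟩ := LieSuper.exists_orbit_representatives τ
    ({m₀} ∪ (Set.range S.m ∪ Set.range S'.m))
    ((Set.finite_singleton m₀).union ((Set.finite_range _).union (Set.finite_range _)))
    ⟨m₀, by simp⟩
  let n := ∑ k, (π.n (m k) + π'.n (m k))
  have hle : ∀ k, π.n (m k) + π'.n (m k) ≤ n := fun k =>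
    Finset.single_le_sum (f := fun k => π.n (m k) + π'.n (m k)) (fun _ _ => Nat.zero_le _)
      (Finset.mem_univ k)
  have hn : 0 < n := by
    have := hle ⟨0, hl⟩
    have := π.n_pos (m ⟨0, hl⟩)
    omega
  choose q M hq hM hk using fun k => π.exists_decomposition_hom π' (m k)
    ((Nat.le_add_right _ _).trans (hle k)) ((Nat.le_add_left _ _).trans (hle k))
  have h1 := (LieSuper.Mod.UngradedIso.hom_copies (2 ^ S.kappa) (2 ^ S'.kappa) S.irrMod
    S'.irrMod).symm.trans (LieSuper.Mod.UngradedIso.hom_congr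
      (S.copies_irrMod m hm fun i => hF _ (by simp))
      (S'.copies_irrMod m hm fun i => hF _ (by simp)))
  have h2 := (h1.trans (LieSuper.Mod.UngradedIso.hom_tensorR (fun k => π.evRep (m k))
    (fun k => π'.evRep (m k)) (fun k => π.finiteDimensional (m k)) _)).trans
    (LieSuper.Mod.UngradedIso.tensorR_map_congr hk _)
  rw [← List.ofFn_eq_map, ← pow_add] at h2
  have h3 := LieSuper.Mod.iso_iff_ungradedIso.2
    ((h2.trans (LieSuper.Mod.UngradedIso.tensorR_pi q _)).trans
      (LieSuper.Mod.UngradedIso.pi_congr fun j =>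
        (LieSuper.Mod.UngradedIso.tensorList_tensorR _).symm))
  exact ⟨n, l, q, m, M, hn, hl, hq, hm, hM, h3, fun p _ =>
    LieSuper.Mod.nonempty_extEquiv_of_iso h3 p⟩
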